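/- Let $n\ge 1$, let $R'=\mathbb Q[x_1,\dots,x_6]$ with $\deg x_i=2$, and $w=x_1^{n+1}+x_2^{n+1}+x_3^{n+1}-x_4^{n+1}-x_5^{n+1}-x_6^{n+1}$. A graded factorization of $w$ consists of free graded $R'$-modules $M^0,M^1$ (of any rank) and maps $M^0\xrightarrow{d}M^1\xrightarrow{d}M^0$ of degree $n+1$ with $d^2=w$. Let $\mathrm{hmf}_w$ be the category whose objects are the graded factorizations $M$ of $w$ for which the cohomology of the 2-periodic complex $M/(x_1,\dots,x_6)M$ is finite-dimensional over $\mathbb Q$, and whose morphisms are the degree $0$ maps commuting with $d$, modulo homotopies of degree $-n-1$. $\{m\}$ denotes the grading shift up by $m$. For a graded polynomial ring $R$ and homogeneous $a,b\in R$ with $\deg a+\deg b=2(n+1)$ let $\{a,b\}$ be $R\xrightarrow{a}R\{n+1-\deg a\}\xrightarrow{b}R$, and let $\{(a_1,\dots,a_m),(b_1,\dots,b_m)\}=\bigotimes_i\{a_i,b_i\}$ (over $R$). Let $g$ be the polynomial with $g(x+y,xy)=x^{n+1}+y^{n+1}$. To a wide edge with outgoing marks $i,j$ and incoming marks $k,l$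 assign $$C(i,j;k,l)=\{(u_1,u_2),(x_i+x_j-x_k-x_l,\;x_ix_j-x_kx_l)\}\{-1\},$$ $$u_1=\frac{g(x_i+x_j,x_ix_j)-g(x_k+x_l,x_ix_j)}{x_i+x_j-x_k-x_l},\qquad u_2=\frac{g(x_k+x_l,x_ix_j)-g(x_k+x_l,x_kx_l)}{x_ix_j-x_kx_l},$$ and to an arc oriented from the mark $j$ to the mark $i$ assign $L^i_j=\{\frac{x_i^{n+1}-x_j^{n+1}}{x_i-x_j},\,x_i-x_j\}$. For a planar graph $\Gamma$ with marks, $C(\Gamma)$ is the tensor product of the factorizations of all its wide edges and arcs over the polynomial ring in the variables of all marks, regarded as a factorization over the polynomial ring in the variables of the boundary points. Let $\Gamma_1,\Gamma_2,\Gamma_3,\Gamma_4$ be the graphs with boundary points $1,2,3$ (outgoing) and $4,5,6$ (incoming), the first and the third having also internal marks $7,8,9$, for which $$C(\Gamma_1)=C(1,2;7,8)\otimes C(8,3;9,6)\otimes C(7,9;4,5),\qquad C(\Gamma_2)=C(2,3;5,6)\otimes L^1_4,$$ $$C(\Gamma_3)=C(2,3;7,8)\otimes C(1,7;4,9)\otimes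 C(9,8;5,6),\qquad C(\Gamma_4)=C(1,2;4,5)\otimes L^3_6.$$ Let $s_1,s_2,s_3$ be the elementary symmetric functions of $x_1,x_2,x_3$ and $s_4,s_5,s_6$ those of $x_4,x_5,x_6$, let $h$ be the polynomial with $h(s_1,s_2,s_3)=x_1^{n+1}+x_2^{n+1}+x_3^{n+1}$, and put $\alpha_1=s_1-s_4$, $\alpha_2=s_2-s_5$, $\alpha_3=s_3-s_6$, $$v_1=\frac{h(s_1,s_2,s_3)-h(s_4,s_2,s_3)}{s_1-s_4},\quad v_2=\frac{h(s_4,s_2,s_3)-h(s_4,s_5,s_3)}{s_2-s_5},\quad v_3=\frac{h(s_4,s_5,s_3)-h(s_4,s_5,s_6)}{s_3-s_6},$$ where $v_i$ is given degree $2(n+1)-2i$, and $\Upsilon=\{(v_1,v_2,v_3),(\alpha_1,\alpha_2,\alpha_3)\}\{-3\}$ over $R'$. Then there are isomorphisms in $\mathrm{hmf}_w$ $$C(\Gamma_1)\cong\Upsilon\oplus C(\Gamma_4)\qquad\text{and}\qquad C(\Gamma_1)\oplus C(\Gamma_2)\cong C(\Gamma_3)\oplus C(\Gamma_4).$$ 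-/

import Mathlib

open MvPolynomial CategoryTheory

noncomputable section

namespace KhovanovRozansky

/-! ## Graded polynomial rings and free graded modules -/

/-- `p` is homogeneous of degree `k`, all variables having degree `2`; the zero polynomial is
homogeneous of every degree. -/
def IsHomog {σ : Type} (p : MvPolynomial σ ℚ) (k : ℤ) : Prop :=
  ∀ m : σ →₀ ℕ, p.coeff m ≠ 0 → 2 * (m.degree : ℤ) = k

section Homog

variable {σ τ : Type} {p q : MvPolynomial σ ℚ} {k l : ℤ}

theorem isHomog_zero (k : ℤ) : IsHomog (0 : MvPolynomial σ ℚ) k := by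
  intro m hm
  simp at hm

theorem IsHomog.add (hp : IsHomog p k) (hq : IsHomog q k) : IsHomog (p + q) k := by
  intro m hm
  by_cases h : p.coeff m = 0
  · refine hq m fun h' => hm ?_
    rw [coeff_add, h, h', add_zero]
  · exact hp m h

theorem IsHomog.neg (hp : IsHomog p k) : IsHomog (-p) k := by
  intro m hm
  refine hp m fun h => hm ?_
  rw [coeff_neg, h, neg_zero]

theorem IsHomog.sub (hp : IsHomog p k) (hq : IsHomog q k) : IsHomog (p - q) k := by
  rw [sub_eq_add_neg]
  exact hp.add hq.neg

theorem IsHomog.mul (hp : IsHomog p k) (hq : IsHomog q l) : IsHomog (p * q) (k + l) := by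
  classical
  intro m hm
  rw [coeff_mul] at hm
  obtain ⟨⟨a, b⟩, hab, h⟩ := Finset.exists_ne_zero_of_sum_ne_zero hm
  have h1 := hp a (left_ne_zero_of_mul h)
  have h2 := hq b (right_ne_zero_of_mul h)
  have h3 : a + b = m := Finset.HasAntidiagonal.mem_antidiagonal.mp hab
  subst h3
  rw [map_add]
  push_cast
  linarith

theorem isHomog_C (c : ℚ) : IsHomog (C c : MvPolynomial σ ℚ) 0 := by
  classical
  intro m hm
  rw [coeff_C] at hm
  by_cases h : 0 = m
  · subst h
    simp
  · simp [h] at hm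

theorem isHomog_one : IsHomog (1 : MvPolynomial σ ℚ) 0 := by
  rw [← C_1]
  exact isHomog_C 1

theorem isHomog_natCast (c : ℕ) : IsHomog (c : MvPolynomial σ ℚ) 0 := by
  have h := isHomog_C (σ := σ) (c : ℚ)
  rwa [map_natCast] at h

theorem isHomog_X (i : σ) : IsHomog (X i : MvPolynomial σ ℚ) 2 := by
  classical
  intro m hm
  rw [coeff_X] at hm
  by_cases h : Finsupp.single i 1 = m
  · subst h
    simp
  · simp [h] at hm

theorem IsHomog.pow (hp : IsHomog p k) (n : ℕ) : IsHomog (p ^ n) (n * k) := by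
  induction n with
  | zero => simpa using isHomog_one
  | succ n ih =>
    rw [pow_succ]
    convert ih.mul hp using 1
    push_cast
    ring

theorem IsHomog.sum {ι : Type*} (s : Finset ι) (f : ι → MvPolynomial σ ℚ)
    (h : ∀ i ∈ s, IsHomog (f i) k) : IsHomog (∑ i ∈ s, f i) k := by
  classical
  induction s using Finset.induction_on with
  | empty => simpa using isHomog_zero k
  | insert a s ha ih =>
    rw [Finset.sum_insert ha]
    exact (h a (Finset.mem_insert_self a s)).add
      (ih fun i hi => h i (Finset.mem_insert_of_mem hi))

theorem coeff_coeff_sumAlgEquiv (p : MvPolynomial (σ ⊕ τ) ℚ) (m : σ →₀ ℕ) (d : τ →₀ ℕ) :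
    coeff d (coeff m (sumAlgEquiv ℚ σ τ p)) = coeff (Finsupp.sumElim m d) p := by
  induction p using MvPolynomial.induction_on' with
  | monomial u a =>
    classical
    obtain ⟨⟨m', d'⟩, rfl⟩ := Finsupp.sumFinsuppEquivProdFinsupp.symm.surjective u
    have h1 : sumAlgEquiv ℚ σ τ (monomial (Finsupp.sumElim m' d') a) =
        monomial m' (monomial d' a) := by
      have h2 : Finsupp.sumFinsuppAddEquivProdFinsupp (Finsupp.sumElim m' d') = (m', d') :=
        Finsupp.sumFinsuppEquivProdFinsupp.apply_symm_apply (m', d')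
      change AddMonoidAlgebra.curryAlgEquiv ℚ (AddMonoidAlgebra.domCongr ℚ ℚ
        Finsupp.sumFinsuppAddEquivProdFinsupp (AddMonoidAlgebra.single _ a)) = _
      rw [AddMonoidAlgebra.domCongr_single, h2, AddMonoidAlgebra.curryAlgEquiv_single]
      rfl
    change coeff d (coeff m (sumAlgEquiv ℚ σ τ (monomial (Finsupp.sumElim m' d') a))) =
      coeff (Finsupp.sumElim m d) (monomial (Finsupp.sumElim m' d') a)
    have h3 : Finsupp.sumElim m' d' = Finsupp.sumElim m d ↔ m' = m ∧ d' = d := by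
      rw [← Prod.mk.injEq]
      exact (Finsupp.sumFinsuppEquivProdFinsupp (α := σ) (β := τ) (γ := ℕ)).symm.injective.eq_iff
        (a := (m', d')) (b := (m, d))
    rw [h1, coeff_monomial, coeff_monomial]
    by_cases hm : m' = m <;> by_cases hd : d' = d <;> simp_all
  | add p q hp hq => simp only [map_add, coeff_add, hp, hq]

theorem isHomog_iff_coeff (p : MvPolynomial (σ ⊕ τ) ℚ) (k : ℤ) :
    IsHomog p k ↔ ∀ m : σ →₀ ℕ, IsHomog (coeff m (sumAlgEquiv ℚ σ τ p)) (k - 2 * m.degree) := by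
  have key : ∀ (m : σ →₀ ℕ) (d : τ →₀ ℕ),
      (Finsupp.sumElim m d).degree = m.degree + d.degree := by
    intro m d
    exact Finsupp.sum_sumElim m d fun _ a => a
  constructor
  · intro h m d hd
    rw [coeff_coeff_sumAlgEquiv] at hd
    have := h _ hd
    rw [key] at this
    push_cast at this
    linarith
  · intro h u hu
    obtain ⟨⟨m, d⟩, rfl⟩ := Finsupp.sumFinsuppEquivProdFinsupp.symm.surjective u
    have := h m d (by rw [coeff_coeff_sumAlgEquiv]; exact hu)
    have h2 := key m d
    change 2 * (((Finsupp.sumElim m d).degree : ℕ) : ℤ) = k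
    rw [h2]
    push_cast
    linarith

end Homog

/-- A family of subgroups `gr j` makes `N` a *free graded module* over the graded ring `ℚ[σ]`: there
is a basis `b i` with degrees `deg i` such that `gr j` consists of the elements whose `i`-th
coordinate is homogeneous of degree `j - deg i` for every `i`, i.e. `N ≅ ⨁ i, ℚ[σ]{deg i}`. -/
def IsGradedFree (σ : Type) {N : Type} [AddCommGroup N] [Module (MvPolynomial σ ℚ) N]
    (gr : ℤ → AddSubgroup N) : Prop :=
  ∃ (ι : Type) (b : Module.Basis ι (MvPolynomial σ ℚ) N) (deg : ι → ℤ),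
    ∀ (j : ℤ) (x : N), x ∈ gr j ↔ ∀ i, IsHomog (b.repr x i) (j - deg i)

/-- Free graded modules over the polynomial ring `ℚ[σ]` (variables in degree `2`), of any rank. -/
structure FreeGradedModule (σ : Type) where
  carrier : Type
  [addCommGroup : AddCommGroup carrier]
  [module : Module (MvPolynomial σ ℚ) carrier]
  gr : ℤ → AddSubgroup carrier
  free : IsGradedFree σ gr

attribute [instance] FreeGradedModule.addCommGroup FreeGradedModule.module

namespace FreeGradedModule

variable {σ : Type}

instance : CoeSort (FreeGradedModule σ) Type := ⟨carrier⟩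

theorem smul_mem {N : FreeGradedModule σ} {r : MvPolynomial σ ℚ} {k j : ℤ} {x : N}
    (hr : IsHomog r k) (hx : x ∈ N.gr j) : r • x ∈ N.gr (j + k) := by
  obtain ⟨ι, b, deg, h⟩ := N.free
  rw [h] at hx ⊢
  intro i
  rw [map_smul, Finsupp.smul_apply, smul_eq_mul, show j + k - deg i = k + (j - deg i) by ring]
  exact hr.mul (hx i)

theorem mem_of_eq {N : FreeGradedModule σ} {j k : ℤ} {x : N} (hx : x ∈ N.gr j) (h : j = k) :
    x ∈ N.gr k :=
  h ▸ hx

/-- The ring `ℚ[σ]` as a free graded module over itself. -/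
def self (σ : Type) : FreeGradedModule σ where
  carrier := MvPolynomial σ ℚ
  gr j :=
    { carrier := {p | IsHomog p j}
      zero_mem' := isHomog_zero j
      add_mem' := fun h h' => IsHomog.add h h'
      neg_mem' := fun h => IsHomog.neg h }
  free := by
    refine ⟨Unit, Module.Basis.singleton Unit _, fun _ => 0, fun j x => ?_⟩
    simp only [Module.Basis.singleton_repr, sub_zero, forall_const]
    rfl

/-- The zero module. -/
def zero (σ : Type) : FreeGradedModule σ where
  carrier := PUnit
  gr _ := ⊤
  free := by
    refine ⟨Empty, Module.Basis.empty _, fun _ => 0, fun j x => ?_⟩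
    simp

/-- The grading shift up: `N{m}` has `N{m}_j = N_{j - m}`. -/
def shift (N : FreeGradedModule σ) (m : ℤ) : FreeGradedModule σ where
  carrier := N
  gr j := N.gr (j - m)
  free := by
    obtain ⟨ι, b, deg, h⟩ := N.free
    refine ⟨ι, b, fun i => deg i + m, fun j x => ?_⟩
    rw [h]
    refine forall_congr' fun i => ?_
    rw [show j - m - deg i = j - (deg i + m) by ring]

/-- The direct sum of graded modules. -/
def prod (N N' : FreeGradedModule σ) : FreeGradedModule σ where
  carrier := N × N'
  gr j := (N.gr j).prod (N'.gr j)
  free := by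
    obtain ⟨ι, b, deg, h⟩ := N.free
    obtain ⟨ι', b', deg', h'⟩ := N'.free
    refine ⟨ι ⊕ ι', b.prod b', Sum.elim deg deg', fun j x => ?_⟩
    rw [AddSubgroup.mem_prod, h, h', Sum.forall]
    simp

/-- A module over `ℚ[I ⊔ B]` seen as a module over the subring `ℚ[B]`. -/
def restrict {I B : Type} (N : FreeGradedModule (I ⊕ B)) : FreeGradedModule B :=
  letI : Module (MvPolynomial B ℚ) N :=
    Module.compHom N.carrier (rename (R := ℚ) (Sum.inr : B → I ⊕ B)).toRingHom
  { carrier := N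
    gr := N.gr
    free := by
      let : Algebra (MvPolynomial B ℚ) (MvPolynomial (I ⊕ B) ℚ) :=
        (rename (R := ℚ) (Sum.inr : B → I ⊕ B)).toRingHom.toAlgebra
      have : IsScalarTower (MvPolynomial B ℚ) (MvPolynomial (I ⊕ B) ℚ) N.carrier :=
        ⟨fun x y z => mul_smul (rename (R := ℚ) (Sum.inr : B → I ⊕ B) x) y z⟩
      obtain ⟨ι, b, deg, h⟩ := N.free
      let e : MvPolynomial (I ⊕ B) ℚ ≃ₗ[MvPolynomial B ℚ] MvPolynomial I (MvPolynomial B ℚ) :=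
        { (sumAlgEquiv ℚ I B).toAddEquiv with
          map_smul' := fun r p => by
            have h1 : r • p = rename (R := ℚ) (Sum.inr : B → I ⊕ B) r * p := rfl
            have h2 := AlgHom.congr_fun (sumAlgEquiv_comp_rename_inr (R := ℚ) (S₁ := I) (S₂ := B)) r
            change sumAlgEquiv ℚ I B (r • p) = r • sumAlgEquiv ℚ I B p
            rw [h1, map_mul, Algebra.smul_def]
            congr 1 }
      let c : Module.Basis (I →₀ ℕ) (MvPolynomial B ℚ) (MvPolynomial (I ⊕ B) ℚ) :=
        (basisMonomials I (MvPolynomial B ℚ)).map e.symm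
      have hc : ∀ p m, c.repr p m = coeff m (sumAlgEquiv ℚ I B p) := fun p m => rfl
      refine ⟨(I →₀ ℕ) × ι, c.smulTower b, fun i => 2 * (i.1.degree : ℤ) + deg i.2,
        fun j x => ?_⟩
      refine (h j x).trans ⟨fun H => ?_, fun H i => ?_⟩
      · rintro ⟨m, i⟩
        rw [Module.Basis.smulTower_repr, hc]
        convert (isHomog_iff_coeff _ _).1 (H i) m using 1
        ring
      · refine (isHomog_iff_coeff _ _).2 fun m => ?_
        have := H (m, i)
        rw [Module.Basis.smulTower_repr, hc] at this
        convert this using 1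
        ring }

end FreeGradedModule

/-! ## Graded matrix factorizations and their homotopy category -/

/-- A graded matrix factorization over `ℚ[σ]` with potential `w`: free graded modules `M⁰`, `M¹`
of any rank with maps `d⁰ : M⁰ → M¹`, `d¹ : M¹ → M⁰` of degree `n + 1` whose two composites are
multiplication by `w`. -/
structure GradedFactorization (σ : Type) (n : ℕ) (w : MvPolynomial σ ℚ) where
  M0 : FreeGradedModule σ
  M1 : FreeGradedModule σ
  d0 : M0 →ₗ[MvPolynomial σ ℚ] M1
  d1 : M1 →ₗ[MvPolynomial σ ℚ] M0
  d0_mem : ∀ (j : ℤ) (x : M0), x ∈ M0.gr j → d0 x ∈ M1.gr (j + (n + 1))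
  d1_mem : ∀ (j : ℤ) (x : M1), x ∈ M1.gr j → d1 x ∈ M0.gr (j + (n + 1))
  d1_d0 : ∀ x : M0, d1 (d0 x) = w • x
  d0_d1 : ∀ x : M1, d0 (d1 x) = w • x

namespace GradedFactorization

variable {σ : Type} {n : ℕ} {w : MvPolynomial σ ℚ}

/-- Homomorphisms of graded factorizations: pairs of linear maps of degree `0` that commute with
the differentials. -/
@[ext]
structure Hom (M N : GradedFactorization σ n w) where
  f0 : M.M0 →ₗ[MvPolynomial σ ℚ] N.M0
  f1 : M.M1 →ₗ[MvPolynomial σ ℚ] N.M1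
  f0_mem : ∀ (j : ℤ) (x : M.M0), x ∈ M.M0.gr j → f0 x ∈ N.M0.gr j
  f1_mem : ∀ (j : ℤ) (x : M.M1), x ∈ M.M1.gr j → f1 x ∈ N.M1.gr j
  comm0 : ∀ x : M.M0, f1 (M.d0 x) = N.d0 (f0 x)
  comm1 : ∀ x : M.M1, f0 (M.d1 x) = N.d1 (f1 x)

/-- The category `mf^all_w` of graded factorizations with potential `w`. -/
instance category : Category (GradedFactorization σ n w) where
  Hom := Hom
  id M :=
    { f0 := LinearMap.id
      f1 := LinearMap.id
      f0_mem := fun _ _ h => h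
      f1_mem := fun _ _ h => h
      comm0 := fun _ => rfl
      comm1 := fun _ => rfl }
  comp f g :=
    { f0 := g.f0 ∘ₗ f.f0
      f1 := g.f1 ∘ₗ f.f1
      f0_mem := fun j x h => g.f0_mem j _ (f.f0_mem j x h)
      f1_mem := fun j x h => g.f1_mem j _ (f.f1_mem j x h)
      comm0 := fun x => by simp [f.comm0, g.comm0]
      comm1 := fun x => by simp [f.comm1, g.comm1] }

/-- Two homomorphisms are homotopic if `f - g = h d_M + d_N h` for a pair of linear maps
`h⁰ : M⁰ → N¹`, `h¹ : M¹ → N⁰` of degree `- n - 1`. -/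
def Homotopic : HomRel (GradedFactorization σ n w) := fun M N f g =>
  ∃ (h0 : M.M0 →ₗ[MvPolynomial σ ℚ] N.M1) (h1 : M.M1 →ₗ[MvPolynomial σ ℚ] N.M0),
    (∀ (j : ℤ) (x : M.M0), x ∈ M.M0.gr j → h0 x ∈ N.M1.gr (j - (n + 1))) ∧
    (∀ (j : ℤ) (x : M.M1), x ∈ M.M1.gr j → h1 x ∈ N.M0.gr (j - (n + 1))) ∧
    (∀ x : M.M0, f.f0 x - g.f0 x = h1 (M.d0 x) + N.d1 (h0 x)) ∧
    (∀ x : M.M1, f.f1 x - g.f1 x = h0 (M.d1 x) + N.d0 (h1 x))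

/-- Homotopy is a congruence, so that the quotient category below has as morphisms exactly the
homotopy classes of homomorphisms. -/
instance : Congruence (Homotopic (σ := σ) (n := n) (w := w)) where
  equivalence :=
    { refl := fun f => ⟨0, 0, fun _ _ _ => zero_mem _, fun _ _ _ => zero_mem _,
        fun x => by simp, fun x => by simp⟩
      symm := by
        rintro f g ⟨h0, h1, H0, H1, e0, e1⟩
        refine ⟨-h0, -h1, fun j x hx => neg_mem (H0 j x hx), fun j x hx => neg_mem (H1 j x hx),
          fun x => ?_, fun x => ?_⟩
        · rw [← neg_sub, e0]
          simp only [LinearMap.neg_apply, map_neg]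
          abel
        · rw [← neg_sub, e1]
          simp only [LinearMap.neg_apply, map_neg]
          abel
      trans := by
        rintro f g k ⟨h0, h1, H0, H1, e0, e1⟩ ⟨h0', h1', H0', H1', e0', e1'⟩
        refine ⟨h0 + h0', h1 + h1', fun j x hx => add_mem (H0 j x hx) (H0' j x hx),
          fun j x hx => add_mem (H1 j x hx) (H1' j x hx), fun x => ?_, fun x => ?_⟩
        · rw [← sub_add_sub_cancel, e0, e0']
          simp only [LinearMap.add_apply, map_add]
          abel
        · rw [← sub_add_sub_cancel, e1, e1']
          simp only [LinearMap.add_apply, map_add]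
          abel }
  comp_left := by
    rintro M N P f g g' ⟨h0, h1, H0, H1, e0, e1⟩
    refine ⟨h0 ∘ₗ f.f0, h1 ∘ₗ f.f1, fun j x hx => H0 j _ (f.f0_mem j x hx),
      fun j x hx => H1 j _ (f.f1_mem j x hx), fun x => ?_, fun x => ?_⟩
    · exact (e0 (f.f0 x)).trans (by simp [f.comm0])
    · exact (e1 (f.f1 x)).trans (by simp [f.comm1])
  comp_right := by
    rintro M N P f f' g ⟨h0, h1, H0, H1, e0, e1⟩
    refine ⟨g.f1 ∘ₗ h0, g.f0 ∘ₗ h1, fun j x hx => g.f1_mem _ _ (H0 j x hx),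
      fun j x hx => g.f0_mem _ _ (H1 j x hx), fun x => ?_, fun x => ?_⟩
    · change g.f0 (f.f0 x) - g.f0 (f'.f0 x) = _
      rw [← map_sub, e0, map_add, g.comm1]
      rfl
    · change g.f1 (f.f1 x) - g.f1 (f'.f1 x) = _
      rw [← map_sub, e1, map_add, g.comm0]
      rfl

/-- The ideal `𝔪` of `ℚ[σ]` generated by the variables. -/
def irrelevant (σ : Type) : Ideal (MvPolynomial σ ℚ) := Ideal.span (Set.range X)

/-- The map `N / 𝔪 N → N' / 𝔪 N'` induced by a linear map. -/
def reduction {N N' : FreeGradedModule σ} (f : N →ₗ[MvPolynomial σ ℚ] N') :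
    (N ⧸ (irrelevant σ • ⊤ : Submodule (MvPolynomial σ ℚ) N)) →ₗ[MvPolynomial σ ℚ]
      (N' ⧸ (irrelevant σ • ⊤ : Submodule (MvPolynomial σ ℚ) N')) :=
  Submodule.mapQ _ _ f (Submodule.smul_top_le_comap_smul_top _ f)

/-- The even cohomology `H⁰(M)` of the 2-periodic complex `M / 𝔪 M`. -/
abbrev cohomology0 (M : GradedFactorization σ n w) : Type :=
  (LinearMap.ker (reduction M.d0)) ⧸
    ((LinearMap.range (reduction M.d1)).submoduleOf (LinearMap.ker (reduction M.d0)))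

/-- The odd cohomology `H¹(M)` of the 2-periodic complex `M / 𝔪 M`. -/
abbrev cohomology1 (M : GradedFactorization σ n w) : Type :=
  (LinearMap.ker (reduction M.d1)) ⧸
    ((LinearMap.range (reduction M.d0)).submoduleOf (LinearMap.ker (reduction M.d1)))

/-- `H(M) = H⁰(M) ⊕ H¹(M)` is finite-dimensional over `ℚ`. -/
def HasFiniteDimensionalCohomology (M : GradedFactorization σ n w) : Prop :=
  Module.Finite ℚ (RestrictScalars ℚ (MvPolynomial σ ℚ) M.cohomology0) ∧
    Module.Finite ℚ (RestrictScalars ℚ (MvPolynomial σ ℚ) M.cohomology1)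

end GradedFactorization

/-- The category `hmf^all_w` of graded factorizations of `w` up to homotopy. -/
abbrev HmfAll (σ : Type) (n : ℕ) (w : MvPolynomial σ ℚ) : Type 1 :=
  Quotient (GradedFactorization.Homotopic (σ := σ) (n := n) (w := w))

/-- The category `hmf_w`: the full subcategory of `hmf^all_w` on the factorizations with
finite-dimensional cohomology. -/
abbrev Hmf (σ : Type) (n : ℕ) (w : MvPolynomial σ ℚ) : Type 1 :=
  ObjectProperty.FullSubcategory fun M : HmfAll σ n w => M.as.HasFiniteDimensionalCohomology

/-- A factorization with finite-dimensional cohomology as an object of `hmf_w`. -/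
abbrev Hmf.of {σ : Type} {n : ℕ} {w : MvPolynomial σ ℚ} (M : GradedFactorization σ n w)
    (hM : M.HasFiniteDimensionalCohomology) : Hmf σ n w :=
  ⟨⟨M⟩, hM⟩

/-- `M` and `N` lie in `hmf_w` and there is an isomorphism `M ≅ N` in `hmf_w`. -/
def IsomorphicInHmf {σ : Type} {n : ℕ} {w : MvPolynomial σ ℚ} (M N : GradedFactorization σ n w) :
    Prop :=
  ∃ (hM : M.HasFiniteDimensionalCohomology) (hN : N.HasFiniteDimensionalCohomology),
    Nonempty (Hmf.of M hM ≅ Hmf.of N hN)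

namespace GradedFactorization

variable {σ : Type} {n : ℕ} {w : MvPolynomial σ ℚ}

/-- The direct sum `M ⊕ N`. -/
def directSum (M N : GradedFactorization σ n w) : GradedFactorization σ n w where
  M0 := M.M0.prod N.M0
  M1 := M.M1.prod N.M1
  d0 := LinearMap.prodMap M.d0 N.d0
  d1 := LinearMap.prodMap M.d1 N.d1
  d0_mem j x hx := ⟨M.d0_mem j x.1 hx.1, N.d0_mem j x.2 hx.2⟩
  d1_mem j x hx := ⟨M.d1_mem j x.1 hx.1, N.d1_mem j x.2 hx.2⟩
  d1_d0 x := Prod.ext (M.d1_d0 x.1) (N.d1_d0 x.2)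
  d0_d1 x := Prod.ext (M.d0_d1 x.1) (N.d0_d1 x.2)

/-- The grading shift `M{m}`. -/
def shift (M : GradedFactorization σ n w) (m : ℤ) : GradedFactorization σ n w where
  M0 := M.M0.shift m
  M1 := M.M1.shift m
  d0 := M.d0
  d1 := M.d1
  d0_mem j x hx := by
    have h := M.d0_mem (j - m) x hx
    rwa [sub_add_eq_add_sub] at h
  d1_mem j x hx := by
    have h := M.d1_mem (j - m) x hx
    rwa [sub_add_eq_add_sub] at h
  d1_d0 := M.d1_d0
  d0_d1 := M.d0_d1

/-- The same factorization, with its potential rewritten as an equal polynomial. -/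
def ofEq {w' : MvPolynomial σ ℚ} (h : w = w') (M : GradedFactorization σ n w) :
    GradedFactorization σ n w' where
  M0 := M.M0
  M1 := M.M1
  d0 := M.d0
  d1 := M.d1
  d0_mem := M.d0_mem
  d1_mem := M.d1_mem
  d1_d0 := h ▸ M.d1_d0
  d0_d1 := h ▸ M.d0_d1

/-- A factorization over `ℚ[I ⊔ B]` whose potential lies in `ℚ[B]`, seen as a factorization over
`ℚ[B]` (of infinite rank in general). -/
def restrict {I B : Type} {w : MvPolynomial B ℚ}
    (M : GradedFactorization (I ⊕ B) n (rename Sum.inr w)) : GradedFactorization B n w where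
  M0 := M.M0.restrict
  M1 := M.M1.restrict
  d0 :=
    { toFun := M.d0
      map_add' := M.d0.map_add
      map_smul' := fun r x => M.d0.map_smul (rename Sum.inr r) x }
  d1 :=
    { toFun := M.d1
      map_add' := M.d1.map_add
      map_smul' := fun r x => M.d1.map_smul (rename Sum.inr r) x }
  d0_mem := M.d0_mem
  d1_mem := M.d1_mem
  d1_d0 := M.d1_d0
  d0_d1 := M.d0_d1

end GradedFactorization

/-! ## Koszul factorizations -/

/-- A row `(a, b)` of a graded Koszul factorization: homogeneous polynomials with
`deg a + deg b = 2 (n + 1)`, where `degB` is the degree of `b`. -/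
structure KoszulRow (σ : Type) (n : ℕ) where
  a : MvPolynomial σ ℚ
  b : MvPolynomial σ ℚ
  degB : ℤ
  a_homog : IsHomog a (2 * (n + 1) - degB)
  b_homog : IsHomog b degB

/-- The potential `∑ i, a i * b i` of a Koszul factorization. -/
def koszulPotential {σ : Type} {n : ℕ} : List (KoszulRow σ n) → MvPolynomial σ ℚ
  | [] => 0
  | r :: l => r.a * r.b + koszulPotential l

namespace GradedFactorization

variable {σ : Type} {n : ℕ} {w : MvPolynomial σ ℚ}

/-- The tensor product over `R = ℚ[σ]` of the rank one factorization
`{a, b} = (R --a--> R{n + 1 - deg a} --b--> R)` and of `M`, with `d (x ⊗ m) = dx ⊗ m ± x ⊗ dm`.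
As `R ⊗ M = M`, its even part is `M⁰ ⊕ M¹{n + 1 - deg a}` and its odd part is
`M¹ ⊕ M⁰{n + 1 - deg a}`; note that `n + 1 - deg a = deg b - n - 1`. -/
def tensorRow (r : KoszulRow σ n) (M : GradedFactorization σ n w) :
    GradedFactorization σ n (r.a * r.b + w) where
  M0 := M.M0.prod (M.M1.shift (r.degB - (n + 1)))
  M1 := M.M1.prod (M.M0.shift (r.degB - (n + 1)))
  d0 := LinearMap.prod
    (M.d0 ∘ₗ LinearMap.fst _ M.M0 M.M1 + r.b • LinearMap.snd _ M.M0 M.M1)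
    (r.a • LinearMap.fst _ M.M0 M.M1 - M.d1 ∘ₗ LinearMap.snd _ M.M0 M.M1)
  d1 := LinearMap.prod
    (M.d1 ∘ₗ LinearMap.fst _ M.M1 M.M0 + r.b • LinearMap.snd _ M.M1 M.M0)
    (r.a • LinearMap.fst _ M.M1 M.M0 - M.d0 ∘ₗ LinearMap.snd _ M.M1 M.M0)
  d0_mem := by
    rintro j ⟨x, y⟩ ⟨hx, hy⟩
    refine ⟨add_mem (M.d0_mem j x hx) ?_, (M.M0.gr _).sub_mem ?_ ?_⟩
    · exact FreeGradedModule.mem_of_eq (FreeGradedModule.smul_mem r.b_homog hy) (by ring)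
    · exact FreeGradedModule.mem_of_eq (FreeGradedModule.smul_mem r.a_homog hx) (by ring)
    · exact FreeGradedModule.mem_of_eq (M.d1_mem _ y hy) (by ring)
  d1_mem := by
    rintro j ⟨x, y⟩ ⟨hx, hy⟩
    refine ⟨add_mem (M.d1_mem j x hx) ?_, (M.M1.gr _).sub_mem ?_ ?_⟩
    · exact FreeGradedModule.mem_of_eq (FreeGradedModule.smul_mem r.b_homog hy) (by ring)
    · exact FreeGradedModule.mem_of_eq (FreeGradedModule.smul_mem r.a_homog hx) (by ring)
    · exact FreeGradedModule.mem_of_eq (M.d0_mem _ y hy) (by ring)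
  d1_d0 := by
    rintro ⟨(x : M.M0), (y : M.M1)⟩
    refine Prod.ext ?_ ?_
    · change M.d1 (M.d0 x + r.b • y) + r.b • (r.a • x - M.d1 y) = (r.a * r.b + w) • x
      rw [map_add, map_smul, M.d1_d0]
      module
    · change r.a • (M.d0 x + r.b • y) - M.d0 (r.a • x - M.d1 y) = (r.a * r.b + w) • y
      rw [map_sub, map_smul, M.d0_d1]
      module
  d0_d1 := by
    rintro ⟨(x : M.M1), (y : M.M0)⟩
    refine Prod.ext ?_ ?_
    · change M.d0 (M.d1 x + r.b • y) + r.b • (r.a • x - M.d0 y) = (r.a * r.b + w) • x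
      rw [map_add, map_smul, M.d0_d1]
      module
    · change r.a • (M.d1 x + r.b • y) - M.d1 (r.a • x - M.d0 y) = (r.a * r.b + w) • y
      rw [map_sub, map_smul, M.d1_d0]
      module

/-- The factorization `R → 0 → R` with potential `0`. -/
def unit (σ : Type) (n : ℕ) : GradedFactorization σ n 0 where
  M0 := FreeGradedModule.self σ
  M1 := FreeGradedModule.zero σ
  d0 := 0
  d1 := 0
  d0_mem _ _ _ := zero_mem _
  d1_mem _ _ _ := zero_mem _
  d1_d0 _ := by simp
  d0_d1 _ := by simp

/-- The Koszul factorization `{(a₁, …, aₘ), (b₁, …, bₘ)} = ⨂ i, {aᵢ, bᵢ}`. -/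
def koszul : (l : List (KoszulRow σ n)) → GradedFactorization σ n (koszulPotential l)
  | [] => unit σ n
  | r :: l => tensorRow r (koszul l)

end GradedFactorization

/-! ## Power sums in terms of elementary symmetric functions, and difference quotients -/

section PowerSums

variable {A : Type} [CommRing A]

/-- `x ^ k + y ^ k` as a polynomial `g` in `s₁ = x + y` and `s₂ = x * y`. -/
def powerSum₂ (s₁ s₂ : A) : ℕ → A
  | 0 => 2
  | 1 => s₁
  | k + 2 => s₁ * powerSum₂ s₁ s₂ (k + 1) - s₂ * powerSum₂ s₁ s₂ k

/-- `x ^ k + y ^ k + z ^ k` as a polynomial `h` in the elementary symmetric functions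
`s₁ = x + y + z`, `s₂ = x * y + x * z + y * z`, `s₃ = x * y * z`. -/
def powerSum₃ (s₁ s₂ s₃ : A) : ℕ → A
  | 0 => 3
  | 1 => s₁
  | 2 => s₁ ^ 2 - 2 * s₂
  | k + 3 => s₁ * powerSum₃ s₁ s₂ s₃ (k + 2) - s₂ * powerSum₃ s₁ s₂ s₃ (k + 1) +
      s₃ * powerSum₃ s₁ s₂ s₃ k

theorem powerSum₂_eq (x y : A) (k : ℕ) : powerSum₂ (x + y) (x * y) k = x ^ k + y ^ k := by
  induction k using Nat.twoStepInduction with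
  | zero => norm_num [powerSum₂]
  | one => simp [powerSum₂]
  | more k h₀ h₁ => rw [powerSum₂, h₀, h₁]; ring

theorem powerSum₃_eq (x y z : A) (k : ℕ) :
    powerSum₃ (x + y + z) (x * y + x * z + y * z) (x * y * z) k = x ^ k + y ^ k + z ^ k := by
  induction k using Nat.strong_induction_on with
  | _ k ih =>
    match k, ih with
    | 0, _ => norm_num [powerSum₃]
    | 1, _ => simp [powerSum₃]
    | 2, _ => rw [powerSum₃]; ring
    | k + 3, ih =>
      rw [powerSum₃, ih (k + 2) (by omega), ih (k + 1) (by omega), ih k (by omega)]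
      ring

theorem map_powerSum₂ {A' : Type} [CommRing A'] (φ : A →+* A') (s₁ s₂ : A) (k : ℕ) :
    φ (powerSum₂ s₁ s₂ k) = powerSum₂ (φ s₁) (φ s₂) k := by
  induction k using Nat.twoStepInduction with
  | zero => simp [powerSum₂, map_ofNat]
  | one => simp [powerSum₂]
  | more k h₀ h₁ => simp [powerSum₂, h₀, h₁]

theorem map_powerSum₃ {A' : Type} [CommRing A'] (φ : A →+* A') (s₁ s₂ s₃ : A) (k : ℕ) :
    φ (powerSum₃ s₁ s₂ s₃ k) = powerSum₃ (φ s₁) (φ s₂) (φ s₃) k := by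
  induction k using Nat.strong_induction_on with
  | _ k ih =>
    match k, ih with
    | 0, _ => simp [powerSum₃, map_ofNat]
    | 1, _ => simp [powerSum₃]
    | 2, _ => simp [powerSum₃, map_ofNat]
    | k + 3, ih =>
      simp [powerSum₃, ih (k + 2) (by omega), ih (k + 1) (by omega), ih k (by omega)]

/-- The difference quotient `(f(a) - f(b)) / (a - b)` of a one-variable polynomial `f`, expanded
as a polynomial in `a` and `b`: the quotient for `T ^ k` is `∑ i < k, a ^ i * b ^ (k - 1 - i)`. -/
def diffQuot (f : Polynomial A) (a b : A) : A :=
  ∑ k ∈ f.support, f.coeff k * ∑ i ∈ Finset.range k, a ^ i * b ^ (k - 1 - i)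

theorem diffQuot_mul (f : Polynomial A) (a b : A) :
    diffQuot f a b * (a - b) = f.eval a - f.eval b := by
  rw [diffQuot, Polynomial.eval_eq_sum, Polynomial.eval_eq_sum, Polynomial.sum, Polynomial.sum,
    ← Finset.sum_sub_distrib, Finset.sum_mul]
  refine Finset.sum_congr rfl fun k _ => ?_
  rw [mul_assoc, (Commute.all a b).geom_sum₂_mul, mul_sub]

end PowerSums

section PolyHomog

variable {σ : Type}

/-- `f(T)` is homogeneous of degree `N` when `T` has degree `d`. -/
def IsPolyHomog (d N : ℤ) (f : Polynomial (MvPolynomial σ ℚ)) : Prop :=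
  ∀ k : ℕ, IsHomog (f.coeff k) (N - k * d)

variable {d N N' : ℤ} {f g : Polynomial (MvPolynomial σ ℚ)}

theorem IsPolyHomog.add (hf : IsPolyHomog d N f) (hg : IsPolyHomog d N g) :
    IsPolyHomog d N (f + g) := by
  intro k
  rw [Polynomial.coeff_add]
  exact (hf k).add (hg k)

theorem IsPolyHomog.sub (hf : IsPolyHomog d N f) (hg : IsPolyHomog d N g) :
    IsPolyHomog d N (f - g) := by
  intro k
  rw [Polynomial.coeff_sub]
  exact (hf k).sub (hg k)

theorem IsPolyHomog.mul (hf : IsPolyHomog d N f) (hg : IsPolyHomog d N' g) :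
    IsPolyHomog d (N + N') (f * g) := by
  intro k
  rw [Polynomial.coeff_mul]
  refine IsHomog.sum _ _ fun ij hij => ?_
  have h := (hf ij.1).mul (hg ij.2)
  rw [← Finset.HasAntidiagonal.mem_antidiagonal.mp hij]
  convert h using 1
  push_cast
  ring

theorem isPolyHomog_C {p : MvPolynomial σ ℚ} (hp : IsHomog p N) :
    IsPolyHomog d N (Polynomial.C p) := by
  intro k
  rw [Polynomial.coeff_C]
  split_ifs with h
  · subst h
    simpa using hp
  · exact isHomog_zero _

theorem isPolyHomog_X : IsPolyHomog d d (Polynomial.X : Polynomial (MvPolynomial σ ℚ)) := by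
  intro k
  rw [Polynomial.coeff_X]
  split_ifs with h
  · subst h
    simpa using isHomog_one
  · exact isHomog_zero _

theorem isPolyHomog_natCast (c : ℕ) :
    IsPolyHomog d 0 (c : Polynomial (MvPolynomial σ ℚ)) := by
  have h := isPolyHomog_C (d := d) (isHomog_natCast (σ := σ) c)
  rwa [map_natCast] at h

theorem isPolyHomog_powerSum₂ {s₁ s₂ : Polynomial (MvPolynomial σ ℚ)} (h₁ : IsPolyHomog d 2 s₁)
    (h₂ : IsPolyHomog d 4 s₂) (k : ℕ) : IsPolyHomog d (2 * k) (powerSum₂ s₁ s₂ k) := by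
  induction k using Nat.twoStepInduction with
  | zero => exact isPolyHomog_natCast 2
  | one => exact h₁
  | more k i₀ i₁ =>
    have e₁ := h₁.mul i₁
    have e₂ := h₂.mul i₀
    rw [powerSum₂]
    refine IsPolyHomog.sub ?_ ?_
    · convert e₁ using 1
      push_cast
      ring
    · convert e₂ using 1
      push_cast
      ring

theorem isPolyHomog_powerSum₃ {s₁ s₂ s₃ : Polynomial (MvPolynomial σ ℚ)}
    (h₁ : IsPolyHomog d 2 s₁) (h₂ : IsPolyHomog d 4 s₂) (h₃ : IsPolyHomog d 6 s₃) (k : ℕ) :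
    IsPolyHomog d (2 * k) (powerSum₃ s₁ s₂ s₃ k) := by
  induction k using Nat.strong_induction_on with
  | _ k ih =>
    match k, ih with
    | 0, _ => exact isPolyHomog_natCast 3
    | 1, _ => exact h₁
    | 2, _ =>
      rw [powerSum₃, pow_two]
      exact (h₁.mul h₁).sub ((isPolyHomog_natCast 2).mul h₂)
    | k + 3, ih =>
      have e₁ := h₁.mul (ih (k + 2) (by omega))
      have e₂ := h₂.mul (ih (k + 1) (by omega))
      have e₃ := h₃.mul (ih k (by omega))
      rw [powerSum₃]
      refine IsPolyHomog.add (IsPolyHomog.sub ?_ ?_) ?_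
      · convert e₁ using 1
        push_cast
        ring
      · convert e₂ using 1
        push_cast
        ring
      · convert e₃ using 1
        push_cast
        ring

theorem IsPolyHomog.diffQuot (hf : IsPolyHomog d N f) {a b : MvPolynomial σ ℚ}
    (ha : IsHomog a d) (hb : IsHomog b d) : IsHomog (diffQuot f a b) (N - d) := by
  refine IsHomog.sum _ _ fun k _ => ?_
  rw [Finset.mul_sum]
  refine IsHomog.sum _ _ fun i hi => ?_
  have h := (hf k).mul ((ha.pow i).mul (hb.pow (k - 1 - i)))
  have hi' : i + (k - 1 - i) + 1 = k := by
    have := Finset.mem_range.mp hi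
    omega
  convert h using 1
  have : (k : ℤ) = i + ((k - 1 - i : ℕ) : ℤ) + 1 := by exact_mod_cast hi'.symm
  rw [this]
  ring

end PolyHomog

/-! ## Planar graphs and their factorizations -/

/-- A wide edge with the marks on the two oriented edges leaving it and the two entering it. -/
structure WideEdge (V : Type) where
  out₁ : V
  out₂ : V
  in₁ : V
  in₂ : V

/-- An arc of an oriented edge, between two marks, oriented from `tail` to `head`. -/
structure Arc (V : Type) where
  head : V
  tail : V

/-- A planar graph all of whose components carry marks, cut along its marks into wide edges and
arcs. `B` is the set of boundary points and `s` their signs (`1` if the edge at that point is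
oriented outward, `-1` if inward), `I` the set of internal marks. Every internal mark is the end of
one piece and the beginning of one piece; a boundary point is the end of one piece if its sign is
`1`, and the beginning of one piece otherwise. The embedding in the disc is not recorded, since the
factorization does not depend on it. -/
structure MarkedGraph (B : Type) [Fintype B] (s : B → ℤˣ) (I : Type) [Fintype I] where
  wide : List (WideEdge (I ⊕ B))
  arcs : List (Arc (I ⊕ B))
  ends_eq :
    ((wide.flatMap fun t => [t.out₁, t.out₂]) ++ arcs.map Arc.head : Multiset (I ⊕ B)) =
      Finset.univ.val.map Sum.inl + (Finset.univ.filter fun i => s i = 1).val.map Sum.inr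
  starts_eq :
    ((wide.flatMap fun t => [t.in₁, t.in₂]) ++ arcs.map Arc.tail : Multiset (I ⊕ B)) =
      Finset.univ.val.map Sum.inl + (Finset.univ.filter fun i => s i = -1).val.map Sum.inr

/-- `w(Γ) = ∑ i, s(i) * x_i ^ (n + 1)`, the sum running over the boundary points. -/
def boundaryPotential {B : Type} [Fintype B] (s : B → ℤˣ) (n : ℕ) : MvPolynomial B ℚ :=
  ∑ i, ((s i : ℤ) : MvPolynomial B ℚ) * X i ^ (n + 1)

section Rows

variable {V : Type} (n : ℕ)

/-- The row `(u₁, x₁ + x₂ - x₃ - x₄)` of a wide edge, where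
`u₁ = (g(x₁ + x₂, x₁ x₂) - g(x₃ + x₄, x₁ x₂)) / (x₁ + x₂ - x₃ - x₄)`. -/
def WideEdge.row₁ (t : WideEdge V) : KoszulRow V n where
  a := diffQuot (powerSum₂ Polynomial.X (Polynomial.C (X t.out₁ * X t.out₂)) (n + 1))
    (X t.out₁ + X t.out₂) (X t.in₁ + X t.in₂)
  b := X t.out₁ + X t.out₂ - (X t.in₁ + X t.in₂)
  degB := 2
  a_homog := by
    have h := isPolyHomog_powerSum₂ (d := 2) isPolyHomog_X
      (isPolyHomog_C ((isHomog_X t.out₁).mul (isHomog_X t.out₂))) (n + 1)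
    exact_mod_cast h.diffQuot ((isHomog_X _).add (isHomog_X _)) ((isHomog_X _).add (isHomog_X _))
  b_homog := ((isHomog_X _).add (isHomog_X _)).sub ((isHomog_X _).add (isHomog_X _))

/-- The row `(u₂, x₁ x₂ - x₃ x₄)` of a wide edge, where
`u₂ = (g(x₃ + x₄, x₁ x₂) - g(x₃ + x₄, x₃ x₄)) / (x₁ x₂ - x₃ x₄)`. -/
def WideEdge.row₂ (t : WideEdge V) : KoszulRow V n where
  a := diffQuot (powerSum₂ (Polynomial.C (X t.in₁ + X t.in₂)) Polynomial.X (n + 1))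
    (X t.out₁ * X t.out₂) (X t.in₁ * X t.in₂)
  b := X t.out₁ * X t.out₂ - X t.in₁ * X t.in₂
  degB := 4
  a_homog := by
    have h := isPolyHomog_powerSum₂ (d := 4)
      (isPolyHomog_C ((isHomog_X t.in₁).add (isHomog_X t.in₂))) isPolyHomog_X (n + 1)
    exact_mod_cast h.diffQuot ((isHomog_X _).mul (isHomog_X _)) ((isHomog_X _).mul (isHomog_X _))
  b_homog := ((isHomog_X _).mul (isHomog_X _)).sub ((isHomog_X _).mul (isHomog_X _))

/-- The row `(π, x - y)` of an arc from the mark `y` to the mark `x`, where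
`π = (x ^ (n + 1) - y ^ (n + 1)) / (x - y)`. -/
def Arc.row (α : Arc V) : KoszulRow V n where
  a := diffQuot (Polynomial.X ^ (n + 1)) (X α.head) (X α.tail)
  b := X α.head - X α.tail
  degB := 2
  a_homog := by
    have h : IsPolyHomog 2 (2 * ((n : ℤ) + 1))
        (Polynomial.X ^ (n + 1) : Polynomial (MvPolynomial V ℚ)) := by
      intro k
      rw [Polynomial.coeff_X_pow]
      split_ifs with h
      · subst h
        convert isHomog_one using 1
        push_cast
        ring
      · exact isHomog_zero _
    exact h.diffQuot (isHomog_X _) (isHomog_X _)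
  b_homog := (isHomog_X _).sub (isHomog_X _)

theorem WideEdge.rows_potential (t : WideEdge V) :
    (t.row₁ n).a * (t.row₁ n).b + (t.row₂ n).a * (t.row₂ n).b =
      X t.out₁ ^ (n + 1) + X t.out₂ ^ (n + 1) - (X t.in₁ ^ (n + 1) + X t.in₂ ^ (n + 1)) := by
  have key : ∀ (c : MvPolynomial V ℚ) (f : Polynomial (MvPolynomial V ℚ)),
      f.eval c = Polynomial.evalRingHom c f := fun _ _ => rfl
  simp only [WideEdge.row₁, WideEdge.row₂, diffQuot_mul, key, map_powerSum₂]
  simp only [Polynomial.coe_evalRingHom, Polynomial.eval_X, Polynomial.eval_C, powerSum₂_eq]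
  ring

theorem Arc.row_potential (α : Arc V) :
    (α.row n).a * (α.row n).b = X α.head ^ (n + 1) - X α.tail ^ (n + 1) := by
  simp only [Arc.row, diffQuot_mul, Polynomial.eval_pow, Polynomial.eval_X]

end Rows

namespace MarkedGraph

variable {B I : Type} [Fintype B] [Fintype I] {s : B → ℤˣ}

/-- The rows of all wide edges and all arcs of the graph, over the ring of all marks. -/
def rows (Γ : MarkedGraph B s I) (n : ℕ) : List (KoszulRow (I ⊕ B) n) :=
  (Γ.wide.flatMap fun t => [t.row₁ n, t.row₂ n]) ++ Γ.arcs.map fun α => α.row n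

theorem koszulPotential_rows (Γ : MarkedGraph B s I) (n : ℕ) :
    koszulPotential (Γ.rows n) = rename Sum.inr (boundaryPotential s n) := by
  classical
  let f : I ⊕ B → MvPolynomial (I ⊕ B) ℚ := fun v => X v ^ (n + 1)
  have hw : ∀ l : List (WideEdge (I ⊕ B)),
      koszulPotential (l.flatMap fun t => [t.row₁ n, t.row₂ n]) =
        ((l.flatMap fun t => [t.out₁, t.out₂]).map f).sum -
          ((l.flatMap fun t => [t.in₁, t.in₂]).map f).sum := by
    intro l
    induction l with
    | nil => simp [koszulPotential]
    | cons t l ih =>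
      have h := t.rows_potential n
      simp only [List.flatMap_cons, List.cons_append, List.nil_append, koszulPotential, ih,
        List.map_cons, List.sum_cons, f] at h ⊢
      linear_combination h
  have ha : ∀ l : List (Arc (I ⊕ B)), koszulPotential (l.map fun α => α.row n) =
      ((l.map Arc.head).map f).sum - ((l.map Arc.tail).map f).sum := by
    intro l
    induction l with
    | nil => simp [koszulPotential]
    | cons α l ih =>
      have h := α.row_potential n
      simp only [koszulPotential, ih, List.map_cons, List.sum_cons, f] at h ⊢
      linear_combination h
  have happ : ∀ l l' : List (KoszulRow (I ⊕ B) n),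
      koszulPotential (l ++ l') = koszulPotential l + koszulPotential l' := by
    intro l l'
    induction l with
    | nil => simp [koszulPotential]
    | cons r l ih => simp only [List.cons_append, koszulPotential, ih, add_assoc]
  have e := congrArg (fun m : Multiset (I ⊕ B) => (m.map f).sum) Γ.ends_eq
  have e' := congrArg (fun m : Multiset (I ⊕ B) => (m.map f).sum) Γ.starts_eq
  simp only [Multiset.map_coe, Multiset.sum_coe, List.map_append, List.sum_append,
    Multiset.map_add, Multiset.sum_add] at e e'
  have hsign : rename Sum.inr (boundaryPotential s n) =
      (∑ i ∈ Finset.univ.filter (fun i => s i = 1), f (Sum.inr i)) -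
        ∑ i ∈ Finset.univ.filter (fun i => s i = -1), f (Sum.inr i) := by
    rw [boundaryPotential, map_sum, Finset.sum_filter, Finset.sum_filter,
      ← Finset.sum_sub_distrib]
    refine Finset.sum_congr rfl fun i _ => ?_
    rcases Int.units_eq_one_or (s i) with h | h <;> simp [h, f]
  simp only [Multiset.map_map] at e e'
  change _ = _ + ∑ i ∈ Finset.univ.filter (fun i => s i = 1), f (Sum.inr i) at e
  change _ = _ + ∑ i ∈ Finset.univ.filter (fun i => s i = -1), f (Sum.inr i) at e'
  rw [rows, happ, hw, ha, hsign]
  linear_combination e - e'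

/-- The graded factorization `C(Γ)` over `ℚ[x_i, i ∈ B]` with potential `w(Γ)`: the tensor product
of `C_t = {(u₁, u₂), (x₁ + x₂ - x₃ - x₄, x₁ x₂ - x₃ x₄)}{-1}` over all wide edges `t` and of
`L = {π, x - y}` over all arcs. -/
def factorization (Γ : MarkedGraph B s I) (n : ℕ) :
    GradedFactorization B n (boundaryPotential s n) :=
  (((GradedFactorization.koszul (Γ.rows n)).ofEq (Γ.koszulPotential_rows n)).shift
    (-(Γ.wide.length : ℤ))).restrict

end MarkedGraph

/-! ## The four graphs with six boundary points, and `Υ` -/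

/-- The boundary points `0, 1, 2` (carrying `x₁, x₂, x₃`) are outgoing, `3, 4, 5` (carrying
`x₄, x₅, x₆`) are incoming. -/
def sixSigns : Fin 6 → ℤˣ := ![1, 1, 1, -1, -1, -1]

/-- The boundary point carrying `x₁, …, x₆` for `i = 0, …, 5`. -/
abbrev bd {I : Type} (i : Fin 6) : I ⊕ Fin 6 := Sum.inr i

/-- The internal mark carrying `x₇, x₈, x₉` for `i = 0, 1, 2`. -/
abbrev im (i : Fin 3) : Fin 3 ⊕ Fin 6 := Sum.inl i

/-- `Γ₁`: a wide edge on the first two strands, then one on the last two, then one on the first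
two, i.e. wide edges from `x₇, x₈` to `x₁, x₂`, from `x₉, x₆` to `x₈, x₃` and from `x₄, x₅` to
`x₇, x₉`. -/
def graph₁ : MarkedGraph (Fin 6) sixSigns (Fin 3) where
  wide := [⟨bd 0, bd 1, im 0, im 1⟩, ⟨im 1, bd 2, im 2, bd 5⟩, ⟨im 0, im 2, bd 3, bd 4⟩]
  arcs := []
  ends_eq := by decide
  starts_eq := by decide

/-- `Γ₂`: an arc from `x₄` to `x₁` and a wide edge from `x₅, x₆` to `x₂, x₃`. -/
def graph₂ : MarkedGraph (Fin 6) sixSigns Empty where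
  wide := [⟨bd 1, bd 2, bd 4, bd 5⟩]
  arcs := [⟨bd 0, bd 3⟩]
  ends_eq := by decide
  starts_eq := by decide

/-- `Γ₃`: the mirror image of `Γ₁`, with wide edges from `x₇, x₈` to `x₂, x₃`, from `x₄, x₉` to
`x₁, x₇` and from `x₅, x₆` to `x₉, x₈`. -/
def graph₃ : MarkedGraph (Fin 6) sixSigns (Fin 3) where
  wide := [⟨bd 1, bd 2, im 0, im 1⟩, ⟨bd 0, im 0, bd 3, im 2⟩, ⟨im 2, im 1, bd 4, bd 5⟩]
  arcs := []
  ends_eq := by decide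
  starts_eq := by decide

/-- `Γ₄`: a wide edge from `x₄, x₅` to `x₁, x₂` and an arc from `x₆` to `x₃`. -/
def graph₄ : MarkedGraph (Fin 6) sixSigns Empty where
  wide := [⟨bd 0, bd 1, bd 3, bd 4⟩]
  arcs := [⟨bd 2, bd 5⟩]
  ends_eq := by decide
  starts_eq := by decide

/-- The elementary symmetric functions `s₁, s₂, s₃` of `x₁, x₂, x₃` and `s₄, s₅, s₆` of
`x₄, x₅, x₆`. -/
def s₁ : MvPolynomial (Fin 6) ℚ := X 0 + X 1 + X 2
def s₂ : MvPolynomial (Fin 6) ℚ := X 0 * X 1 + X 0 * X 2 + X 1 * X 2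
def s₃ : MvPolynomial (Fin 6) ℚ := X 0 * X 1 * X 2
def s₄ : MvPolynomial (Fin 6) ℚ := X 3 + X 4 + X 5
def s₅ : MvPolynomial (Fin 6) ℚ := X 3 * X 4 + X 3 * X 5 + X 4 * X 5
def s₆ : MvPolynomial (Fin 6) ℚ := X 3 * X 4 * X 5

theorem isHomog_s₁ : IsHomog s₁ 2 := ((isHomog_X _).add (isHomog_X _)).add (isHomog_X _)
theorem isHomog_s₂ : IsHomog s₂ 4 :=
  (((isHomog_X _).mul (isHomog_X _)).add ((isHomog_X _).mul (isHomog_X _))).add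
    ((isHomog_X _).mul (isHomog_X _))
theorem isHomog_s₃ : IsHomog s₃ 6 := ((isHomog_X _).mul (isHomog_X _)).mul (isHomog_X _)
theorem isHomog_s₄ : IsHomog s₄ 2 := ((isHomog_X _).add (isHomog_X _)).add (isHomog_X _)
theorem isHomog_s₅ : IsHomog s₅ 4 :=
  (((isHomog_X _).mul (isHomog_X _)).add ((isHomog_X _).mul (isHomog_X _))).add
    ((isHomog_X _).mul (isHomog_X _))
theorem isHomog_s₆ : IsHomog s₆ 6 := ((isHomog_X _).mul (isHomog_X _)).mul (isHomog_X _)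

/-- The rows `(v₁, α₁), (v₂, α₂), (v₃, α₃)`, where `α₁ = s₁ - s₄`, `α₂ = s₂ - s₅`, `α₃ = s₃ - s₆` and
`v₁ = (h(s₁, s₂, s₃) - h(s₄, s₂, s₃)) / (s₁ - s₄)`,
`v₂ = (h(s₄, s₂, s₃) - h(s₄, s₅, s₃)) / (s₂ - s₅)`,
`v₃ = (h(s₄, s₅, s₃) - h(s₄, s₅, s₆)) / (s₃ - s₆)`. -/
def upsilonRows (n : ℕ) : List (KoszulRow (Fin 6) n) :=
  [{ a := diffQuot
        (powerSum₃ Polynomial.X (Polynomial.C s₂) (Polynomial.C s₃) (n + 1)) s₁ s₄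
     b := s₁ - s₄
     degB := 2
     a_homog := by
      have h := isPolyHomog_powerSum₃ (d := 2) isPolyHomog_X (isPolyHomog_C isHomog_s₂)
        (isPolyHomog_C isHomog_s₃) (n + 1)
      exact_mod_cast h.diffQuot isHomog_s₁ isHomog_s₄
     b_homog := isHomog_s₁.sub isHomog_s₄ },
   { a := diffQuot
        (powerSum₃ (Polynomial.C s₄) Polynomial.X (Polynomial.C s₃) (n + 1)) s₂ s₅
     b := s₂ - s₅
     degB := 4
     a_homog := by
      have h := isPolyHomog_powerSum₃ (d := 4) (isPolyHomog_C isHomog_s₄) isPolyHomog_X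
        (isPolyHomog_C isHomog_s₃) (n + 1)
      exact_mod_cast h.diffQuot isHomog_s₂ isHomog_s₅
     b_homog := isHomog_s₂.sub isHomog_s₅ },
   { a := diffQuot
        (powerSum₃ (Polynomial.C s₄) (Polynomial.C s₅) Polynomial.X (n + 1)) s₃ s₆
     b := s₃ - s₆
     degB := 6
     a_homog := by
      have h := isPolyHomog_powerSum₃ (d := 6) (isPolyHomog_C isHomog_s₄)
        (isPolyHomog_C isHomog_s₅) isPolyHomog_X (n + 1)
      exact_mod_cast h.diffQuot isHomog_s₃ isHomog_s₆
     b_homog := isHomog_s₃.sub isHomog_s₆ }]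

theorem koszulPotential_upsilonRows (n : ℕ) :
    koszulPotential (upsilonRows n) = boundaryPotential sixSigns n := by
  have key : ∀ (c : MvPolynomial (Fin 6) ℚ) (f : Polynomial (MvPolynomial (Fin 6) ℚ)),
      f.eval c = Polynomial.evalRingHom c f := fun _ _ => rfl
  have h₁ := powerSum₃_eq (X 0 : MvPolynomial (Fin 6) ℚ) (X 1) (X 2) (n + 1)
  have h₂ := powerSum₃_eq (X 3 : MvPolynomial (Fin 6) ℚ) (X 4) (X 5) (n + 1)
  change powerSum₃ s₁ s₂ s₃ (n + 1) = _ at h₁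
  change powerSum₃ s₄ s₅ s₆ (n + 1) = _ at h₂
  simp only [upsilonRows, koszulPotential, diffQuot_mul, key, map_powerSum₃]
  simp only [Polynomial.coe_evalRingHom, Polynomial.eval_X, Polynomial.eval_C, h₁, h₂]
  simp only [boundaryPotential, sixSigns, Fin.sum_univ_six]
  simp
  ring

/-- `Υ = {(v₁, v₂, v₃), (α₁, α₂, α₃)}{-3}`. -/
def upsilon (n : ℕ) : GradedFactorization (Fin 6) n (boundaryPotential sixSigns n) :=
  ((GradedFactorization.koszul (upsilonRows n)).ofEq (koszulPotential_upsilonRows n)).shift (-3)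

end KhovanovRozansky

end

open KhovanovRozansky

/-! Let `M` be a Koszul factorization whose second column `(b₁, …, bₘ)` is a regular sequence. The
`b`-part of the differential is that of the Koszul resolution of `R/(b)`, and the `a`-part raises
Koszul degree, so `M` is a deformation of a finite free resolution. Solving for homotopies one
filtration step at a time, as in the comparison theorem for resolutions, shows that maps `P ⟶ M` in
the homotopy category are the graded maps `P⁰/dP¹ → M⁰/J`, where `M⁰/J ≅ R/(b)`
(`IsResolution.represents`). By a Yoneda argument the graded module `R/(b)` determines `M` up to
homotopy equivalence, whatever the first column is (`Represents.homotopyEquivalent`). Ranks play no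
role, so this also applies to graphs with internal marks, whose modules are regarded over the ring
of the boundary variables.

The theorem thus becomes commutative algebra. All the sequences involved are regular. For a graph
this is seen edge by edge: the two outgoing variables of an edge do not occur in the later rows, and
the linear and quadratic rows of the edge are monic in them after a substitution. For `Υ` one
eliminates `x₃`.

It remains to decompose the cyclic module of `Γ₁` over `R'`. The rows of the first edge make `x₇,
x₈` the two roots of `T² - (x₁ + x₂)T + x₁x₂`, and `x₉ = x₄ + x₅ - x₇`; hence `1` and `x₆ - x₈`
generate (`exists_normalForm`). The annihilators are computed by evaluating at the two orderings of
the roots `x₁, x₂`: `1` spans `R'/(α₁, α₂, α₃)`, `x₆ - x₈` spans `R'/(x₁ + x₂ - x₄ - x₅, x₁x₂ -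
x₄x₅, x₃ - x₆)`, and the sum is direct (`mem_of_mem_tripleIdeal`, `incl_mem_tripleIdeal`). These are
the modules of `Υ` and `Γ₄`; the degree `2` of `x₆ - x₈` turns the shift `{-3}` into `{-1}`.
Reflection gives `C(Γ₃) ≅ Υ ⊕ C(Γ₂)`, and the second isomorphism follows by adding `C(Γ₂)` to the
first and `C(Γ₄)` to this one.

Membership in `hmf_w` is deduced from the finite rank of `Υ`, `C(Γ₂)` and `C(Γ₄)`, because homotopy
equivalences control cohomology. -/

noncomputable section

namespace KhovanovRozansky

/-! ## Linear maps out of free graded modules -/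

namespace FreeGradedModule

variable {σ : Type}

/-- A linear relation that is everywhere solvable in degree `k` on a free graded module contains
the graph of a linear map of degree `k`. -/
theorem exists_linearMap (P N : FreeGradedModule σ) (k : ℤ)
    (S : Submodule (MvPolynomial σ ℚ) (P × N))
    (h : ∀ (j : ℤ) (x : P), x ∈ P.gr j → ∃ y ∈ N.gr (j + k), (x, y) ∈ S) :
    ∃ f : P →ₗ[MvPolynomial σ ℚ] N,
      (∀ (j : ℤ) (x : P), x ∈ P.gr j → f x ∈ N.gr (j + k)) ∧ ∀ x, (x, f x) ∈ S := by
  obtain ⟨ι, b, deg, hb⟩ := P.free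
  have hbi : ∀ i, b i ∈ P.gr (deg i) := by
    classical
    intro i
    rw [hb]
    intro i'
    rw [Module.Basis.repr_self, Finsupp.single_apply]
    split_ifs with hi
    · subst hi
      simpa using isHomog_one
    · exact isHomog_zero _
  choose y hy hyS using fun i => h (deg i) (b i) (hbi i)
  have hf : ∀ x, b.constr (MvPolynomial σ ℚ) y x = ∑ i ∈ (b.repr x).support, b.repr x i • y i := fun x => by
    rw [Module.Basis.constr_apply, Finsupp.sum]
  refine ⟨b.constr (MvPolynomial σ ℚ) y, fun j x hx => ?_, fun x => ?_⟩
  · rw [hf]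
    refine sum_mem fun i _ => mem_of_eq (smul_mem ((hb j x).1 hx i) (hy i)) ?_
    ring
  · have hx : (x, b.constr (MvPolynomial σ ℚ) y x) = ∑ i ∈ (b.repr x).support, b.repr x i • (b i, y i) := by
      refine Prod.ext ?_ ?_
      · rw [Prod.fst_sum]
        exact (b.linearCombination_repr x).symm
      · rw [Prod.snd_sum, hf]
        rfl
    rw [hx]
    exact S.sum_mem fun i _ => S.smul_mem _ (hyS i)

end FreeGradedModule

namespace GradedFactorization

variable {σ : Type} {n : ℕ} {w : MvPolynomial σ ℚ}

/-! ## Homotopy equivalences -/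

/-- `M` and `N` are isomorphic up to homotopy. -/
def HomotopyEquivalent (M N : GradedFactorization σ n w) : Prop :=
  ∃ (f : M ⟶ N) (g : N ⟶ M), Homotopic (f ≫ g) (𝟙 M) ∧ Homotopic (g ≫ f) (𝟙 N)

theorem HomotopyEquivalent.refl (M : GradedFactorization σ n w) : HomotopyEquivalent M M :=
  ⟨𝟙 M, 𝟙 M, Congruence.equivalence.refl _, Congruence.equivalence.refl _⟩

theorem HomotopyEquivalent.symm {M N : GradedFactorization σ n w} :
    HomotopyEquivalent M N → HomotopyEquivalent N M := by
  rintro ⟨f, g, h, h'⟩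
  exact ⟨g, f, h', h⟩

theorem HomotopyEquivalent.trans {M N P : GradedFactorization σ n w} :
    HomotopyEquivalent M N → HomotopyEquivalent N P → HomotopyEquivalent M P := by
  have key : ∀ {A B C : GradedFactorization σ n w} {f : A ⟶ B} {g : B ⟶ A} {f' : B ⟶ C}
      {g' : C ⟶ B}, Homotopic (f ≫ g) (𝟙 A) → Homotopic (f' ≫ g') (𝟙 B) →
      Homotopic ((f ≫ f') ≫ g' ≫ g) (𝟙 A) := by
    intro A B C f g f' g' h h'
    have h₁ : Homotopic (f ≫ (f' ≫ g') ≫ g) (f ≫ 𝟙 B ≫ g) :=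
      HomRel.comp_left _ (HomRel.comp_right _ h')
    exact Congruence.equivalence.trans h₁ h
  rintro ⟨f, g, h₁, h₂⟩ ⟨f', g', h₁', h₂'⟩
  exact ⟨f ≫ f', g' ≫ g, key h₁ h₁', key h₂' h₂⟩

/-- The direct sum of two morphisms. -/
def directSumMap {M M' N N' : GradedFactorization σ n w} (f : M ⟶ M') (g : N ⟶ N') :
    M.directSum N ⟶ M'.directSum N' :=
  Hom.mk (M := M.directSum N) (N := M'.directSum N') (LinearMap.prodMap f.f0 g.f0)
    (LinearMap.prodMap f.f1 g.f1)
    (fun j x hx => ⟨f.f0_mem j x.1 hx.1, g.f0_mem j x.2 hx.2⟩)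
    (fun j x hx => ⟨f.f1_mem j x.1 hx.1, g.f1_mem j x.2 hx.2⟩)
    (fun x => Prod.ext (f.comm0 x.1) (g.comm0 x.2))
    (fun x => Prod.ext (f.comm1 x.1) (g.comm1 x.2))

theorem Homotopic.directSumMap {M M' N N' : GradedFactorization σ n w} {f f' : M ⟶ M'}
    {g g' : N ⟶ N'} : Homotopic f f' → Homotopic g g' →
      Homotopic (directSumMap f g) (directSumMap f' g') := by
  rintro ⟨h0, h1, H0, H1, e0, e1⟩ ⟨k0, k1, K0, K1, e0', e1'⟩
  exact ⟨LinearMap.prodMap h0 k0, LinearMap.prodMap h1 k1,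
    fun j x hx => ⟨H0 j x.1 hx.1, K0 j x.2 hx.2⟩, fun j x hx => ⟨H1 j x.1 hx.1, K1 j x.2 hx.2⟩,
    fun x => Prod.ext (e0 x.1) (e0' x.2), fun x => Prod.ext (e1 x.1) (e1' x.2)⟩

theorem HomotopyEquivalent.directSum {M M' N N' : GradedFactorization σ n w} :
    HomotopyEquivalent M M' → HomotopyEquivalent N N' →
      HomotopyEquivalent (M.directSum N) (M'.directSum N') := by
  rintro ⟨f, g, h₁, h₂⟩ ⟨f', g', h₁', h₂'⟩
  exact ⟨directSumMap f f', directSumMap g g', h₁.directSumMap h₁', h₂.directSumMap h₂'⟩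

/-- The canonical map `(M ⊕ N) ⊕ P → (M ⊕ P) ⊕ N`. -/
def directSumRightComm (M N P : GradedFactorization σ n w) :
    (M.directSum N).directSum P ⟶ (M.directSum P).directSum N :=
  Hom.mk (M := (M.directSum N).directSum P) (N := (M.directSum P).directSum N)
    (LinearMap.prod (LinearMap.prodMap (LinearMap.fst _ M.M0 N.M0) LinearMap.id)
      (LinearMap.snd _ M.M0 N.M0 ∘ₗ LinearMap.fst _ (M.M0 × N.M0) P.M0))
    (LinearMap.prod (LinearMap.prodMap (LinearMap.fst _ M.M1 N.M1) LinearMap.id)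
      (LinearMap.snd _ M.M1 N.M1 ∘ₗ LinearMap.fst _ (M.M1 × N.M1) P.M1))
    (fun _ _ hx => ⟨⟨hx.1.1, hx.2⟩, hx.1.2⟩)
    (fun _ _ hx => ⟨⟨hx.1.1, hx.2⟩, hx.1.2⟩) (fun _ => rfl) (fun _ => rfl)

theorem homotopyEquivalent_directSum_right_comm (M N P : GradedFactorization σ n w) :
    HomotopyEquivalent ((M.directSum N).directSum P) ((M.directSum P).directSum N) :=
  ⟨directSumRightComm M N P, directSumRightComm M P N, Congruence.equivalence.refl _,
    Congruence.equivalence.refl _⟩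

/-! ## Filtered resolutions and lifting -/

/-- The two-step filtration `M⁰ ⊇ J = E 0 ⊇ E 1 ⊇ ⋯`, `M¹ = O 0 ⊇ O 1 ⊇ ⋯` exhibits `M` as a
deformation of a finite graded resolution of the module `M⁰ / J`: the differential lowers the
filtration by one step, and it is exact on the associated graded pieces. -/
structure IsResolution (M : GradedFactorization σ n w)
    (J : Submodule (MvPolynomial σ ℚ) M.M0) (E : ℕ → Submodule (MvPolynomial σ ℚ) M.M0)
    (O : ℕ → Submodule (MvPolynomial σ ℚ) M.M1) (N : ℕ) : Prop where
  E_zero : E 0 = J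
  O_zero : O 0 = ⊤
  E_succ_le : ∀ p, E (p + 1) ≤ E p
  O_succ_le : ∀ p, O (p + 1) ≤ O p
  d0_mem : ∀ p, ∀ x ∈ E (p + 1), M.d0 x ∈ O p
  d1_mem : ∀ p, ∀ y ∈ O p, M.d1 y ∈ E p
  exact_E : ∀ p j, ∀ x ∈ E p, x ∈ M.M0.gr j → M.d0 x ∈ O p →
    ∃ y ∈ O p, y ∈ M.M1.gr (j - (n + 1)) ∧ x - M.d1 y ∈ E (p + 1)
  exact_O : ∀ p j, ∀ y ∈ O p, y ∈ M.M1.gr j → M.d1 y ∈ E (p + 1) →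
    ∃ x ∈ E (p + 1), x ∈ M.M0.gr (j - (n + 1)) ∧ y - M.d0 x ∈ O (p + 1)
  E_eq_bot : E N = ⊥
  O_eq_bot : O N = ⊥

/-- `f` is homotopic to zero by a homotopy whose odd part takes values in `J`. -/
def IsNullVia {P M : GradedFactorization σ n w} (J : Submodule (MvPolynomial σ ℚ) M.M0)
    (f : Hom P M) : Prop :=
  ∃ (h0 : P.M0 →ₗ[MvPolynomial σ ℚ] M.M1) (h1 : P.M1 →ₗ[MvPolynomial σ ℚ] M.M0),
    (∀ (j : ℤ) (x : P.M0), x ∈ P.M0.gr j → h0 x ∈ M.M1.gr (j - (n + 1))) ∧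
    (∀ (j : ℤ) (x : P.M1), x ∈ P.M1.gr j → h1 x ∈ M.M0.gr (j - (n + 1))) ∧
    (∀ x : P.M1, h1 x ∈ J) ∧
    (∀ x : P.M0, f.f0 x = h1 (P.d0 x) + M.d1 (h0 x)) ∧
    (∀ x : P.M1, f.f1 x = h0 (P.d1 x) + M.d0 (h1 x))

/-- Subtracting the boundary of a homotopy from a homomorphism. -/
def Hom.subBoundary {P M : GradedFactorization σ n w} (f : Hom P M)
    (h0 : P.M0 →ₗ[MvPolynomial σ ℚ] M.M1) (h1 : P.M1 →ₗ[MvPolynomial σ ℚ] M.M0)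
    (H0 : ∀ (j : ℤ) (x : P.M0), x ∈ P.M0.gr j → h0 x ∈ M.M1.gr (j - (n + 1)))
    (H1 : ∀ (j : ℤ) (x : P.M1), x ∈ P.M1.gr j → h1 x ∈ M.M0.gr (j - (n + 1))) : Hom P M where
  f0 := f.f0 - (h1 ∘ₗ P.d0 + M.d1 ∘ₗ h0)
  f1 := f.f1 - (h0 ∘ₗ P.d1 + M.d0 ∘ₗ h1)
  f0_mem j x hx := sub_mem (f.f0_mem j x hx) (add_mem
    (FreeGradedModule.mem_of_eq (H1 _ _ (P.d0_mem j x hx)) (by ring))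
    (FreeGradedModule.mem_of_eq (M.d1_mem _ _ (H0 j x hx)) (by ring)))
  f1_mem j x hx := sub_mem (f.f1_mem j x hx) (add_mem
    (FreeGradedModule.mem_of_eq (H0 _ _ (P.d1_mem j x hx)) (by ring))
    (FreeGradedModule.mem_of_eq (M.d0_mem _ _ (H1 j x hx)) (by ring)))
  comm0 x := by
    simp only [LinearMap.sub_apply, LinearMap.add_apply, LinearMap.comp_apply, map_sub, map_add,
      f.comm0, P.d1_d0, M.d0_d1, map_smul]
    abel
  comm1 x := by
    simp only [LinearMap.sub_apply, LinearMap.add_apply, LinearMap.comp_apply, map_sub, map_add,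
      f.comm1, P.d0_d1, M.d1_d0, map_smul]
    abel

/-- Homotopies add up, so a null-homotopy may be built by successive corrections of the map. -/
theorem IsNullVia.of_subBoundary {P M : GradedFactorization σ n w}
    {J : Submodule (MvPolynomial σ ℚ) M.M0} {f : Hom P M}
    {h0 : P.M0 →ₗ[MvPolynomial σ ℚ] M.M1} {h1 : P.M1 →ₗ[MvPolynomial σ ℚ] M.M0}
    {H0 : ∀ (j : ℤ) (x : P.M0), x ∈ P.M0.gr j → h0 x ∈ M.M1.gr (j - (n + 1))}
    {H1 : ∀ (j : ℤ) (x : P.M1), x ∈ P.M1.gr j → h1 x ∈ M.M0.gr (j - (n + 1))}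
    (hJ : ∀ x, h1 x ∈ J) : IsNullVia J (f.subBoundary h0 h1 H0 H1) → IsNullVia J f := by
  rintro ⟨k0, k1, K0, K1, KJ, e0, e1⟩
  refine ⟨k0 + h0, k1 + h1, fun j x hx => add_mem (K0 j x hx) (H0 j x hx),
    fun j x hx => add_mem (K1 j x hx) (H1 j x hx), fun x => add_mem (KJ x) (hJ x),
    fun x => ?_, fun x => ?_⟩
  · have := e0 x
    simp only [Hom.subBoundary, LinearMap.sub_apply, LinearMap.add_apply, LinearMap.comp_apply,
      map_add] at this ⊢
    rw [sub_eq_iff_eq_add] at this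
    rw [this]
    abel
  · have := e1 x
    simp only [Hom.subBoundary, LinearMap.sub_apply, LinearMap.add_apply, LinearMap.comp_apply,
      map_add] at this ⊢
    rw [sub_eq_iff_eq_add] at this
    rw [this]
    abel

namespace IsResolution

variable {M : GradedFactorization σ n w} {J : Submodule (MvPolynomial σ ℚ) M.M0}
  {E : ℕ → Submodule (MvPolynomial σ ℚ) M.M0} {O : ℕ → Submodule (MvPolynomial σ ℚ) M.M1} {N : ℕ}

theorem E_le (hM : IsResolution M J E O N) (p : ℕ) : E p ≤ J := by
  induction p with
  | zero => exact hM.E_zero.le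
  | succ p ih => exact (hM.E_succ_le p).trans ih

/-- Induction on the number `k` of filtration steps left before zero. At each step a homotopy `h0`
pushes the even component from `E p` to `E (p + 1)`, then a homotopy `h1` pushes the odd component
from `O p` to `O (p + 1)`. Exactness solves for the value on each homogeneous element, and freeness
of `P` makes the choices linear. -/
theorem isNullVia_of_mem (hM : IsResolution M J E O N) {P : GradedFactorization σ n w}
    (k : ℕ) : ∀ (p : ℕ), p + k = N → ∀ f : Hom P M, (∀ x, f.f0 x ∈ E p) → (∀ x, f.f1 x ∈ O p) →
      IsNullVia J f := by
  induction k with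
  | zero =>
    rintro p rfl f h₀ h₁
    rw [add_zero] at hM
    refine ⟨0, 0, fun _ _ _ => zero_mem _, fun _ _ _ => zero_mem _, fun _ => zero_mem _,
      fun x => ?_, fun x => ?_⟩
    · have := h₀ x
      rw [hM.E_eq_bot, Submodule.mem_bot] at this
      simp [this]
    · have := h₁ x
      rw [hM.O_eq_bot, Submodule.mem_bot] at this
      simp [this]
  | succ k ih =>
    intro p hp f h₀ h₁
    let S : Submodule (MvPolynomial σ ℚ) (P.M0 × M.M1) :=
      (O p).comap (LinearMap.snd _ P.M0 M.M1) ⊓ (E (p + 1)).comap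
        (f.f0 ∘ₗ LinearMap.fst _ P.M0 M.M1 - M.d1 ∘ₗ LinearMap.snd _ P.M0 M.M1)
    obtain ⟨h0, H0, hS⟩ := P.M0.exists_linearMap M.M1 (-(n + 1)) S fun j x hx => by
      obtain ⟨y, hy, hj, hE⟩ := hM.exact_E p j (f.f0 x) (h₀ x) (f.f0_mem j x hx)
        (by rw [← f.comm0]; exact h₁ _)
      exact ⟨y, FreeGradedModule.mem_of_eq hj (by ring), hy, hE⟩
    have H0' : ∀ (j : ℤ) (x : P.M0), x ∈ P.M0.gr j → h0 x ∈ M.M1.gr (j - (n + 1)) :=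
      fun j x hx => FreeGradedModule.mem_of_eq (H0 j x hx) (by ring)
    -- The correction by `h0` leaves the odd component in `O p` because `h0` takes values there.
    let f' := f.subBoundary h0 0 H0' fun _ _ _ => zero_mem _
    have h₀' : ∀ x, f'.f0 x ∈ E (p + 1) := fun x => by
      have : f'.f0 x = f.f0 x - M.d1 (h0 x) := by simp [f', Hom.subBoundary]
      rw [this]
      exact (hS x).2
    have h₁' : ∀ x, f'.f1 x ∈ O p := fun x => by
      have : f'.f1 x = f.f1 x - h0 (P.d1 x) := by simp [f', Hom.subBoundary]
      rw [this]
      exact sub_mem (h₁ x) (hS _).1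
    let S' : Submodule (MvPolynomial σ ℚ) (P.M1 × M.M0) :=
      (E (p + 1)).comap (LinearMap.snd _ P.M1 M.M0) ⊓ (O (p + 1)).comap
        (f'.f1 ∘ₗ LinearMap.fst _ P.M1 M.M0 - M.d0 ∘ₗ LinearMap.snd _ P.M1 M.M0)
    obtain ⟨h1, H1, hS'⟩ := P.M1.exists_linearMap M.M0 (-(n + 1)) S' fun j x hx => by
      obtain ⟨y, hy, hj, hE⟩ := hM.exact_O p j (f'.f1 x) (h₁' x) (f'.f1_mem j x hx)
        (by rw [← f'.comm1]; exact h₀' _)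
      exact ⟨y, FreeGradedModule.mem_of_eq hj (by ring), hy, hE⟩
    have H1' : ∀ (j : ℤ) (x : P.M1), x ∈ P.M1.gr j → h1 x ∈ M.M0.gr (j - (n + 1)) :=
      fun j x hx => FreeGradedModule.mem_of_eq (H1 j x hx) (by ring)
    -- Only the odd part `h1` of the homotopy must stay in `J`; it is zero in the first correction
    -- and lies in `E (p + 1) ≤ J` in the second.
    refine IsNullVia.of_subBoundary (h0 := h0) (h1 := 0) (H0 := H0')
      (H1 := fun _ _ _ => zero_mem _) (fun _ => zero_mem _) ?_
    refine IsNullVia.of_subBoundary (h0 := 0) (h1 := h1) (H0 := fun _ _ _ => zero_mem _)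
      (H1 := H1') (fun x => hM.E_le _ (hS' x).1) ?_
    refine ih (p + 1) (by omega) _ (fun x => ?_) (fun x => ?_)
    · have : (f'.subBoundary 0 h1 (fun _ _ _ => zero_mem _) H1').f0 x =
          f'.f0 x - h1 (P.d0 x) := by simp [Hom.subBoundary]
      exact this ▸ sub_mem (h₀' x) (hS' _).1
    · have : (f'.subBoundary 0 h1 (fun _ _ _ => zero_mem _) H1').f1 x =
          f'.f1 x - M.d0 (h1 x) := by simp [Hom.subBoundary]
      exact this ▸ (hS' x).2

theorem isNullVia (hM : IsResolution M J E O N) {P : GradedFactorization σ n w} (f : Hom P M)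
    (hf : ∀ x, f.f0 x ∈ J) : IsNullVia J f :=
  hM.isNullVia_of_mem N 0 (zero_add N) f (by rwa [hM.E_zero])
    (by rw [hM.O_zero]; exact fun _ => trivial)

end IsResolution

/-- The factorization `M¹ → M⁰ → M¹`, shifted. -/
def swapShift (M : GradedFactorization σ n w) (m : ℤ) : GradedFactorization σ n w where
  M0 := M.M1.shift m
  M1 := M.M0.shift m
  d0 := M.d1
  d1 := M.d0
  d0_mem j x hx := FreeGradedModule.mem_of_eq (N := M.M0) (M.d1_mem _ x hx) (by ring)
  d1_mem j x hx := FreeGradedModule.mem_of_eq (N := M.M1) (M.d0_mem _ x hx) (by ring)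
  d1_d0 := M.d0_d1
  d0_d1 := M.d1_d0

/-- Homomorphisms from graded factorizations to `M` are, up to homotopy, the maps to the module
`M⁰ / J` that vanish on boundaries. -/
structure Represents (M : GradedFactorization σ n w) (J : Submodule (MvPolynomial σ ℚ) M.M0) :
    Prop where
  d1_mem : ∀ y, M.d1 y ∈ J
  exists_null : ∀ {P : GradedFactorization σ n w} (f : Hom P M), (∀ x, f.f0 x ∈ J) →
    ∃ (h0 : P.M0 →ₗ[MvPolynomial σ ℚ] M.M1) (h1 : P.M1 →ₗ[MvPolynomial σ ℚ] M.M0),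
      (∀ (j : ℤ) (x : P.M0), x ∈ P.M0.gr j → h0 x ∈ M.M1.gr (j - (n + 1))) ∧
      (∀ (j : ℤ) (x : P.M1), x ∈ P.M1.gr j → h1 x ∈ M.M0.gr (j - (n + 1))) ∧
      (∀ x : P.M0, f.f0 x = h1 (P.d0 x) + M.d1 (h0 x)) ∧
      (∀ x : P.M1, f.f1 x = h0 (P.d1 x) + M.d0 (h1 x))
  exists_lift : ∀ {P : GradedFactorization σ n w} (f : P.M0 →ₗ[MvPolynomial σ ℚ] M.M0),
    (∀ (j : ℤ) (x : P.M0), x ∈ P.M0.gr j → f x ∈ M.M0.gr j) → (∀ y, f (P.d1 y) ∈ J) →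
    ∃ F : Hom P M, ∀ x, F.f0 x - f x ∈ J

/-- Lifting reduces to null-homotopy: `(f ∘ d, d ∘ f)` is a map to `M` from `P` with its two parts
exchanged. A null-homotopy `(k0, k1)` of it says exactly that `(f - k1, k0)` commutes with the
differentials, and `k1` with values in `J` means that `f` is unchanged modulo `J`. -/
theorem IsResolution.represents {M : GradedFactorization σ n w}
    {J : Submodule (MvPolynomial σ ℚ) M.M0} {E : ℕ → Submodule (MvPolynomial σ ℚ) M.M0}
    {O : ℕ → Submodule (MvPolynomial σ ℚ) M.M1} {N : ℕ} (hM : IsResolution M J E O N) :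
    Represents M J where
  d1_mem y := hM.E_zero ▸ hM.d1_mem 0 y (hM.O_zero ▸ trivial)
  exists_null f hf := by
    obtain ⟨h0, h1, H0, H1, -, e0, e1⟩ := hM.isNullVia f hf
    exact ⟨h0, h1, H0, H1, e0, e1⟩
  exists_lift {P} f hf hJ := by
    -- The shift by `n + 1` compensates the degree of the differential, so that `F` has degree `0`.
    let F : Hom (P.swapShift (n + 1)) M :=
      { f0 := f ∘ₗ P.d1
        f1 := M.d0 ∘ₗ f
        f0_mem := fun j x hx =>
          FreeGradedModule.mem_of_eq (hf _ _ (P.d1_mem _ x hx)) (by ring)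
        f1_mem := fun j x hx =>
          FreeGradedModule.mem_of_eq (M.d0_mem _ _ (hf _ x hx)) (by ring)
        comm0 := fun x => rfl
        comm1 := fun x =>
          (congrArg f (P.d1_d0 x)).trans ((map_smul f w x).trans (M.d1_d0 _).symm) }
    obtain ⟨h0, h1, H0, H1, HJ, e0, e1⟩ := hM.isNullVia F hJ
    let k0 : P.M1 →ₗ[MvPolynomial σ ℚ] M.M1 := h0
    let k1 : P.M0 →ₗ[MvPolynomial σ ℚ] M.M0 := h1
    have e0' : ∀ x : P.M1, f (P.d1 x) = k1 (P.d1 x) + M.d1 (k0 x) := e0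
    have e1' : ∀ x : P.M0, M.d0 (f x) = k0 (P.d0 x) + M.d0 (k1 x) := e1
    refine ⟨⟨f - k1, k0, fun j x hx => sub_mem (hf j x hx) ?_, fun j x hx => ?_, fun x => ?_,
      fun x => ?_⟩, fun x => ?_⟩
    · exact FreeGradedModule.mem_of_eq (H1 (j + (n + 1)) x
        (FreeGradedModule.mem_of_eq (N := P.M0) hx (by ring))) (by ring)
    · exact FreeGradedModule.mem_of_eq (H0 (j + (n + 1)) x
        (FreeGradedModule.mem_of_eq (N := P.M1) hx (by ring))) (by ring)
    · rw [LinearMap.sub_apply, map_sub, e1', add_sub_cancel_right]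
    · rw [LinearMap.sub_apply, e0', add_sub_cancel_left]
    · rw [LinearMap.sub_apply, sub_sub_cancel_left]
      exact neg_mem (HJ x)

theorem Represents.directSum {M M' : GradedFactorization σ n w}
    {J : Submodule (MvPolynomial σ ℚ) M.M0} {J' : Submodule (MvPolynomial σ ℚ) M'.M0}
    (h : Represents M J) (h' : Represents M' J') :
    Represents (M.directSum M') (J.prod J' : Submodule _ (M.M0 × M'.M0)) where
  d1_mem y := ⟨h.d1_mem y.1, h'.d1_mem y.2⟩
  exists_null {P} f hf := by
    obtain ⟨h0, h1, H0, H1, e0, e1⟩ := h.exists_null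
      (⟨LinearMap.fst _ M.M0 M'.M0 ∘ₗ f.f0, LinearMap.fst _ M.M1 M'.M1 ∘ₗ f.f1,
        fun j x hx => (f.f0_mem j x hx).1, fun j x hx => (f.f1_mem j x hx).1,
        fun x => congrArg Prod.fst (f.comm0 x), fun x => congrArg Prod.fst (f.comm1 x)⟩ : Hom P M)
      fun x => (hf x).1
    obtain ⟨k0, k1, K0, K1, e0', e1'⟩ := h'.exists_null
      (⟨LinearMap.snd _ M.M0 M'.M0 ∘ₗ f.f0, LinearMap.snd _ M.M1 M'.M1 ∘ₗ f.f1,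
        fun j x hx => (f.f0_mem j x hx).2, fun j x hx => (f.f1_mem j x hx).2,
        fun x => congrArg Prod.snd (f.comm0 x), fun x => congrArg Prod.snd (f.comm1 x)⟩ : Hom P M')
      fun x => (hf x).2
    exact ⟨h0.prod k0, h1.prod k1, fun j x hx => ⟨H0 j x hx, K0 j x hx⟩,
      fun j x hx => ⟨H1 j x hx, K1 j x hx⟩, fun x => Prod.ext (e0 x) (e0' x),
      fun x => Prod.ext (e1 x) (e1' x)⟩
  exists_lift {P} f hf hJ := by
    obtain ⟨F, hF⟩ := h.exists_lift (P := P) (LinearMap.fst _ M.M0 M'.M0 ∘ₗ f)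
      (fun j x hx => (hf j x hx).1) fun y => (hJ y).1
    obtain ⟨F', hF'⟩ := h'.exists_lift (P := P) (LinearMap.snd _ M.M0 M'.M0 ∘ₗ f)
      (fun j x hx => (hf j x hx).2) fun y => (hJ y).2
    exact ⟨⟨F.f0.prod F'.f0, F.f1.prod F'.f1, fun j x hx => ⟨F.f0_mem j x hx, F'.f0_mem j x hx⟩,
      fun j x hx => ⟨F.f1_mem j x hx, F'.f1_mem j x hx⟩,
      fun x => Prod.ext (F.comm0 x) (F'.comm0 x), fun x => Prod.ext (F.comm1 x) (F'.comm1 x)⟩,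
      fun x => ⟨hF x, hF' x⟩⟩

/-- The uniqueness half of representability: a map is determined up to homotopy by its even
component modulo `J`. -/
theorem Represents.homotopic {M P : GradedFactorization σ n w}
    {J : Submodule (MvPolynomial σ ℚ) M.M0} (h : Represents M J) (f g : P ⟶ M)
    (hfg : ∀ x, f.f0 x - g.f0 x ∈ J) : Homotopic f g := by
  obtain ⟨h0, h1, H0, H1, e0, e1⟩ := h.exists_null
    (⟨f.f0 - g.f0, f.f1 - g.f1, fun j x hx => sub_mem (f.f0_mem j x hx) (g.f0_mem j x hx),
      fun j x hx => sub_mem (f.f1_mem j x hx) (g.f1_mem j x hx),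
      fun x => by simp [f.comm0, g.comm0], fun x => by simp [f.comm1, g.comm1]⟩ : Hom P M) hfg
  exact ⟨h0, h1, H0, H1, e0, e1⟩

/-- Factorizations representing isomorphic graded modules are homotopy equivalent. -/
theorem Represents.homotopyEquivalent {M N : GradedFactorization σ n w}
    {J : Submodule (MvPolynomial σ ℚ) M.M0} {K : Submodule (MvPolynomial σ ℚ) N.M0}
    (hM : Represents M J) (hN : Represents N K) (ψ : N.M0 →ₗ[MvPolynomial σ ℚ] M.M0)
    (hψ : ∀ (j : ℤ) (x : N.M0), x ∈ N.M0.gr j → ψ x ∈ M.M0.gr j)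
    (hJK : ∀ y, ψ y ∈ J ↔ y ∈ K)
    (hsurj : ∀ (j : ℤ) (x : M.M0), x ∈ M.M0.gr j → ∃ y ∈ N.M0.gr j, x - ψ y ∈ J) :
    HomotopyEquivalent M N := by
  -- `φ` lifts the inverse of the isomorphism `N⁰/K ≅ M⁰/J` induced by `ψ`. The maps `F` and `G`
  -- extend `φ` and `ψ` to factorizations, and both composites are the identity modulo `J` and `K`.
  obtain ⟨φ, hφ, hφJ⟩ := M.M0.exists_linearMap N.M0 0
    (J.comap (LinearMap.fst _ M.M0 N.M0 - ψ ∘ₗ LinearMap.snd _ M.M0 N.M0))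
    (by simpa using hsurj)
  replace hφJ : ∀ x, x - ψ (φ x) ∈ J := hφJ
  obtain ⟨G, hG⟩ := hM.exists_lift (P := N) ψ hψ fun y => (hJK _).2 (hN.d1_mem y)
  obtain ⟨F, hF⟩ := hN.exists_lift (P := M) φ (by simpa using hφ) fun y => by
    rw [← hJK, ← sub_sub_cancel (M.d1 y) (ψ _)]
    exact sub_mem (hM.d1_mem y) (hφJ _)
  have h₁ : ∀ x, G.f0 (F.f0 x) - x ∈ J := fun x => by
    have := sub_mem (add_mem (hG (F.f0 x)) ((hJK _).2 (hF x))) (hφJ x)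
    rw [map_sub] at this
    convert this using 1
    abel
  refine ⟨F, G, hM.homotopic _ _ h₁, hN.homotopic _ _ fun x => ?_⟩
  change F.f0 (G.f0 x) - x ∈ K
  -- Membership in `K` is tested after applying `ψ`, which `G` equals modulo `J`.
  rw [← hJK, map_sub]
  have := sub_mem (add_mem (h₁ (G.f0 x)) (hG x)) (hG (F.f0 (G.f0 x)))
  convert this using 1
  abel

end GradedFactorization

/-! ## Homogeneous components -/

section Components

variable {σ τ : Type}

/-- The component of degree `k` of a polynomial, all variables having degree `2`. -/
def homogComponent (k : ℤ) : MvPolynomial σ ℚ →ₗ[ℚ] MvPolynomial σ ℚ :=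
  weightedHomogeneousComponent (fun _ => (2 : ℤ)) k

theorem coeff_homogComponent (k : ℤ) (p : MvPolynomial σ ℚ) (m : σ →₀ ℕ) :
    coeff m (homogComponent k p) = if 2 * (m.degree : ℤ) = k then coeff m p else 0 := by
  classical
  have h : Finsupp.weight (fun _ : σ => (2 : ℤ)) m = 2 * (m.degree : ℤ) := by
    rw [Finsupp.weight_apply, Finsupp.sum, Finsupp.degree_apply, Nat.cast_sum, Finset.mul_sum]
    exact Finset.sum_congr rfl fun i _ => by simp [mul_comm]
  rw [homogComponent, coeff_weightedHomogeneousComponent, h]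

theorem isHomog_homogComponent (k : ℤ) (p : MvPolynomial σ ℚ) : IsHomog (homogComponent k p) k := by
  intro m hm
  rw [coeff_homogComponent] at hm
  by_contra h
  exact hm (if_neg h)

theorem IsHomog.homogComponent_eq {k : ℤ} {p : MvPolynomial σ ℚ} (hp : IsHomog p k) :
    homogComponent k p = p := by
  ext m
  rw [coeff_homogComponent]
  split_ifs with h
  · rfl
  · by_contra h'
    exact h (hp m (Ne.symm h'))

theorem IsHomog.homogComponent_mul {d : ℤ} {b : MvPolynomial σ ℚ} (hb : IsHomog b d) (k : ℤ)
    (p : MvPolynomial σ ℚ) : homogComponent k (b * p) = b * homogComponent (k - d) p := by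
  classical
  ext m
  rw [coeff_homogComponent, coeff_mul, coeff_mul, ← Finset.sum_const_zero, ← Finset.sum_ite_irrel]
  refine Finset.sum_congr rfl fun u hu => ?_
  rw [coeff_homogComponent]
  by_cases hub : coeff u.1 b = 0
  · simp [hub]
  · have h₁ := hb _ hub
    have h₂ : (m.degree : ℤ) = u.1.degree + u.2.degree := by
      rw [← Finset.HasAntidiagonal.mem_antidiagonal.mp hu, map_add, Nat.cast_add]
    have h₃ : 2 * (m.degree : ℤ) = k ↔ 2 * (u.2.degree : ℤ) = k - d := by
      constructor <;> intro h <;> linarith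
    simp only [h₃, mul_ite, mul_zero]

theorem homogComponent_rename (f : σ → τ) (k : ℤ) (p : MvPolynomial σ ℚ) :
    homogComponent k (rename f p) = rename f (homogComponent k p) := by
  have hmon : ∀ {σ : Type} (m : σ →₀ ℕ) (a : ℚ), homogComponent k (monomial m a) =
      if 2 * (m.degree : ℤ) = k then monomial m a else 0 := by
    classical
    intro σ m a
    ext m'
    rw [coeff_homogComponent, coeff_monomial]
    by_cases h : m = m'
    · subst h
      by_cases h : 2 * (m.degree : ℤ) = k <;> simp [h]
    · split_ifs <;> simp [coeff_monomial, h]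
  induction p using MvPolynomial.induction_on' with
  | monomial m a =>
    rw [rename_monomial, hmon, hmon, Finsupp.degree_mapDomain]
    split_ifs
    · rw [rename_monomial]
    · rw [map_zero]
  | add p q hp hq => simp only [map_add, hp, hq]

theorem IsHomog.rename {k : ℤ} {p : MvPolynomial σ ℚ} (hp : IsHomog p k) (f : σ → τ) :
    IsHomog (rename f p) k := by
  rw [← hp.homogComponent_eq, ← homogComponent_rename]
  exact isHomog_homogComponent k _

end Components

/-! ## Koszul factorizations of regular sequences -/

section RowIdeal

variable {σ : Type} {n : ℕ}

/-- The ideal `(b₁, …, bₘ)` of a list of rows. -/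
def rowIdeal : List (KoszulRow σ n) → Ideal (MvPolynomial σ ℚ)
  | [] => ⊥
  | r :: l => Ideal.span {r.b} ⊔ rowIdeal l

/-- `f` is a nonzerodivisor modulo `I`. -/
def IsRegularMod {A : Type} [CommRing A] (I : Ideal A) (f : A) : Prop :=
  ∀ g, f * g ∈ I → g ∈ I

/-- The sequence `bₘ, …, b₁` is regular. -/
def IsRegularRows : List (KoszulRow σ n) → Prop
  | [] => True
  | r :: l => IsRegularMod (rowIdeal l) r.b ∧ IsRegularRows l

/-- The ideal of the rows is generated by homogeneous elements. This allows coefficients in ideal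
memberships to be replaced by homogeneous ones of the right degree. -/
theorem homogComponent_mem_rowIdeal {l : List (KoszulRow σ n)} {p : MvPolynomial σ ℚ}
    (hp : p ∈ rowIdeal l) (k : ℤ) : homogComponent k p ∈ rowIdeal l := by
  induction l generalizing p with
  | nil =>
    rw [rowIdeal, Ideal.mem_bot] at hp ⊢
    rw [hp, map_zero]
  | cons r l ih =>
    rw [rowIdeal, Ideal.mem_span_singleton_sup] at hp ⊢
    obtain ⟨a, q, hq, rfl⟩ := hp
    exact ⟨homogComponent (k - r.degB) a, _, ih hq, by
      rw [map_add, mul_comm a, r.b_homog.homogComponent_mul, mul_comm r.b]⟩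

end RowIdeal

namespace GradedFactorization

variable {σ : Type} {n : ℕ} {w : MvPolynomial σ ℚ}

/-- Tensoring with a row is the mapping cone of multiplication by `b`, which resolves `(M⁰/J)/b`
when `b` is a nonzerodivisor on `M⁰/J`. For `p ≥ 1` one may think of `E p` as Koszul degree at least
`2p`, and of `O p` as degree at least `2p + 1`; the new generator has degree `1`, whence the pieces
`E (p + 1) × O p` and `O (p + 1) × E (p + 1)`. The submodule `J'` is the preimage of `J + bM⁰` under
the first coordinate, and `hgr` makes the multiplier of `b` homogeneous. -/
theorem IsResolution.tensorRow {M : GradedFactorization σ n w}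
    {J : Submodule (MvPolynomial σ ℚ) M.M0} {E : ℕ → Submodule (MvPolynomial σ ℚ) M.M0}
    {O : ℕ → Submodule (MvPolynomial σ ℚ) M.M1} {N : ℕ} (hM : IsResolution M J E O N)
    (r : KoszulRow σ n) (hr : ∀ x, r.b • x ∈ J → x ∈ J)
    (J' : Submodule (MvPolynomial σ ℚ) (M.M0 × M.M1))
    (hJ' : ∀ x, x ∈ J' ↔ ∃ q, x.1 - r.b • q ∈ J)
    (hgr : ∀ j, ∀ x ∈ M.M0.gr j, (∃ q, x - r.b • q ∈ J) →
      ∃ q ∈ M.M0.gr (j - r.degB), x - r.b • q ∈ J) :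
    IsResolution (M.tensorRow r) J'
      (fun p => Nat.casesOn p J' fun p => (E (p + 1)).prod (O p))
      (fun p => Nat.casesOn p (⊤ : Submodule _ (M.M1 × M.M0))
        fun p => (O (p + 1)).prod (E (p + 1))) (N + 1) where
  E_zero := rfl
  O_zero := rfl
  E_succ_le p := by
    cases p with
    | zero =>
      rintro ⟨(x : M.M0), (y : M.M1)⟩ ⟨hx, -⟩
      exact (hJ' _).2 ⟨0, by simpa using hM.E_le 1 hx⟩
    | succ p => exact Submodule.prod_mono (hM.E_succ_le _) (hM.O_succ_le _)
  O_succ_le p := by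
    cases p with
    | zero => exact le_top
    | succ p => exact Submodule.prod_mono (hM.O_succ_le _) (hM.E_succ_le _)
  d0_mem p := by
    rintro ⟨(x : M.M0), (y : M.M1)⟩ ⟨hx : x ∈ E (p + 1), hy : y ∈ O p⟩
    cases p with
    | zero => trivial
    | succ p =>
      exact ⟨add_mem (hM.d0_mem _ x hx) (Submodule.smul_mem _ _ hy),
        sub_mem (Submodule.smul_mem _ _ (hM.E_succ_le _ hx)) (hM.d1_mem _ y hy)⟩
  d1_mem p := by
    rintro ⟨(x : M.M1), (y : M.M0)⟩ h
    cases p with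
    | zero =>
      refine (hJ' _).2 ⟨y, ?_⟩
      have : M.d1 x ∈ J := hM.E_zero ▸ hM.d1_mem 0 x (hM.O_zero ▸ trivial)
      change M.d1 x + r.b • y - r.b • y ∈ J
      rwa [add_sub_cancel_right]
    | succ p =>
      exact ⟨add_mem (hM.d1_mem _ x h.1) (Submodule.smul_mem _ _ h.2),
        sub_mem (Submodule.smul_mem _ _ (hM.O_succ_le _ h.1)) (hM.d0_mem _ y h.2)⟩
  exact_E p j := by
    rintro ⟨(x : M.M0), (y : M.M1)⟩ h ⟨hxj : x ∈ M.M0.gr j, hyj : y ∈ M.M1.gr (j - (r.degB - (n + 1)))⟩ hd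
    cases p with
    | zero =>
      obtain ⟨q, hqj, hq⟩ := hgr j x hxj ((hJ' _).1 h)
      obtain ⟨z, hz, hzj, hE⟩ := hM.exact_E 0 j (x - r.b • q) (by rwa [hM.E_zero])
        (sub_mem hxj (FreeGradedModule.mem_of_eq
          (FreeGradedModule.smul_mem r.b_homog hqj) (by ring))) (by rw [hM.O_zero]; trivial)
      refine ⟨(z, q), trivial, ⟨hzj, FreeGradedModule.mem_of_eq (N := M.M0) hqj (by ring)⟩,
        ?_, ?_⟩
      · change x - (M.d1 z + r.b • q) ∈ E 1
        rwa [add_comm, ← sub_sub]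
      · exact hM.O_zero ▸ trivial
    | succ p =>
      obtain ⟨hx : x ∈ E (p + 1), hy : y ∈ O p⟩ := h
      obtain ⟨hd₁ : M.d0 x + r.b • y ∈ O (p + 1), hd₂ : r.a • x - M.d1 y ∈ E (p + 1)⟩ := hd
      -- The second coordinate is solved first, modulo the next step; its solution `z` perturbs the
      -- equation for the first coordinate by `b z`. The sign of `-z` comes from the minus sign in
      -- the tensor differential.
      obtain ⟨z, hz, hzj, hO⟩ := hM.exact_O p _ y hy hyj
        ((Submodule.sub_mem_iff_right _ (Submodule.smul_mem _ _ hx)).1 hd₂)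
      obtain ⟨t, ht, htj, hE⟩ := hM.exact_E (p + 1) j (x + r.b • z)
        (add_mem hx (Submodule.smul_mem _ _ hz))
        (add_mem hxj (FreeGradedModule.mem_of_eq
          (FreeGradedModule.smul_mem r.b_homog hzj) (by ring))) (by
          have := sub_mem hd₁ (Submodule.smul_mem _ r.b hO)
          convert this using 1
          rw [map_add, map_smul]
          module)
      refine ⟨(t, -z), ⟨ht, neg_mem hz⟩, ⟨htj,
        (M.M0.gr _).neg_mem (FreeGradedModule.mem_of_eq hzj (by ring))⟩, ?_, ?_⟩
      · change x - (M.d1 t + r.b • -z) ∈ E (p + 2)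
        convert hE using 1
        module
      · change y - (r.a • t - M.d0 (-z)) ∈ O (p + 1)
        have := sub_mem hO (Submodule.smul_mem _ r.a ht)
        convert this using 1
        rw [map_neg]
        module
  exact_O p j := by
    rintro ⟨(x : M.M1), (y : M.M0)⟩ h ⟨hxj : x ∈ M.M1.gr j,
      hyj : y ∈ M.M0.gr (j - (r.degB - (n + 1)))⟩
      ⟨hd₁ : M.d1 x + r.b • y ∈ E (p + 1), hd₂ : r.a • x - M.d0 y ∈ O p⟩
    -- The only use of regularity: at the bottom of the filtration `b y ∈ J` has to give `y ∈ J`.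
    have hxy : x ∈ O p ∧ y ∈ E p := by
      cases p with
      | zero =>
        rw [hM.O_zero, hM.E_zero]
        have hx : M.d1 x ∈ J := hM.E_zero ▸ hM.d1_mem 0 x (hM.O_zero ▸ trivial)
        exact ⟨trivial, hr y ((add_mem_cancel_left hx).1 (hM.E_le 1 hd₁))⟩
      | succ p => exact h
    obtain ⟨z, hz, hzj, hE⟩ := hM.exact_E p _ y hxy.2 hyj
      ((Submodule.sub_mem_iff_right _ (Submodule.smul_mem _ _ hxy.1)).1 hd₂)
    obtain ⟨t, ht, htj, hO⟩ := hM.exact_O p j (x + r.b • z)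
      (add_mem hxy.1 (Submodule.smul_mem _ _ hz))
      (add_mem hxj (FreeGradedModule.mem_of_eq
        (FreeGradedModule.smul_mem r.b_homog hzj) (by ring))) (by
        have := sub_mem hd₁ (Submodule.smul_mem _ r.b hE)
        convert this using 1
        rw [map_add, map_smul]
        module)
    refine ⟨(t, -z), ⟨ht, neg_mem hz⟩, ⟨htj,
      (M.M1.gr _).neg_mem (FreeGradedModule.mem_of_eq hzj (by ring))⟩, ?_, ?_⟩
    · change x - (M.d0 t + r.b • -z) ∈ O (p + 1)
      convert hO using 1
      module
    · change y - (r.a • t - M.d1 (-z)) ∈ E (p + 1)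
      have := sub_mem hE (Submodule.smul_mem _ r.a ht)
      convert this using 1
      rw [map_neg]
      module
  E_eq_bot := by
    change (E (N + 1)).prod (O N) = ⊥
    rw [hM.O_eq_bot, eq_bot_iff.2 ((hM.E_succ_le N).trans hM.E_eq_bot.le), Submodule.prod_bot]
  O_eq_bot := by
    change (O (N + 1)).prod (E (N + 1)) = ⊥
    rw [eq_bot_iff.2 ((hM.O_succ_le N).trans hM.O_eq_bot.le),
      eq_bot_iff.2 ((hM.E_succ_le N).trans hM.E_eq_bot.le), Submodule.prod_bot]

/-- The coordinate of `R ⊗ ⋯ ⊗ R` in the even part of a Koszul factorization. -/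
def koszulProj : (l : List (KoszulRow σ n)) → (koszul l).M0 →ₗ[MvPolynomial σ ℚ] MvPolynomial σ ℚ
  | [] => LinearMap.id
  | _ :: l => koszulProj l ∘ₗ LinearMap.fst _ (koszul l).M0 (koszul l).M1

/-- The inclusion of `R ⊗ ⋯ ⊗ R` into the even part of a Koszul factorization. -/
def koszulIncl : (l : List (KoszulRow σ n)) → MvPolynomial σ ℚ →ₗ[MvPolynomial σ ℚ] (koszul l).M0
  | [] => LinearMap.id
  | _ :: l => LinearMap.inl _ (koszul l).M0 (koszul l).M1 ∘ₗ koszulIncl l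

theorem koszulProj_koszulIncl (l : List (KoszulRow σ n)) (p : MvPolynomial σ ℚ) :
    koszulProj l (koszulIncl l p) = p := by
  induction l with
  | nil => rfl
  | cons r l ih => exact ih

theorem isHomog_koszulProj {l : List (KoszulRow σ n)} {j : ℤ} {x : (koszul l).M0}
    (hx : x ∈ (koszul l).M0.gr j) : IsHomog (koszulProj l x) j := by
  induction l with
  | nil => exact hx
  | cons r l ih => exact ih hx.1

theorem koszulIncl_mem (l : List (KoszulRow σ n)) {j : ℤ} {p : MvPolynomial σ ℚ}
    (hp : IsHomog p j) : koszulIncl l p ∈ (koszul l).M0.gr j := by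
  induction l with
  | nil => exact hp
  | cons r l ih => exact ⟨ih, zero_mem _⟩

/-- The elements of the even part whose coordinate in `R ⊗ ⋯ ⊗ R` lies in `(b₁, …, bₘ)`. -/
def koszulKer (l : List (KoszulRow σ n)) : Submodule (MvPolynomial σ ℚ) (koszul l).M0 :=
  Submodule.comap (koszulProj l) (rowIdeal l)

theorem isResolution_unit : IsResolution (unit σ n) ⊥ (fun _ => ⊥) (fun _ => ⊤) 0 where
  E_zero := rfl
  O_zero := rfl
  E_succ_le _ := le_rfl
  O_succ_le _ := le_rfl
  d0_mem _ _ _ := trivial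
  d1_mem _ _ _ := zero_mem _
  exact_E _ _ x hx _ _ := ⟨0, trivial, zero_mem _, by
    rw [map_zero, sub_zero]
    exact hx⟩
  exact_O _ _ _ _ _ _ := ⟨0, zero_mem _, zero_mem _, trivial⟩
  E_eq_bot := rfl
  O_eq_bot := eq_bot_iff.2 fun _ _ => rfl

/-- Rows are added one at a time, each regular modulo the rows after it. The coordinate `koszulProj`
identifies `M⁰/J` with `R/(b₁, …, bₘ)`, so the hypotheses of `IsResolution.tensorRow` become
statements about this quotient ring. -/
theorem exists_isResolution_koszul (l : List (KoszulRow σ n)) (hl : IsRegularRows l) :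
    ∃ E O N, IsResolution (koszul l) (koszulKer l) E O N := by
  induction l with
  | nil => exact ⟨_, _, _, isResolution_unit⟩
  | cons r l ih =>
    obtain ⟨E, O, N, h⟩ := ih hl.2
    refine ⟨_, _, _, h.tensorRow r (fun x hx => ?_) _ (fun x => ?_) fun j x hx hq => ?_⟩
    · rw [koszulKer, Submodule.mem_comap, map_smul] at hx
      exact hl.1 _ hx
    · change koszulProj l x.1 ∈ rowIdeal (r :: l) ↔ _
      rw [rowIdeal, Ideal.mem_span_singleton_sup]
      constructor
      · rintro ⟨a, q, hq, hx⟩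
        refine ⟨koszulIncl l a, ?_⟩
        rw [koszulKer, Submodule.mem_comap, map_sub, map_smul, koszulProj_koszulIncl, ← hx, smul_eq_mul,
          mul_comm, add_sub_cancel_left]
        exact hq
      · rintro ⟨q, hq⟩
        rw [koszulKer, Submodule.mem_comap, map_sub, map_smul, smul_eq_mul] at hq
        exact ⟨_, _, hq, by rw [mul_comm, add_sub_cancel]⟩
    · obtain ⟨q, hq⟩ := hq
      refine ⟨koszulIncl l (homogComponent (j - r.degB) (koszulProj l q)),
        koszulIncl_mem l (isHomog_homogComponent _ _), ?_⟩
      rw [koszulKer, Submodule.mem_comap, map_sub, map_smul, smul_eq_mul] at hq ⊢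
      rw [koszulProj_koszulIncl]
      -- Taking the degree `j` component of the membership replaces the multiplier of `b` by its
      -- component of degree `j - degB`.
      have := homogComponent_mem_rowIdeal hq j
      rwa [map_sub, r.b_homog.homogComponent_mul, (isHomog_koszulProj hx).homogComponent_eq] at this

/-- A submodule over `ℚ[I ⊔ B]` seen as a submodule over the subring `ℚ[B]`. -/
def restrictSubmodule {I B : Type} {N : FreeGradedModule (I ⊕ B)}
    (S : Submodule (MvPolynomial (I ⊕ B) ℚ) N) : Submodule (MvPolynomial B ℚ) N.restrict where
  carrier := (S : Set N)
  add_mem' := S.add_mem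
  zero_mem' := S.zero_mem
  smul_mem' r _ h := S.smul_mem (rename Sum.inr r) h

/-! ### Resolutions under change of potential, shift and restriction of scalars -/

section

variable {M : GradedFactorization σ n w} {J : Submodule (MvPolynomial σ ℚ) M.M0}
  {E : ℕ → Submodule (MvPolynomial σ ℚ) M.M0} {O : ℕ → Submodule (MvPolynomial σ ℚ) M.M1} {N : ℕ}

theorem IsResolution.ofEq {w' : MvPolynomial σ ℚ} (hM : IsResolution M J E O N) (hw : w = w') :
    IsResolution (M.ofEq hw) J E O N :=
  ⟨hM.E_zero, hM.O_zero, hM.E_succ_le, hM.O_succ_le, hM.d0_mem, hM.d1_mem, hM.exact_E, hM.exact_O,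
    hM.E_eq_bot, hM.O_eq_bot⟩

theorem IsResolution.shift (hM : IsResolution M J E O N) (m : ℤ) :
    IsResolution (M.shift m) J E O N where
  E_zero := hM.E_zero
  O_zero := hM.O_zero
  E_succ_le := hM.E_succ_le
  O_succ_le := hM.O_succ_le
  d0_mem := hM.d0_mem
  d1_mem := hM.d1_mem
  exact_E p j x hx hxj hd := by
    obtain ⟨y, hy, hyj, h⟩ := hM.exact_E p _ x hx hxj hd
    exact ⟨y, hy, FreeGradedModule.mem_of_eq (N := M.M1) hyj (by ring), h⟩
  exact_O p j x hx hxj hd := by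
    obtain ⟨y, hy, hyj, h⟩ := hM.exact_O p _ x hx hxj hd
    exact ⟨y, hy, FreeGradedModule.mem_of_eq (N := M.M0) hyj (by ring), h⟩
  E_eq_bot := hM.E_eq_bot
  O_eq_bot := hM.O_eq_bot

end

/-- The conditions concern only elements, degrees and differentials, none of which change when
scalars are restricted. Freeness over the smaller ring is part of the restricted graded module. -/
theorem IsResolution.restrict {I B : Type} {w : MvPolynomial B ℚ}
    {M : GradedFactorization (I ⊕ B) n (rename Sum.inr w)}
    {J : Submodule (MvPolynomial (I ⊕ B) ℚ) M.M0}
    {E : ℕ → Submodule (MvPolynomial (I ⊕ B) ℚ) M.M0}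
    {O : ℕ → Submodule (MvPolynomial (I ⊕ B) ℚ) M.M1} {N : ℕ} (hM : IsResolution M J E O N) :
    IsResolution M.restrict (restrictSubmodule J) (fun p => restrictSubmodule (E p))
      (fun p => restrictSubmodule (O p)) N where
  E_zero := congrArg restrictSubmodule hM.E_zero
  O_zero := congrArg restrictSubmodule hM.O_zero
  E_succ_le := hM.E_succ_le
  O_succ_le := hM.O_succ_le
  d0_mem := hM.d0_mem
  d1_mem := hM.d1_mem
  exact_E := hM.exact_E
  exact_O := hM.exact_O
  E_eq_bot := congrArg restrictSubmodule hM.E_eq_bot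
  O_eq_bot := congrArg restrictSubmodule hM.O_eq_bot

end GradedFactorization

namespace MarkedGraph

open GradedFactorization

theorem represents_factorization {B I : Type} [Fintype B] [Fintype I] {s : B → ℤˣ}
    (Γ : MarkedGraph B s I) (n : ℕ) (h : IsRegularRows (Γ.rows n)) :
    Represents (Γ.factorization n)
      (restrictSubmodule (N := (koszul (Γ.rows n)).M0.shift (-(Γ.wide.length : ℤ)))
        (koszulKer (Γ.rows n))) := by
  obtain ⟨E, O, N, hE⟩ := exists_isResolution_koszul _ h
  exact ((hE.ofEq (Γ.koszulPotential_rows n)).shift (-(Γ.wide.length : ℤ))).restrict.represents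

end MarkedGraph

/-! ## Regular sequences in polynomial rings -/

section Regular

variable {A : Type} [CommRing A] {I : Ideal A} {a b : A}

/-- If `a f = b g` modulo `I`, then regularity of `b` modulo `a` gives `g = a k`, and cancelling `a`
gives `f = b k`. The exchange yields `a` regular modulo `b`, but not `b` regular modulo `I`. -/
theorem IsRegularMod.swap (ha : IsRegularMod I a) (hb : IsRegularMod (Ideal.span {a} ⊔ I) b) :
    IsRegularMod (Ideal.span {b} ⊔ I) a := by
  intro f hf
  obtain ⟨g, i, hi, h⟩ := Ideal.mem_span_singleton_sup.1 hf
  obtain ⟨k, i', hi', rfl⟩ := Ideal.mem_span_singleton_sup.1 (hb g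
    (Ideal.mem_span_singleton_sup.2 ⟨f, -i, neg_mem hi, by linear_combination -h⟩))
  refine Ideal.mem_span_singleton_sup.2 ⟨k, f - k * b, ha _ ?_, by ring⟩
  have : a * (f - k * b) = i + b * i' := by linear_combination -h
  rw [this]
  exact add_mem hi (I.mul_mem_left _ hi')

theorem IsRegularMod.neg (h : IsRegularMod I (-a)) : IsRegularMod I a := fun g hg =>
  h g (by rw [neg_mul]; exact neg_mem hg)

theorem IsRegularMod.congr (h : IsRegularMod I a) (hab : b - a ∈ I) : IsRegularMod I b :=
  fun g hg => h g (by
    have := sub_mem hg (I.mul_mem_right g hab)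
    rwa [← sub_mul, sub_sub_cancel] at this)

theorem isRegularMod_bot [IsDomain A] (ha : a ≠ 0) : IsRegularMod ⊥ a := fun _ hg =>
  (mul_eq_zero.1 hg).resolve_left ha

/-- An element that becomes monic in a new variable is a nonzerodivisor modulo an ideal that does
not involve that variable. -/
theorem isRegularMod_of_monic (ψ : A →+* Polynomial A) (t : A) (hψ : ∀ x, (ψ x).eval t = x)
    (hI : I ≤ (I.map Polynomial.C).comap ψ) (ha : (ψ a).Monic) : IsRegularMod I a := by
  intro g hg
  have h₁ := (Ideal.mem_map_C_iff.1 (hI hg) : _)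
  have h₂ : (ψ a).map (Ideal.Quotient.mk I) * (ψ g).map (Ideal.Quotient.mk I) = 0 := by
    rw [← Polynomial.map_mul, ← map_mul]
    ext k
    rw [Polynomial.coeff_map, Polynomial.coeff_zero, Ideal.Quotient.eq_zero_iff_mem]
    exact h₁ k
  have h₃ := (ha.map (Ideal.Quotient.mk I)).mul_right_eq_zero_iff.1 h₂
  rw [← hψ g, Polynomial.eval_eq_sum, Polynomial.sum]
  refine sum_mem fun k _ => I.mul_mem_right _ ?_
  rw [← Ideal.Quotient.eq_zero_iff_mem, ← Polynomial.coeff_map, h₃, Polynomial.coeff_zero]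

/-- Regularity modulo an ideal can be checked after eliminating a variable. -/
theorem IsRegularMod.of_retraction (θ : A →+* A) (hI : I ≤ I.comap θ) (hb : θ b = 0)
    (hθ : ∀ x, x - θ x ∈ Ideal.span {b}) (h : IsRegularMod I (θ a)) :
    IsRegularMod (Ideal.span {b} ⊔ I) a := by
  -- The ideal `(b) + I` is the preimage of `I` under `θ`.
  have key : ∀ x, x ∈ Ideal.span {b} ⊔ I ↔ θ x ∈ I := by
    intro x
    constructor
    · intro hx
      obtain ⟨c, i, hi, rfl⟩ := Ideal.mem_span_singleton_sup.1 hx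
      rw [map_add, map_mul, hb, mul_zero, zero_add]
      exact hI hi
    · intro hx
      rw [← sub_add_cancel x (θ x)]
      exact add_mem (Ideal.mem_sup_left (hθ x)) (Ideal.mem_sup_right hx)
  intro g hg
  rw [key, map_mul] at hg
  exact (key g).2 (h _ hg)

end Regular

section Variables

variable {σ : Type} {I : Ideal (MvPolynomial σ ℚ)} {s : Set σ}

/-- The ideal `I` is generated by polynomials in the variables in `s`. -/
def IsSupportedIdeal (I : Ideal (MvPolynomial σ ℚ)) (s : Set σ) : Prop :=
  I ≤ Ideal.span {p | p ∈ I ∧ p ∈ supported ℚ s}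

theorem isSupportedIdeal_bot : IsSupportedIdeal (⊥ : Ideal (MvPolynomial σ ℚ)) s := bot_le

theorem IsSupportedIdeal.span_sup (hI : IsSupportedIdeal I s) {p : MvPolynomial σ ℚ}
    (hp : p ∈ supported ℚ s) : IsSupportedIdeal (Ideal.span {p} ⊔ I) s := by
  refine sup_le ?_ (hI.trans (Ideal.span_mono fun q hq => ⟨Ideal.mem_sup_right hq.1, hq.2⟩))
  rw [Ideal.span_singleton_le_iff_mem]
  exact Ideal.subset_span ⟨Ideal.mem_sup_left (Ideal.mem_span_singleton_self p), hp⟩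

theorem IsSupportedIdeal.rowIdeal {n : ℕ} {l : List (KoszulRow σ n)}
    (hl : ∀ r ∈ l, r.b ∈ supported ℚ s) : IsSupportedIdeal (rowIdeal l) s := by
  induction l with
  | nil => exact isSupportedIdeal_bot
  | cons r l ih =>
    exact (ih fun r' hr' => hl r' (List.mem_cons_of_mem _ hr')).span_sup
      (hl r List.mem_cons_self)

theorem eq_of_mem_supported {B : Type} [CommRing B] [Algebra ℚ B]
    (φ φ' : MvPolynomial σ ℚ →ₐ[ℚ] B) (h : ∀ i ∈ s, φ (X i) = φ' (X i)) {p : MvPolynomial σ ℚ}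
    (hp : p ∈ supported ℚ s) : φ p = φ' p := by
  have : supported ℚ s ≤ AlgHom.equalizer φ φ' := by
    rw [supported_eq_adjoin_X, Algebra.adjoin_le_iff]
    rintro _ ⟨i, hi, rfl⟩
    exact h i hi
  exact this hp

/-- Version of `isRegularMod_of_monic` for a substitution of the variables. -/
theorem IsSupportedIdeal.isRegularMod_of_monic (hI : IsSupportedIdeal I s)
    (φ : σ → Polynomial (MvPolynomial σ ℚ)) (t : MvPolynomial σ ℚ)
    (hφ : ∀ i, (φ i).eval t = X i) (hs : ∀ i ∈ s, φ i = Polynomial.C (X i))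
    {a : MvPolynomial σ ℚ} (ha : (aeval φ a).Monic) : IsRegularMod I a := by
  refine KhovanovRozansky.isRegularMod_of_monic (aeval φ : _ →ₐ[ℚ] _).toRingHom t (fun x => ?_)
    (hI.trans ?_) ha
  · change (Polynomial.evalRingHom t).comp (aeval φ : _ →ₐ[ℚ] _).toRingHom x = RingHom.id _ x
    congr 1
    refine MvPolynomial.ringHom_ext (fun c => ?_) fun i => ?_
    · simp [Polynomial.algebraMap_apply, algebraMap_eq]
    · simpa using hφ i
  · rw [Ideal.span_le]
    rintro p ⟨hpI, hps⟩
    have : aeval φ p = (Polynomial.CAlgHom (R := ℚ) (A := MvPolynomial σ ℚ)) p :=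
      eq_of_mem_supported _ _ (fun i hi => (aeval_X φ i).trans (hs i hi)) hps
    change aeval φ p ∈ I.map Polynomial.C
    rw [this]
    exact Ideal.mem_map_of_mem _ hpI

/-- Version of `IsRegularMod.of_retraction` for the elimination of a variable. -/
theorem IsSupportedIdeal.isRegularMod_of_elimination [DecidableEq σ] (hI : IsSupportedIdeal I s)
    {v : σ} (hv : v ∉ s) {q a : MvPolynomial σ ℚ} (hq : q ∈ supported ℚ {v}ᶜ)
    (h : IsRegularMod I (aeval (Function.update X v q) a)) :
    IsRegularMod (Ideal.span {X v - q} ⊔ I) a := by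
  have hfix : ∀ {p : MvPolynomial σ ℚ} {s : Set σ}, v ∉ s → p ∈ supported ℚ s →
      aeval (Function.update X v q) p = p := fun {p s} hv hp =>
    eq_of_mem_supported (aeval (Function.update X v q)) (AlgHom.id ℚ _) (fun i hi => by
      have : i ≠ v := fun h => hv (h ▸ hi)
      simp [this]) hp
  refine IsRegularMod.of_retraction (aeval (Function.update X v q) : _ →ₐ[ℚ] _).toRingHom
    (hI.trans ?_) ?_ (fun x => ?_) h
  · rw [Ideal.span_le]
    rintro p ⟨hpI, hps⟩
    change aeval _ p ∈ I
    rwa [hfix hv hps]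
  · change aeval _ (X v - q) = 0
    rw [map_sub, hfix (by simp) hq, aeval_X, Function.update_self, sub_self]
  · rw [← Ideal.Quotient.eq]
    change (Ideal.Quotient.mkₐ ℚ _) x = ((Ideal.Quotient.mkₐ ℚ (Ideal.span {X v - q})).comp
      (aeval (Function.update X v q))) x
    congr 1
    refine MvPolynomial.algHom_ext fun i => ?_
    by_cases hi : i = v
    · subst hi
      simp only [Ideal.Quotient.mkₐ_eq_mk, AlgHom.comp_apply, aeval_X, Function.update_self]
      exact Ideal.Quotient.eq.2 (Ideal.mem_span_singleton_self _)
    · simp [hi]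

theorem monic_quadratic {A : Type} [CommRing A] (a b : A) :
    (Polynomial.X ^ 2 + Polynomial.C a * Polynomial.X + Polynomial.C b).Monic := by
  nontriviality A
  monicity!

/-- The sequence `x_u x_v - e, x_u + x_v - d` is regular if `d`, `e` and the ideal do not involve
`x_u` and `x_v`. -/
theorem IsSupportedIdeal.isRegularMod_pair [DecidableEq σ] {u v : σ} (huv : u ≠ v)
    (hI : IsSupportedIdeal I {u, v}ᶜ) {d e : MvPolynomial σ ℚ} (hd : d ∈ supported ℚ {u, v}ᶜ)
    (he : e ∈ supported ℚ {u, v}ᶜ) :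
    IsRegularMod I (X u * X v - e) ∧
      IsRegularMod (Ideal.span {X u * X v - e} ⊔ I) (X u + X v - d) := by
  have haev : ∀ (φ : σ → Polynomial (MvPolynomial σ ℚ)),
      (∀ i ∈ ({u, v}ᶜ : Set σ), φ i = Polynomial.C (X i)) →
      ∀ {p}, p ∈ supported ℚ ({u, v}ᶜ : Set σ) → aeval φ p = Polynomial.C p := fun φ hφ p hp =>
    eq_of_mem_supported (aeval φ) (Polynomial.CAlgHom (R := ℚ))
      (fun i hi => (aeval_X φ i).trans (hφ i hi)) hp
  have hne : ∀ i ∈ ({u, v}ᶜ : Set σ), i ≠ u ∧ i ≠ v := fun i hi => by simpa using hi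
  have hsub : ∀ {p : MvPolynomial σ ℚ} {i : σ}, i ∈ ({u, v} : Set σ) →
      p ∈ supported ℚ ({u, v}ᶜ : Set σ) → p ∈ supported ℚ ({i}ᶜ : Set σ) := fun hi hp =>
    supported_mono (Set.compl_subset_compl.2 (Set.singleton_subset_iff.2 hi)) hp
  have h₁ : IsRegularMod I (X u * X v - e) := by
    -- The substitution `x_u = T`, `x_v = T + (x_v - x_u)` makes the product monic of degree `2` in
    -- `T`, and `T = x_u` undoes it.
    let φ : σ → Polynomial (MvPolynomial σ ℚ) := fun i => if i = u then Polynomial.X else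
      if i = v then Polynomial.X + Polynomial.C (X v - X u) else Polynomial.C (X i)
    have hφ : ∀ i ∈ ({u, v}ᶜ : Set σ), φ i = Polynomial.C (X i) := fun i hi => by
      simp [φ, hne i hi]
    refine hI.isRegularMod_of_monic φ (X u) (fun i => ?_) hφ ?_
    · by_cases hu : i = u
      · simp [φ, hu]
      · by_cases hv : i = v
        · simp [φ, hv, huv.symm]
        · simp [φ, hu, hv]
    · rw [map_sub, map_mul, aeval_X, aeval_X, haev φ hφ he]
      have : φ u * φ v - Polynomial.C e = Polynomial.X ^ 2 +
          Polynomial.C (X v - X u) * Polynomial.X + Polynomial.C (-e) := by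
        simp only [φ, huv.symm, if_true, if_false, map_sub, map_neg]
        ring
      rw [this]
      exact monic_quadratic _ _
  -- The linear element is monic in `x_v`. Eliminating `x_v` by it turns the quadratic element into
  -- minus a monic quadratic in `x_u`. Exchanging the two gives the required order.
  refine ⟨h₁, IsRegularMod.swap ?_ ?_⟩
  · let φ : σ → Polynomial (MvPolynomial σ ℚ) := fun i =>
      if i = v then Polynomial.X else Polynomial.C (X i)
    have hφ : ∀ i ∈ ({u, v}ᶜ : Set σ), φ i = Polynomial.C (X i) := fun i hi => by
      simp [φ, hne i hi]
    refine hI.isRegularMod_of_monic φ (X v) (fun i => ?_) hφ ?_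
    · by_cases hv : i = v <;> simp [φ, hv]
    · rw [map_sub, map_add, aeval_X, aeval_X, haev φ hφ hd]
      have : φ u + φ v - Polynomial.C d = Polynomial.X + Polynomial.C (X u - d) := by
        simp only [φ, huv, if_true, if_false, map_sub]
        ring
      rw [this]
      exact Polynomial.monic_X_add_C _
  · rw [show X u + X v - d = X v - (d - X u) by ring]
    have hq : d - X u ∈ supported ℚ ({v}ᶜ : Set σ) :=
      sub_mem (hsub (by simp) hd) (X_mem_supported.2 (by simpa using huv))
    refine hI.isRegularMod_of_elimination (by simp) hq (IsRegularMod.neg ?_)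
    have he' : aeval (Function.update X v (d - X u)) e = e :=
      eq_of_mem_supported (aeval _) (AlgHom.id ℚ _) (fun i hi => by simp [(hne i hi).2]) he
    rw [map_sub, map_mul, aeval_X, aeval_X, he', Function.update_self,
      Function.update_of_ne huv]
    let φ : σ → Polynomial (MvPolynomial σ ℚ) := fun i =>
      if i = u then Polynomial.X else Polynomial.C (X i)
    have hφ : ∀ i ∈ ({u, v}ᶜ : Set σ), φ i = Polynomial.C (X i) := fun i hi => by
      simp [φ, hne i hi]
    refine hI.isRegularMod_of_monic φ (X u) (fun i => ?_) hφ ?_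
    · by_cases hu : i = u <;> simp [φ, hu]
    · rw [map_neg, map_sub, map_mul, map_sub, aeval_X, haev φ hφ hd, haev φ hφ he]
      have : -(φ u * (Polynomial.C d - φ u) - Polynomial.C e) =
          Polynomial.X ^ 2 + Polynomial.C (-d) * Polynomial.X + Polynomial.C e := by
        simp only [φ, if_true, map_neg]
        ring
      rw [this]
      exact monic_quadratic _ _

end Variables

/-! ## Regularity of the rows of graphs and of `Υ` -/

/-- The outgoing variables are free with respect to the incoming ones and to all rows already
present, so `IsSupportedIdeal.isRegularMod_pair` applies. -/
theorem IsRegularRows.wideEdge {σ : Type} [DecidableEq σ] {n : ℕ} {l : List (KoszulRow σ n)}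
    (h : IsRegularRows l) (t : WideEdge σ) (ht : t.out₁ ≠ t.out₂)
    (h₁ : t.in₁ ∈ ({t.out₁, t.out₂}ᶜ : Set σ)) (h₂ : t.in₂ ∈ ({t.out₁, t.out₂}ᶜ : Set σ))
    (hl : ∀ r ∈ l, r.b ∈ supported ℚ ({t.out₁, t.out₂}ᶜ : Set σ)) :
    IsRegularRows (t.row₁ n :: t.row₂ n :: l) := by
  obtain ⟨h₃, h₄⟩ := (IsSupportedIdeal.rowIdeal hl).isRegularMod_pair ht
    (add_mem (X_mem_supported.2 h₁) (X_mem_supported.2 h₂))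
    (mul_mem (X_mem_supported.2 h₁) (X_mem_supported.2 h₂))
  exact ⟨h₄, h₃, h⟩

theorem isRegularRows_nil {σ : Type} {n : ℕ} : IsRegularRows ([] : List (KoszulRow σ n)) :=
  trivial

theorem isRegularRows_arc {σ : Type} (n : ℕ) (t : Arc σ) (ht : t.head ≠ t.tail) :
    IsRegularRows [t.row n] :=
  ⟨isRegularMod_bot fun h => ht (X_injective (sub_eq_zero.1 h)), trivial⟩

theorem WideEdge.row₁_b_mem {σ : Type} {s : Set σ} (n : ℕ) (t : WideEdge σ)
    (h : t.out₁ ∈ s ∧ t.out₂ ∈ s ∧ t.in₁ ∈ s ∧ t.in₂ ∈ s) : (t.row₁ n).b ∈ supported ℚ s :=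
  sub_mem (add_mem (X_mem_supported.2 h.1) (X_mem_supported.2 h.2.1))
    (add_mem (X_mem_supported.2 h.2.2.1) (X_mem_supported.2 h.2.2.2))

theorem WideEdge.row₂_b_mem {σ : Type} {s : Set σ} (n : ℕ) (t : WideEdge σ)
    (h : t.out₁ ∈ s ∧ t.out₂ ∈ s ∧ t.in₁ ∈ s ∧ t.in₂ ∈ s) : (t.row₂ n).b ∈ supported ℚ s :=
  sub_mem (mul_mem (X_mem_supported.2 h.1) (X_mem_supported.2 h.2.1))
    (mul_mem (X_mem_supported.2 h.2.2.1) (X_mem_supported.2 h.2.2.2))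

/-- The edges are listed from outgoing to incoming, so the two outgoing marks of each edge are
absent from its incoming marks and from all edges after it. -/
theorem isRegularRows_graph₁ (n : ℕ) : IsRegularRows (graph₁.rows n) := by
  refine IsRegularRows.wideEdge (.wideEdge (.wideEdge isRegularRows_nil _ ?_ ?_ ?_ ?_) _ ?_ ?_ ?_ ?_) _
    ?_ ?_ ?_ ?_
  all_goals simp [WideEdge.row₁_b_mem, WideEdge.row₂_b_mem]

theorem isRegularRows_graph₃ (n : ℕ) : IsRegularRows (graph₃.rows n) := by
  refine IsRegularRows.wideEdge (.wideEdge (.wideEdge isRegularRows_nil _ ?_ ?_ ?_ ?_) _ ?_ ?_ ?_ ?_) _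
    ?_ ?_ ?_ ?_
  all_goals simp [WideEdge.row₁_b_mem, WideEdge.row₂_b_mem]

theorem isRegularRows_graph₂ (n : ℕ) : IsRegularRows (graph₂.rows n) := by
  refine IsRegularRows.wideEdge (isRegularRows_arc n _ ?_) _ ?_ ?_ ?_ ?_
  all_goals simp [Arc.row, sub_mem, X_mem_supported]

theorem isRegularRows_graph₄ (n : ℕ) : IsRegularRows (graph₄.rows n) := by
  refine IsRegularRows.wideEdge (isRegularRows_arc n _ ?_) _ ?_ ?_ ?_ ?_
  all_goals simp [Arc.row, sub_mem, X_mem_supported]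

/-- The polynomial is linear in `x₃`, with coefficient `x₁x₂` coprime to the constant term
`-x₄x₅x₆`. It is therefore irreducible, hence prime. -/
theorem prime_s₃_sub_s₆ : Prime (s₃ - s₆) := by
  have hX : ∀ i : Fin 6, Prime (X i : MvPolynomial (Fin 6) ℚ) := fun i => X_prime
  have hrel : ∀ i j : Fin 6, i ≠ j → IsRelPrime (X i : MvPolynomial (Fin 6) ℚ) (X j) :=
    fun i j hij => ((hX i).irreducible.isRelPrime_iff_not_dvd).2 fun h => hij (X_dvd_X.1 h)
  have hvars : ∀ {p : MvPolynomial (Fin 6) ℚ}, p ∈ supported ℚ ({2}ᶜ : Set (Fin 6)) → 2 ∉ p.vars :=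
    fun hp h => mem_supported.1 hp h rfl
  have h : Irreducible (X 0 * X 1 * X 2 + (-s₆) : MvPolynomial (Fin 6) ℚ) := by
    refine irreducible_mul_X_add _ _ 2 (mul_ne_zero (X_ne_zero _) (X_ne_zero _)) ?_ ?_ ?_
    · exact hvars (mul_mem (X_mem_supported.2 (by simp)) (X_mem_supported.2 (by simp)))
    · exact hvars (neg_mem (mul_mem (mul_mem (X_mem_supported.2 (by simp))
        (X_mem_supported.2 (by simp))) (X_mem_supported.2 (by simp))))
    · rw [IsRelPrime.neg_right_iff, s₆]
      refine IsRelPrime.mul_left (.mul_right (.mul_right ?_ ?_) ?_)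
        (.mul_right (.mul_right ?_ ?_) ?_) <;> exact hrel _ _ (by decide)
  rw [← sub_eq_add_neg] at h
  exact h.prime

/-- The elimination of `x₃` by `s₁ = s₄`. -/
def eliminate : MvPolynomial (Fin 6) ℚ →ₐ[ℚ] MvPolynomial (Fin 6) ℚ :=
  aeval (Function.update X 2 (s₄ - X 0 - X 1))

/-- Regularity is easiest in the order `α₁, α₂, α₃`: after eliminating `x₃`, `-α₂` becomes a monic
quadratic in `x₂`, and modulo it `α₃` becomes `(x₁ - x₄)(x₁ - x₅)(x₁ - x₆)`, which does not involve
`x₂`. The list of rows asks for the opposite order, which is reached by exchanging neighbours; the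
exchanges need `α₂` regular modulo `α₃` separately, and primality of `α₃` supplies it. -/
theorem isRegularRows_upsilonRows (n : ℕ) : IsRegularRows (upsilonRows n) := by
  have heval : ∀ (c : Fin 6 → ℚ) {p : MvPolynomial (Fin 6) ℚ}, aeval c p ≠ 0 → p ≠ 0 :=
    fun c p h hp => h (by rw [hp, map_zero])
  have hα₁ : s₁ - s₄ ≠ 0 := heval ![1, 0, 0, 0, 0, 0] (by simp [s₁, s₄])
  have elim : ∀ {I : Ideal (MvPolynomial (Fin 6) ℚ)} {s : Set (Fin 6)} {a},
      IsSupportedIdeal I s → 2 ∉ s → IsRegularMod I (eliminate a) →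
      IsRegularMod (Ideal.span {s₁ - s₄} ⊔ I) a := fun {I s a} hI hs h => by
    rw [show s₁ - s₄ = X 2 - (s₄ - X 0 - X 1) by rw [s₁]; ring]
    refine hI.isRegularMod_of_elimination hs ?_ h
    refine sub_mem (sub_mem (add_mem (add_mem ?_ ?_) ?_) ?_) ?_ <;>
      exact X_mem_supported.2 (by simp)
  have h₁ : eliminate (s₂ - s₅) = -(X 1 ^ 2 + (X 0 - s₄) * X 1 + (X 0 ^ 2 - s₄ * X 0 + s₅)) := by
    simp [eliminate, s₂, s₄, s₅]
    ring
  have h₂ : eliminate (s₃ - s₆) = X 0 ^ 3 - s₄ * X 0 ^ 2 + s₅ * X 0 - s₆ +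
      X 0 * eliminate (s₂ - s₅) := by
    simp [eliminate, s₂, s₃, s₄, s₅, s₆]
    ring
  have hs : s₄ ∈ supported ℚ ({1}ᶜ : Set (Fin 6)) ∧ s₅ ∈ supported ℚ ({1}ᶜ : Set (Fin 6)) ∧
      s₆ ∈ supported ℚ ({1}ᶜ : Set (Fin 6)) := by
    have hX : ∀ i : Fin 6, i ≠ 1 → X i ∈ supported ℚ ({1}ᶜ : Set (Fin 6)) := fun i hi =>
      X_mem_supported.2 hi
    refine ⟨add_mem (add_mem ?_ ?_) ?_, add_mem (add_mem (mul_mem ?_ ?_) (mul_mem ?_ ?_))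
      (mul_mem ?_ ?_), mul_mem (mul_mem ?_ ?_) ?_⟩ <;> exact hX _ (by decide)
  have hX0 : X 0 ∈ supported ℚ ({1}ᶜ : Set (Fin 6)) := X_mem_supported.2 (by simp)
  -- The polynomial with roots `x₄, x₅, x₆`, evaluated at `x₁`.
  set m : MvPolynomial (Fin 6) ℚ := X 0 ^ 3 - s₄ * X 0 ^ 2 + s₅ * X 0 - s₆ with hm
  have hm' : m ∈ supported ℚ ({1}ᶜ : Set (Fin 6)) :=
    sub_mem (add_mem (sub_mem (pow_mem hX0 3) (mul_mem hs.1 (pow_mem hX0 2)))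
      (mul_mem hs.2.1 hX0)) hs.2.2
  have hm0 : m ≠ 0 := heval ![1, 0, 0, 0, 0, 0] (by simp [m, s₄, s₅, s₆])
  have hβ0 : eliminate (s₂ - s₅) ≠ 0 := by
    rw [h₁]
    exact heval ![1, 0, 0, 0, 0, 0] (by simp [s₄, s₅])
  have hα₃0 : eliminate (s₃ - s₆) ≠ 0 := by
    rw [h₂, h₁, hm]
    exact heval ![1, 1, 0, 0, 0, 1] (by simp [s₄, s₅, s₆])
  have hβm : IsRegularMod (Ideal.span {m} ⊔ ⊥) (eliminate (s₂ - s₅)) := by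
    rw [h₁]
    refine IsRegularMod.neg ?_
    rw [neg_neg]
    let φ : Fin 6 → Polynomial (MvPolynomial (Fin 6) ℚ) := fun i =>
      if i = 1 then Polynomial.X else Polynomial.C (X i)
    have hφ : ∀ i ∈ ({1}ᶜ : Set (Fin 6)), φ i = Polynomial.C (X i) := fun i hi => if_neg hi
    have haev : ∀ {p}, p ∈ supported ℚ ({1}ᶜ : Set (Fin 6)) → aeval φ p = Polynomial.C p :=
      fun hp => eq_of_mem_supported (aeval φ) (Polynomial.CAlgHom (R := ℚ))
        (fun i hi => (aeval_X φ i).trans (hφ i hi)) hp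
    refine (isSupportedIdeal_bot.span_sup hm').isRegularMod_of_monic φ (X 1) (fun i => ?_) hφ ?_
    · by_cases hi : i = 1 <;> simp [φ, hi]
    · rw [map_add, map_add, map_mul, map_pow, haev (sub_mem hX0 hs.1),
        haev (add_mem (sub_mem (pow_mem hX0 2) (mul_mem hs.1 hX0)) hs.2.1), aeval_X]
      exact monic_quadratic _ _
  have hmβ : IsRegularMod (Ideal.span {eliminate (s₂ - s₅)} ⊔ ⊥) m :=
    (isRegularMod_bot hm0).swap hβm
  have hβ' : eliminate (s₂ - s₅) ∈ supported ℚ ({2}ᶜ : Set (Fin 6)) := by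
    have hX : ∀ i : Fin 6, i ≠ 2 → X i ∈ supported ℚ ({2}ᶜ : Set (Fin 6)) := fun i hi =>
      X_mem_supported.2 hi
    have hs₄ : s₄ ∈ supported ℚ ({2}ᶜ : Set (Fin 6)) := by
      refine add_mem (add_mem ?_ ?_) ?_ <;> exact hX _ (by decide)
    rw [h₁]
    refine neg_mem (add_mem (add_mem (pow_mem ?_ 2) (mul_mem (sub_mem ?_ hs₄) ?_))
      (add_mem (sub_mem (pow_mem ?_ 2) (mul_mem hs₄ ?_)) (add_mem (add_mem (mul_mem ?_ ?_)
        (mul_mem ?_ ?_)) (mul_mem ?_ ?_)))) <;> exact hX _ (by decide)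
  have hα₂_sub : s₂ - s₅ - eliminate (s₂ - s₅) = (X 0 + X 1) * (s₁ - s₄) := by
    rw [h₁, s₁, s₂, s₄, s₅]
    ring
  -- Modulo `α₁`, `α₂` may be replaced by its eliminated form, which is free of `x₃`, so elimination
  -- by `α₁` applies.
  have hideal : Ideal.span {s₂ - s₅} ⊔ (Ideal.span {s₁ - s₄} ⊔ ⊥) =
      Ideal.span {s₁ - s₄} ⊔ (Ideal.span {eliminate (s₂ - s₅)} ⊔ ⊥) := by
    have h₃ : s₁ - s₄ ∈ Ideal.span {s₁ - s₄} := Ideal.mem_span_singleton_self _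
    have h₄ := Ideal.mul_mem_left _ (X 0 + X 1) h₃
    rw [← hα₂_sub] at h₄
    rw [sup_bot_eq, sup_bot_eq]
    refine le_antisymm (sup_le ?_ le_sup_left) (sup_le le_sup_right ?_)
    · have := add_mem (Ideal.mem_sup_left h₄)
        (Ideal.mem_sup_right (Ideal.mem_span_singleton_self (eliminate (s₂ - s₅))))
      rwa [sub_add_cancel, ← Ideal.span_singleton_le_iff_mem] at this
    · have := sub_mem (Ideal.mem_sup_left (Ideal.mem_span_singleton_self (s₂ - s₅)))
        (Ideal.mem_sup_right h₄)
      rwa [sub_sub_cancel, ← Ideal.span_singleton_le_iff_mem] at this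
  have h₃₁₂ : IsRegularMod (Ideal.span {s₂ - s₅} ⊔ (Ideal.span {s₁ - s₄} ⊔ ⊥)) (s₃ - s₆) := by
    rw [hideal]
    refine elim (isSupportedIdeal_bot.span_sup hβ') (by simp) (hmβ.congr ?_)
    rw [h₂, add_sub_cancel_left, sup_bot_eq]
    exact Ideal.mul_mem_left _ _ (Ideal.mem_span_singleton_self _)
  have h₂₁ : IsRegularMod (Ideal.span {s₁ - s₄} ⊔ ⊥) (s₂ - s₅) :=
    elim isSupportedIdeal_bot (Set.notMem_empty _) (isRegularMod_bot hβ0)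
  have h₃₁ : IsRegularMod (Ideal.span {s₁ - s₄} ⊔ ⊥) (s₃ - s₆) :=
    elim isSupportedIdeal_bot (Set.notMem_empty _) (isRegularMod_bot hα₃0)
  have h₁₃ : IsRegularMod (Ideal.span {s₃ - s₆} ⊔ ⊥) (s₁ - s₄) :=
    (isRegularMod_bot hα₁).swap h₃₁
  have h₂₁₃ : IsRegularMod (Ideal.span {s₁ - s₄} ⊔ (Ideal.span {s₃ - s₆} ⊔ ⊥)) (s₂ - s₅) := by
    rw [sup_left_comm]
    exact h₂₁.swap h₃₁₂
  have h₂₃ : IsRegularMod (Ideal.span {s₃ - s₆} ⊔ ⊥) (s₂ - s₅) := by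
    intro g hg
    rw [sup_bot_eq, Ideal.mem_span_singleton] at hg ⊢
    refine (prime_s₃_sub_s₆.dvd_or_dvd hg).resolve_left fun ⟨c, hc⟩ => ?_
    -- At this point `α₃` vanishes and `α₂` equals `1`, so `α₃` cannot divide `α₂`.
    have := congrArg (aeval (![1, 1, 0, 0, 0, 0] : Fin 6 → ℚ)) hc
    simp [s₂, s₃, s₅, s₆] at this
  exact ⟨h₁₃.swap h₂₁₃, h₂₃, isRegularMod_bot prime_s₃_sub_s₆.ne_zero, trivial⟩

/-! ## Decomposition of the module of a triple of wide edges -/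

/-- The polynomial ring in the boundary variables inside the ring of all variables. -/
abbrev boundaryIncl (I : Type) : MvPolynomial (Fin 6) ℚ →ₐ[ℚ] MvPolynomial (I ⊕ Fin 6) ℚ :=
  rename Sum.inr

section Triple

variable (x₁ x₂ x₃ x₄ x₅ x₆ : MvPolynomial (Fin 6) ℚ) (i₇ i₈ i₉ : Fin 3)

local notation "ι" => boundaryIncl (Fin 3)

/-- The ideal generated by the rows of the wide edges from `x₇, x₈` to `x₁, x₂`, from `x₉, x₆` to
`x₈, x₃` and from `x₄, x₅` to `x₇, x₉`. -/
def tripleIdeal : Ideal (MvPolynomial (Fin 3 ⊕ Fin 6) ℚ) :=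
  Ideal.span {ι x₁ + ι x₂ - (X (im i₇) + X (im i₈))} ⊔
    (Ideal.span {ι x₁ * ι x₂ - X (im i₇) * X (im i₈)} ⊔
      (Ideal.span {X (im i₈) + ι x₃ - (X (im i₉) + ι x₆)} ⊔
        (Ideal.span {X (im i₈) * ι x₃ - X (im i₉) * ι x₆} ⊔
          (Ideal.span {X (im i₇) + X (im i₉) - (ι x₄ + ι x₅)} ⊔
            (Ideal.span {X (im i₇) * X (im i₉) - ι x₄ * ι x₅} ⊔ ⊥)))))

variable {x₁ x₂ x₃ x₄ x₅ x₆ i₇ i₈ i₉}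

theorem mem_tripleIdeal {p : MvPolynomial (Fin 3 ⊕ Fin 6) ℚ} :
    p ∈ tripleIdeal x₁ x₂ x₃ x₄ x₅ x₆ i₇ i₈ i₉ ↔ ∃ k₁ k₂ k₃ k₄ k₅ k₆,
      p = k₁ * (ι x₁ + ι x₂ - (X (im i₇) + X (im i₈))) +
        k₂ * (ι x₁ * ι x₂ - X (im i₇) * X (im i₈)) +
        k₃ * (X (im i₈) + ι x₃ - (X (im i₉) + ι x₆)) +
        k₄ * (X (im i₈) * ι x₃ - X (im i₉) * ι x₆) +
        k₅ * (X (im i₇) + X (im i₉) - (ι x₄ + ι x₅)) +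
        k₆ * (X (im i₇) * X (im i₉) - ι x₄ * ι x₅) := by
  simp only [tripleIdeal, Ideal.mem_span_singleton_sup, Ideal.mem_bot]
  constructor
  · rintro ⟨k₁, _, ⟨k₂, _, ⟨k₃, _, ⟨k₄, _, ⟨k₅, _, ⟨k₆, _, rfl, rfl⟩, rfl⟩, rfl⟩, rfl⟩, rfl⟩, rfl⟩
    exact ⟨k₁, k₂, k₃, k₄, k₅, k₆, by ring⟩
  · rintro ⟨k₁, k₂, k₃, k₄, k₅, k₆, rfl⟩
    exact ⟨k₁, _, ⟨k₂, _, ⟨k₃, _, ⟨k₄, _, ⟨k₅, _, ⟨k₆, _, rfl, rfl⟩, rfl⟩, rfl⟩, rfl⟩, rfl⟩, by ring⟩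

/-- Modulo the rows of the first and the linear row of the last wide edge every polynomial is a
combination of `1` and `x₆ - x₈`. -/
theorem exists_normalForm (hi : ∀ i, i = i₇ ∨ i = i₈ ∨ i = i₉)
    {J : Ideal (MvPolynomial (Fin 3 ⊕ Fin 6) ℚ)}
    (h₁ : ι x₁ + ι x₂ - (X (im i₇) + X (im i₈)) ∈ J)
    (h₂ : ι x₁ * ι x₂ - X (im i₇) * X (im i₈) ∈ J)
    (h₅ : X (im i₇) + X (im i₉) - (ι x₄ + ι x₅) ∈ J) (g : MvPolynomial (Fin 3 ⊕ Fin 6) ℚ) :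
    ∃ a b, g - (ι a + (ι x₆ - X (im i₈)) * ι b) ∈ J := by
  have hadd : ∀ {g g'}, (∃ a b, g - (ι a + (ι x₆ - X (im i₈)) * ι b) ∈ J) →
      (∃ a b, g' - (ι a + (ι x₆ - X (im i₈)) * ι b) ∈ J) →
      ∃ a b, g + g' - (ι a + (ι x₆ - X (im i₈)) * ι b) ∈ J := by
    rintro g g' ⟨a, b, h⟩ ⟨a', b', h'⟩
    refine ⟨a + a', b + b', ?_⟩
    convert add_mem h h' using 1
    simp only [map_add]
    ring
  have hmem : ∀ {g}, g ∈ J → ∃ a b, g - (ι a + (ι x₆ - X (im i₈)) * ι b) ∈ J := fun h =>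
    ⟨0, 0, by simpa using h⟩
  have hmul : ∀ {g} (p), (∃ a b, g - (ι a + (ι x₆ - X (im i₈)) * ι b) ∈ J) →
      ∃ a b, g * ι p - (ι a + (ι x₆ - X (im i₈)) * ι b) ∈ J := by
    rintro g p ⟨a, b, h⟩
    refine ⟨a * p, b * p, ?_⟩
    convert J.mul_mem_right (ι p) h using 1
    simp only [map_mul]
    ring
  have hX₈ : ∀ {g}, (∃ a b, g - (ι a + (ι x₆ - X (im i₈)) * ι b) ∈ J) →
      ∃ a b, g * X (im i₈) - (ι a + (ι x₆ - X (im i₈)) * ι b) ∈ J := by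
    rintro g ⟨a, b, h⟩
    -- With `y = x₆ - x₈`, the relation `(x₈ - x₁)(x₈ - x₂) = 0` reads `y² = (2x₆ - x₁ - x₂) y - (x₆
    -- - x₁)(x₆ - x₂)`; the witnesses are the coefficients of `(a + y b)(x₆ - y)` reduced by it.
    refine ⟨x₆ * a + (x₆ - x₁) * (x₆ - x₂) * b, x₆ * b - a - (2 * x₆ - x₁ - x₂) * b, ?_⟩
    convert sub_mem (add_mem (J.mul_mem_right (X (im i₈)) h)
      (J.mul_mem_left (X (im i₈) * ι b) h₁)) (J.mul_mem_left (ι b) h₂) using 1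
    simp only [map_mul, map_add, map_sub, map_ofNat]
    ring
  have hX₇ : ∀ {g}, (∃ a b, g - (ι a + (ι x₆ - X (im i₈)) * ι b) ∈ J) →
      ∃ a b, g * X (im i₇) - (ι a + (ι x₆ - X (im i₈)) * ι b) ∈ J := by
    intro g h
    have := hadd (hadd (hmul (x₁ + x₂) h) (hmul (-1) (hX₈ h))) (hmem (J.mul_mem_left (-g) h₁))
    convert this using 6
    simp only [map_add, map_neg, map_one]
    ring
  induction g using MvPolynomial.induction_on with
  | C c => exact ⟨C c, 0, by simp⟩
  | add p q hp hq => exact hadd hp hq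
  | mul_X g v h =>
    rcases v with i | i
    · rcases hi i with rfl | rfl | rfl
      · exact hX₇ h
      · exact hX₈ h
      · have := hadd (hadd (hmul (x₄ + x₅) h) (hmul (-1) (hX₇ h))) (hmem (J.mul_mem_left g h₅))
        convert this using 6
        simp only [map_add, map_neg, map_one]
        ring
    · simpa using hmul (X i) h

/-- The two specializations `(x₇, x₈) = (x₁, x₂)` and `(x₂, x₁)`, with `x₉ = x₄ + x₅ - x₇`, kill
both rows of the first edge and the linear row of the last. They determine the coefficients of `1`
and `x₆ - x₈`, since `x₁ - x₂` is a nonzerodivisor. Comparing coefficients expresses `p` and `q` by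
generators of the two annihilators. -/
theorem mem_of_mem_tripleIdeal (hi : ∀ i, i = i₇ ∨ i = i₈ ∨ i = i₉) (h₇₈ : i₇ ≠ i₈) (h₇₉ : i₇ ≠ i₉)
    (h₈₉ : i₈ ≠ i₉) (hx : x₁ ≠ x₂) {p q : MvPolynomial (Fin 6) ℚ}
    (h : ι p + (ι x₆ - X (im i₈)) * ι q ∈ tripleIdeal x₁ x₂ x₃ x₄ x₅ x₆ i₇ i₈ i₉)
    {I J : Ideal (MvPolynomial (Fin 6) ℚ)}
    (hI₁ : x₁ + x₂ + x₃ - (x₄ + x₅ + x₆) ∈ I)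
    (hI₂ : x₁ * x₂ + x₁ * x₃ + x₂ * x₃ - (x₄ * x₅ + x₄ * x₆ + x₅ * x₆) ∈ I)
    (hI₃ : x₁ * x₂ * x₃ - x₄ * x₅ * x₆ ∈ I)
    (hJ₁ : x₁ + x₂ + x₃ - (x₄ + x₅ + x₆) ∈ J)
    (hJ₂ : x₁ * x₂ + x₁ * x₃ + x₂ * x₃ - (x₄ * x₅ + x₄ * x₆ + x₅ * x₆) ∈ J)
    (hJ₃ : x₃ - x₆ ∈ J) : p ∈ I ∧ q ∈ J := by
  obtain ⟨k₁, k₂, k₃, k₄, k₅, k₆, h⟩ := mem_tripleIdeal.1 h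
  let ev : MvPolynomial (Fin 6) ℚ → MvPolynomial (Fin 6) ℚ →
      MvPolynomial (Fin 3 ⊕ Fin 6) ℚ →ₐ[ℚ] MvPolynomial (Fin 6) ℚ := fun y z =>
    aeval (Sum.elim (fun i => if i = i₇ then y else if i = i₈ then z else x₄ + x₅ - y) X)
  have ev_incl : ∀ y z p, ev y z (ι p) = p := fun y z p => by
    change aeval _ (rename _ p) = p
    rw [aeval_rename, Sum.elim_comp_inr, aeval_X_left_apply]
  have ev₇ : ∀ y z, ev y z (X (im i₇)) = y := fun y z => by simp [ev]
  have ev₈ : ∀ y z, ev y z (X (im i₈)) = z := fun y z => by simp [ev, h₇₈.symm]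
  have ev₉ : ∀ y z, ev y z (X (im i₉)) = x₄ + x₅ - y := fun y z => by
    simp [ev, h₇₉.symm, h₈₉.symm]
  have nf : ∀ g, ∃ a b, ev x₁ x₂ g = a + (x₆ - x₂) * b ∧ ev x₂ x₁ g = a + (x₆ - x₁) * b := by
    intro g
    obtain ⟨a, b, h⟩ := exists_normalForm hi (x₁ := x₁) (x₂ := x₂) (x₄ := x₄) (x₅ := x₅)
      (x₆ := x₆) (i₇ := i₇) (i₈ := i₈) (i₉ := i₉)
      (J := RingHom.ker (ev x₁ x₂) ⊓ RingHom.ker (ev x₂ x₁))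
      (by simp [RingHom.mem_ker, ev_incl, ev₇, ev₈, add_comm])
      (by simp [RingHom.mem_ker, ev_incl, ev₇, ev₈, mul_comm])
      (by simp [RingHom.mem_ker, ev_incl, ev₇, ev₉]) g
    obtain ⟨h₁, h₂⟩ := h
    refine ⟨a, b, ?_, ?_⟩
    · simpa [RingHom.mem_ker, ev_incl, ev₈, sub_eq_zero] using h₁
    · simpa [RingHom.mem_ker, ev_incl, ev₈, sub_eq_zero] using h₂
  -- Under both specializations the fourth generator becomes `x₆α₁ - (x₃ - x₆)(x₆ - x₈)`, and the
  -- sixth becomes `α₂ - (x₇ + x₆)α₁ + (x₃ - x₆)(x₆ - x₈)`, where `x₇ = x₁ + x₂ - x₈`. The three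
  -- polynomials normalized here are the resulting coefficients of `α₁`, `α₂` and `(x₃ - x₆)(x₆ -
  -- x₈)`.
  obtain ⟨a, a', ha, ha'⟩ := nf (k₃ + ι x₆ * k₄ - (ι x₁ + ι x₂ + (ι x₆ - X (im i₈))) * k₆)
  obtain ⟨b, b', hb, hb'⟩ := nf k₆
  obtain ⟨d, d', hd, hd'⟩ := nf (k₆ - k₄)
  have e₁ := congrArg (ev x₁ x₂) h
  have e₂ := congrArg (ev x₂ x₁) h
  simp only [map_add, map_sub, map_mul, ev_incl, ev₇, ev₈, ev₉] at e₁ e₂ ha ha' hb hb' hd hd'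
  set P := p - ((x₁ + x₂ + x₃ - (x₄ + x₅ + x₆)) * a +
    (x₁ * x₂ + x₁ * x₃ + x₂ * x₃ - (x₄ * x₅ + x₄ * x₆ + x₅ * x₆)) * b -
    (x₃ - x₆) * (x₆ - x₁) * (x₆ - x₂) * d') with hP
  set Q := q - ((x₁ + x₂ + x₃ - (x₄ + x₅ + x₆)) * a' +
    (x₁ * x₂ + x₁ * x₃ + x₂ * x₃ - (x₄ * x₅ + x₄ * x₆ + x₅ * x₆)) * b' +
    (x₃ - x₆) * (d + (2 * x₆ - x₁ - x₂) * d')) with hQ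
  have f₁ : P + (x₆ - x₂) * Q = 0 := by
    rw [hP, hQ]
    linear_combination e₁ + (x₁ + x₂ + x₃ - (x₄ + x₅ + x₆)) * ha +
      (x₁ * x₂ + x₁ * x₃ + x₂ * x₃ - (x₄ * x₅ + x₄ * x₆ + x₅ * x₆)) * hb +
      (x₃ - x₆) * (x₆ - x₂) * hd
  have f₂ : P + (x₆ - x₁) * Q = 0 := by
    rw [hP, hQ]
    linear_combination e₂ + (x₁ + x₂ + x₃ - (x₄ + x₅ + x₆)) * ha' +
      (x₁ * x₂ + x₁ * x₃ + x₂ * x₃ - (x₄ * x₅ + x₄ * x₆ + x₅ * x₆)) * hb' +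
      (x₃ - x₆) * (x₆ - x₁) * hd'
  have hQ0 : Q = 0 := by
    have : (x₁ - x₂) * Q = 0 := by linear_combination f₁ - f₂
    exact (mul_eq_zero.1 this).resolve_left (sub_ne_zero.2 hx)
  have hP0 : P = 0 := by simpa [hQ0] using f₁
  constructor
  · rw [sub_eq_zero.1 (hP.symm.trans hP0)]
    -- Because `x₆` is a root of the cubic with roots `x₄, x₅, x₆`, one has `(x₃ - x₆)(x₆ - x₁)(x₆ -
    -- x₂) = x₆²α₁ - x₆α₂ + α₃`.
    have := add_mem (add_mem (I.mul_mem_left (a - x₆ ^ 2 * d') hI₁)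
      (I.mul_mem_left (b + x₆ * d') hI₂)) (I.mul_mem_left (-d') hI₃)
    convert this using 1
    ring
  · rw [sub_eq_zero.1 (hQ.symm.trans hQ0)]
    exact add_mem (add_mem (J.mul_mem_right _ hJ₁) (J.mul_mem_right _ hJ₂)) (J.mul_mem_right _ hJ₃)

/-- Sums and products of strands are preserved by each edge, which gives `α₁` and `α₂`; the middle
edge gives `(x₆ - x₈)(x₃ - x₆) = 0`. Together with `(x₈ - x₁)(x₈ - x₂) = 0` this yields `(x₃ -
x₆)(x₆ - x₁)(x₆ - x₂) = 0`, which is `α₃` modulo `α₁` and `α₂`. -/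
theorem incl_mem_tripleIdeal :
    ι (x₁ + x₂ + x₃ - (x₄ + x₅ + x₆)) ∈ tripleIdeal x₁ x₂ x₃ x₄ x₅ x₆ i₇ i₈ i₉ ∧
    ι (x₁ * x₂ + x₁ * x₃ + x₂ * x₃ - (x₄ * x₅ + x₄ * x₆ + x₅ * x₆)) ∈
      tripleIdeal x₁ x₂ x₃ x₄ x₅ x₆ i₇ i₈ i₉ ∧
    ι (x₁ * x₂ * x₃ - x₄ * x₅ * x₆) ∈ tripleIdeal x₁ x₂ x₃ x₄ x₅ x₆ i₇ i₈ i₉ ∧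
    (ι x₆ - X (im i₈)) * ι (x₃ - x₆) ∈ tripleIdeal x₁ x₂ x₃ x₄ x₅ x₆ i₇ i₈ i₉ := by
  simp only [map_add, map_sub, map_mul]
  have h₁ : ι x₁ + ι x₂ + ι x₃ - (ι x₄ + ι x₅ + ι x₆) ∈
      tripleIdeal x₁ x₂ x₃ x₄ x₅ x₆ i₇ i₈ i₉ :=
    mem_tripleIdeal.2 ⟨1, 0, 1, 0, 1, 0, by ring⟩
  have h₂ : ι x₁ * ι x₂ + ι x₁ * ι x₃ + ι x₂ * ι x₃ - (ι x₄ * ι x₅ + ι x₄ * ι x₆ + ι x₅ * ι x₆) ∈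
      tripleIdeal x₁ x₂ x₃ x₄ x₅ x₆ i₇ i₈ i₉ :=
    mem_tripleIdeal.2 ⟨ι x₃, 1, X (im i₇), 1, ι x₆, 1, by ring⟩
  have h₃ : (ι x₆ - X (im i₈)) * (ι x₃ - ι x₆) ∈ tripleIdeal x₁ x₂ x₃ x₄ x₅ x₆ i₇ i₈ i₉ :=
    mem_tripleIdeal.2 ⟨0, 0, ι x₆, -1, 0, 0, by ring⟩
  have h₄ : ι x₁ * ι x₂ - X (im i₇) * X (im i₈) -
      (ι x₁ + ι x₂ - (X (im i₇) + X (im i₈))) * X (im i₈) ∈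
      tripleIdeal x₁ x₂ x₃ x₄ x₅ x₆ i₇ i₈ i₉ :=
    mem_tripleIdeal.2 ⟨-X (im i₈), 1, 0, 0, 0, 0, by ring⟩
  refine ⟨h₁, h₂, ?_, h₃⟩
  have := add_mem (sub_mem (add_mem
    (Ideal.mul_mem_left _ (2 * ι x₆ - ι x₁ - ι x₂ - (ι x₆ - X (im i₈))) h₃)
    (Ideal.mul_mem_left _ (ι x₃ - ι x₆) h₄)) (Ideal.mul_mem_left _ (ι x₆ ^ 2) h₁))
    (Ideal.mul_mem_left _ (ι x₆) h₂)
  convert this using 1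
  ring

end Triple

/-! ## Finite-dimensionality of the cohomology -/

/-- The variables act as zero, so the polynomial ring acts through its constants and generators over
it already span over `ℚ`. -/
theorem finite_restrictScalars {σ : Type} (N : Type) [AddCommGroup N] [Module (MvPolynomial σ ℚ) N]
    [Module.Finite (MvPolynomial σ ℚ) N]
    (h : ∀ (i : σ) (x : N), (X i : MvPolynomial σ ℚ) • x = 0) :
    Module.Finite ℚ (RestrictScalars ℚ (MvPolynomial σ ℚ) N) := by
  classical
  obtain ⟨S, hS⟩ := (Module.Finite.fg_top : (⊤ : Submodule (MvPolynomial σ ℚ) N).FG)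
  let e := (RestrictScalars.addEquiv ℚ (MvPolynomial σ ℚ) N).symm
  have key : ∀ x ∈ Submodule.span (MvPolynomial σ ℚ) (S : Set N),
      e x ∈ Submodule.span ℚ (S.image e : Set (RestrictScalars ℚ (MvPolynomial σ ℚ) N)) := by
    intro x hx
    induction hx using Submodule.span_induction with
    | mem x hx => exact Submodule.subset_span (Finset.mem_image_of_mem e hx)
    | zero =>
      rw [map_zero]
      exact zero_mem _
    | add x y _ _ hx hy =>
      rw [map_add]
      exact add_mem hx hy
    | smul p x _ hx =>
      induction p using MvPolynomial.induction_on with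
      | C a =>
        rw [← algebraMap_eq, RestrictScalars.addEquiv_symm_map_algebraMap_smul]
        exact Submodule.smul_mem _ a hx
      | add p q hp hq =>
        rw [add_smul, map_add]
        exact add_mem hp hq
      | mul_X p i _ =>
        rw [mul_smul, h, smul_zero, map_zero]
        exact zero_mem _
  refine ⟨⟨S.image e, eq_top_iff.2 fun x _ => ?_⟩⟩
  have := key (e.symm x) (hS ▸ trivial)
  rwa [e.apply_symm_apply] at this

namespace GradedFactorization

variable {σ : Type} {n : ℕ} {w : MvPolynomial σ ℚ}

/-- A homotopy retract of something of finite rank has finite cohomology. Modulo the variables, each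
cycle is homologous to its image under `g f`, so the cohomology is a quotient of the kernel of the
reduction of `e`, which is finitely generated by noetherianity. The variables act on it as zero. -/
theorem finite_cohomology_of_homotopy [Finite σ] {M0 M1 N0 N1 : FreeGradedModule σ}
    (d : M0 →ₗ[MvPolynomial σ ℚ] M1) (d' : M1 →ₗ[MvPolynomial σ ℚ] M0)
    (e : N0 →ₗ[MvPolynomial σ ℚ] N1) (f : M0 →ₗ[MvPolynomial σ ℚ] N0)
    (f' : M1 →ₗ[MvPolynomial σ ℚ] N1) (g : N0 →ₗ[MvPolynomial σ ℚ] M0)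
    (g' : N1 →ₗ[MvPolynomial σ ℚ] M1) (h : M0 →ₗ[MvPolynomial σ ℚ] M1)
    (h' : M1 →ₗ[MvPolynomial σ ℚ] M0) (hf : ∀ x, f' (d x) = e (f x))
    (hg : ∀ x, g' (e x) = d (g x)) (hh : ∀ x, g (f x) - x = h' (d x) + d' (h x))
    [Module.Finite (MvPolynomial σ ℚ) N0] :
    Module.Finite ℚ (RestrictScalars ℚ (MvPolynomial σ ℚ) (LinearMap.ker (reduction d) ⧸
      (LinearMap.range (reduction d')).submoduleOf (LinearMap.ker (reduction d)))) := by
  have hred : ∀ x, reduction g' (reduction e x) = reduction d (reduction g x) := fun x => by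
    obtain ⟨x, rfl⟩ := Submodule.Quotient.mk_surjective _ x
    exact congrArg (Submodule.Quotient.mk) (hg x)
  have hred' : ∀ x, reduction f' (reduction d x) = reduction e (reduction f x) := fun x => by
    obtain ⟨x, rfl⟩ := Submodule.Quotient.mk_surjective _ x
    exact congrArg (Submodule.Quotient.mk) (hf x)
  have hred'' : ∀ x, reduction g (reduction f x) - x =
      reduction h' (reduction d x) + reduction d' (reduction h x) := fun x => by
    obtain ⟨x, rfl⟩ := Submodule.Quotient.mk_surjective _ x
    exact congrArg (Submodule.Quotient.mk) (hh x)
  let L : LinearMap.ker (reduction e) →ₗ[MvPolynomial σ ℚ] LinearMap.ker (reduction d) :=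
    (reduction g).restrict fun x hx => by
      rw [LinearMap.mem_ker] at hx ⊢
      rw [← hred, hx, map_zero]
  have hsurj : Function.Surjective (((LinearMap.range (reduction d')).submoduleOf
      (LinearMap.ker (reduction d))).mkQ ∘ₗ L) := by
    intro x
    obtain ⟨⟨x, hx⟩, rfl⟩ := Submodule.Quotient.mk_surjective _ x
    refine ⟨⟨reduction f x, ?_⟩, ?_⟩
    · rw [LinearMap.mem_ker] at hx ⊢
      rw [← hred', hx, map_zero]
    · refine (Submodule.Quotient.eq _).2 ⟨reduction h x, ?_⟩
      have := hred'' x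
      rw [LinearMap.mem_ker.1 hx, map_zero, zero_add] at this
      exact this.symm
  have : Module.Finite (MvPolynomial σ ℚ) (LinearMap.ker (reduction d) ⧸
      (LinearMap.range (reduction d')).submoduleOf (LinearMap.ker (reduction d))) :=
    Module.Finite.of_surjective _ hsurj
  refine finite_restrictScalars _ fun i x => ?_
  obtain ⟨⟨x, hx⟩, rfl⟩ := Submodule.Quotient.mk_surjective _ x
  rw [← Submodule.Quotient.mk_smul, Submodule.Quotient.mk_eq_zero]
  obtain ⟨x, rfl⟩ := Submodule.Quotient.mk_surjective _ x
  have hzero : (X i : MvPolynomial σ ℚ) •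
      (Submodule.Quotient.mk x : M0 ⧸ (irrelevant σ • ⊤ : Submodule (MvPolynomial σ ℚ) M0)) = 0 :=
    (Submodule.Quotient.mk_eq_zero _).2
      (Submodule.smul_mem_smul (Ideal.subset_span ⟨i, rfl⟩) trivial)
  exact ⟨0, by simpa using hzero.symm⟩

theorem HomotopyEquivalent.hasFiniteDimensionalCohomology [Finite σ]
    {M N : GradedFactorization σ n w} (h : HomotopyEquivalent M N)
    (h₀ : Module.Finite (MvPolynomial σ ℚ) N.M0) (h₁ : Module.Finite (MvPolynomial σ ℚ) N.M1) :
    M.HasFiniteDimensionalCohomology := by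
  obtain ⟨f, g, ⟨k0, k1, -, -, e0, e1⟩, -⟩ := h
  exact ⟨finite_cohomology_of_homotopy M.d0 M.d1 N.d0 f.f0 f.f1 g.f0 g.f1 k0 k1 f.comm0 g.comm0 e0,
    finite_cohomology_of_homotopy M.d1 M.d0 N.d1 f.f1 f.f0 g.f1 g.f0 k1 k0 f.comm1 g.comm1 e1⟩

theorem finite_koszul (l : List (KoszulRow σ n)) :
    Module.Finite (MvPolynomial σ ℚ) (koszul l).M0 ∧
      Module.Finite (MvPolynomial σ ℚ) (koszul l).M1 := by
  induction l with
  | nil =>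
    exact ⟨inferInstanceAs (Module.Finite (MvPolynomial σ ℚ) (MvPolynomial σ ℚ)),
      inferInstanceAs (Module.Finite (MvPolynomial σ ℚ) PUnit)⟩
  | cons r l ih =>
    obtain ⟨_, _⟩ := ih
    exact ⟨inferInstanceAs (Module.Finite _ ((koszul l).M0 × (koszul l).M1)),
      inferInstanceAs (Module.Finite _ ((koszul l).M1 × (koszul l).M0))⟩

/-- Without internal marks, restriction of scalars does not shrink the ring. -/
theorem finite_restrict {I B : Type} [IsEmpty I] (N : FreeGradedModule (I ⊕ B))
    (h : Module.Finite (MvPolynomial (I ⊕ B) ℚ) N) : Module.Finite (MvPolynomial B ℚ) N.restrict := by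
  obtain ⟨S, hS⟩ := h.fg_top
  have hsurj : Function.Surjective (Sum.inr : B → I ⊕ B) := by
    rintro (i | b)
    · exact isEmptyElim i
    · exact ⟨b, rfl⟩
  let S' : Finset N.restrict := S
  let T : Submodule (MvPolynomial B ℚ) N.restrict := Submodule.span _ S'
  have key : ∀ x ∈ Submodule.span (MvPolynomial (I ⊕ B) ℚ) (S : Set N), x ∈ (T : Set N.restrict) := by
    intro x hx
    induction hx using Submodule.span_induction with
    | mem x hx => exact Submodule.subset_span (s := (S' : Set N.restrict)) hx
    | zero => exact T.zero_mem
    | add x y _ _ hx hy => exact T.add_mem hx hy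
    | smul p x _ hx =>
      obtain ⟨q, rfl⟩ := rename_surjective (R := ℚ) _ hsurj p
      exact T.smul_mem q hx
  exact ⟨⟨S', eq_top_iff.2 fun x _ => key x (hS ▸ trivial)⟩⟩

theorem HomotopyEquivalent.isomorphicInHmf {M N : GradedFactorization σ n w}
    (h : HomotopyEquivalent M N) (hM : M.HasFiniteDimensionalCohomology)
    (hN : N.HasFiniteDimensionalCohomology) : IsomorphicInHmf M N := by
  obtain ⟨f, g, h₁, h₂⟩ := h
  let F := Quotient.functor (Homotopic (σ := σ) (n := n) (w := w))
  have e₁ : F.map f ≫ F.map g = 𝟙 (F.obj M) := by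
    rw [← F.map_comp, ← F.map_id]
    exact CategoryTheory.Quotient.sound _ h₁
  have e₂ : F.map g ≫ F.map f = 𝟙 (F.obj N) := by
    rw [← F.map_comp, ← F.map_id]
    exact CategoryTheory.Quotient.sound _ h₂
  exact ⟨hM, hN, ⟨ObjectProperty.isoMk _ ⟨F.map f, F.map g, e₁, e₂⟩⟩⟩

end GradedFactorization

/-! ## The decompositions -/

open GradedFactorization

theorem represents_koszul_shift {σ : Type} {n : ℕ} {w : MvPolynomial σ ℚ}
    (l : List (KoszulRow σ n)) (hl : IsRegularRows l) (hw : koszulPotential l = w) (m : ℤ) :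
    Represents (((koszul l).ofEq hw).shift m) (koszulKer l) := by
  obtain ⟨E, O, N, h⟩ := exists_isResolution_koszul l hl
  exact ((h.ofEq hw).shift m).represents

theorem represents_upsilon (n : ℕ) : Represents (upsilon n) (koszulKer (upsilonRows n)) :=
  represents_koszul_shift (upsilonRows n) (isRegularRows_upsilonRows n) _ _

theorem finite_upsilon (n : ℕ) : Module.Finite (MvPolynomial (Fin 6) ℚ) (upsilon n).M0 ∧
    Module.Finite (MvPolynomial (Fin 6) ℚ) (upsilon n).M1 :=
  by
  obtain ⟨h₀, h₁⟩ := finite_koszul (upsilonRows n)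
  exact ⟨h₀, h₁⟩

theorem finite_factorization {B : Type} [Fintype B] {s : B → ℤˣ} (Γ : MarkedGraph B s Empty)
    (n : ℕ) : Module.Finite (MvPolynomial B ℚ) (Γ.factorization n).M0 ∧
      Module.Finite (MvPolynomial B ℚ) (Γ.factorization n).M1 :=
  ⟨finite_restrict ((koszul (Γ.rows n)).M0.shift _) (finite_koszul (Γ.rows n)).1,
    finite_restrict ((koszul (Γ.rows n)).M1.shift _) (finite_koszul (Γ.rows n)).2⟩

/-- A graph consisting of three wide edges decomposes into `Υ` and the factorization of a graph
with one wide edge and one arc. -/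
theorem homotopyEquivalent_upsilon_directSum (n : ℕ) {x₁ x₂ x₃ x₄ x₅ x₆ : MvPolynomial (Fin 6) ℚ}
    {i₇ i₈ i₉ : Fin 3} (hi : ∀ i, i = i₇ ∨ i = i₈ ∨ i = i₉) (h₇₈ : i₇ ≠ i₈) (h₇₉ : i₇ ≠ i₉)
    (h₈₉ : i₈ ≠ i₉) (hx : x₁ ≠ x₂) (hx₆ : IsHomog x₆ 2)
    (hα₁ : x₁ + x₂ + x₃ - (x₄ + x₅ + x₆) = s₁ - s₄)
    (hα₂ : x₁ * x₂ + x₁ * x₃ + x₂ * x₃ - (x₄ * x₅ + x₄ * x₆ + x₅ * x₆) = s₂ - s₅)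
    (hα₃ : x₁ * x₂ * x₃ - x₄ * x₅ * x₆ = s₃ - s₆)
    (Γ : MarkedGraph (Fin 6) sixSigns (Fin 3)) (hΓ : IsRegularRows (Γ.rows n))
    (hΓ₃ : Γ.wide.length = 3)
    (hΓI : rowIdeal (Γ.rows n) = tripleIdeal x₁ x₂ x₃ x₄ x₅ x₆ i₇ i₈ i₉)
    (Δ : MarkedGraph (Fin 6) sixSigns Empty) (hΔ : IsRegularRows (Δ.rows n))
    (hΔ₁ : Δ.wide.length = 1)
    (hΔI : rowIdeal (Δ.rows n) =
      Ideal.span {boundaryIncl Empty (x₁ + x₂ - (x₄ + x₅))} ⊔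
        (Ideal.span {boundaryIncl Empty (x₁ * x₂ - x₄ * x₅)} ⊔
          (Ideal.span {boundaryIncl Empty (x₃ - x₆)} ⊔ ⊥))) :
    HomotopyEquivalent (Γ.factorization n) ((upsilon n).directSum (Δ.factorization n)) := by
  obtain ⟨hI₁, hI₂, hI₃, hI₄⟩ := incl_mem_tripleIdeal (x₁ := x₁) (x₂ := x₂) (x₃ := x₃) (x₄ := x₄)
    (x₅ := x₅) (x₆ := x₆) (i₇ := i₇) (i₈ := i₈) (i₉ := i₉)
  let κ : MvPolynomial (Empty ⊕ Fin 6) ℚ →ₐ[ℚ] MvPolynomial (Fin 3 ⊕ Fin 6) ℚ :=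
    rename (Sum.map Empty.elim id)
  have hκ : ∀ p, κ (boundaryIncl Empty p) = boundaryIncl (Fin 3) p := fun p => by
    change rename _ (rename _ p) = rename _ p
    rw [rename_rename]
    rfl
  have hE : Function.Surjective (boundaryIncl Empty) := by
    refine rename_surjective _ ?_
    rintro (i | b)
    · exact i.elim
    · exact ⟨b, rfl⟩
  -- The generator of the second summand; its degree `2` accounts for the difference between the
  -- shifts `{-3}` and `{-1}`.
  let c : MvPolynomial (Fin 3 ⊕ Fin 6) ℚ := boundaryIncl (Fin 3) x₆ - X (im i₈)
  have hc : IsHomog c 2 := (hx₆.rename _).sub (isHomog_X _)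
  have hadd : ∀ (a a' : (koszul (upsilonRows n)).M0) (b b' : (koszul (Δ.rows n)).M0),
      koszulIncl (Γ.rows n) (boundaryIncl (Fin 3) (koszulProj (upsilonRows n) (a + a')) +
        c * κ (koszulProj (Δ.rows n) (b + b'))) =
      koszulIncl (Γ.rows n) (boundaryIncl (Fin 3) (koszulProj (upsilonRows n) a) +
        c * κ (koszulProj (Δ.rows n) b)) +
      koszulIncl (Γ.rows n) (boundaryIncl (Fin 3) (koszulProj (upsilonRows n) a') +
        c * κ (koszulProj (Δ.rows n) b')) := fun a a' b b' => by
    rw [← map_add (koszulIncl (Γ.rows n)), map_add (koszulProj (upsilonRows n)),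
      map_add (koszulProj (Δ.rows n)), map_add κ, map_add (boundaryIncl (Fin 3)), mul_add,
      add_add_add_comm]
  have hsmul : ∀ (r : MvPolynomial (Fin 6) ℚ) (a : (koszul (upsilonRows n)).M0)
      (b : (koszul (Δ.rows n)).M0),
      koszulIncl (Γ.rows n) (boundaryIncl (Fin 3) (koszulProj (upsilonRows n) (r • a)) +
        c * κ (koszulProj (Δ.rows n) (boundaryIncl Empty r • b))) =
      boundaryIncl (Fin 3) r • koszulIncl (Γ.rows n) (boundaryIncl (Fin 3)
        (koszulProj (upsilonRows n) a) + c * κ (koszulProj (Δ.rows n) b)) := fun r a b => by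
    rw [← map_smul (koszulIncl (Γ.rows n)), map_smul (koszulProj (upsilonRows n)),
      map_smul (koszulProj (Δ.rows n)), smul_eq_mul, smul_eq_mul, smul_eq_mul, map_mul κ, hκ,
      map_mul (boundaryIncl (Fin 3)), mul_left_comm, ← mul_add]
  -- On the represented modules `ψ` is `(p, q) ↦ p + (x₆ - x₈) q`.
  let ψ : ((upsilon n).directSum (Δ.factorization n)).M0 →ₗ[MvPolynomial (Fin 6) ℚ]
      (Γ.factorization n).M0 :=
    { toFun := fun y => koszulIncl (Γ.rows n) (boundaryIncl (Fin 3)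
        (koszulProj (upsilonRows n) y.1) + c * κ (koszulProj (Δ.rows n) y.2))
      map_add' := fun y z => hadd y.1 z.1 y.2 z.2
      map_smul' := fun r y => hsmul r y.1 y.2 }
  have hU : rowIdeal (upsilonRows n) =
      Ideal.span {s₁ - s₄} ⊔ (Ideal.span {s₂ - s₅} ⊔ (Ideal.span {s₃ - s₆} ⊔ ⊥)) := rfl
  rw [← hΓI] at hI₁ hI₂ hI₃ hI₄
  have hfst : ∀ p ∈ rowIdeal (upsilonRows n), boundaryIncl (Fin 3) p ∈ rowIdeal (Γ.rows n) := by
    change rowIdeal (upsilonRows n) ≤ (rowIdeal (Γ.rows n)).comap (boundaryIncl (Fin 3))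
    rw [hU, ← hα₁, ← hα₂, ← hα₃]
    simp only [sup_le_iff, Ideal.span_singleton_le_iff_mem, Ideal.mem_comap, bot_le, and_true]
    exact ⟨hI₁, hI₂, hI₃⟩
  have hsnd : ∀ p ∈ rowIdeal (Δ.rows n), c * κ p ∈ rowIdeal (Γ.rows n) := by
    -- `L` is the annihilator of `x₆ - x₈` modulo the rows of `Γ`. It contains `α₁`, `α₂` and `x₃ -
    -- x₆`, and these generate the remaining relations of `Δ`.
    let L : Ideal (MvPolynomial (Fin 3 ⊕ Fin 6) ℚ) :=
      Submodule.comap (LinearMap.mulLeft (MvPolynomial (Fin 3 ⊕ Fin 6) ℚ) c) (rowIdeal (Γ.rows n))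
    have hL : ∀ p, p ∈ L ↔ c * p ∈ rowIdeal (Γ.rows n) := fun _ => Iff.rfl
    have hL₁ := (rowIdeal (Γ.rows n)).mul_mem_left c hI₁
    have hL₂ := (rowIdeal (Γ.rows n)).mul_mem_left c hI₂
    have hL₁' : boundaryIncl (Fin 3) (x₁ + x₂ - (x₄ + x₅)) ∈ L := by
      convert sub_mem ((hL _).2 hL₁) ((hL _).2 hI₄) using 1
      rw [← map_sub]
      congr 1
      ring
    have hL₂' : boundaryIncl (Fin 3) (x₁ * x₂ - x₄ * x₅) ∈ L := by
      convert sub_mem (sub_mem ((hL _).2 hL₂) (L.mul_mem_left (boundaryIncl (Fin 3) x₃) hL₁'))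
        (L.mul_mem_left (boundaryIncl (Fin 3) (x₄ + x₅)) ((hL _).2 hI₄)) using 1
      rw [← map_mul, ← map_mul, ← map_sub, ← map_sub]
      congr 1
      ring
    change rowIdeal (Δ.rows n) ≤ L.comap κ
    rw [hΔI]
    simp only [sup_le_iff, Ideal.span_singleton_le_iff_mem, Ideal.mem_comap, hκ, bot_le, and_true]
    exact ⟨hL₁', hL₂', hI₄⟩
  let K := (rowIdeal (Δ.rows n)).comap (boundaryIncl Empty)
  have hK : x₁ + x₂ - (x₄ + x₅) ∈ K ∧ x₁ * x₂ - x₄ * x₅ ∈ K ∧ x₃ - x₆ ∈ K := by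
    have h : rowIdeal (Δ.rows n) ≤ rowIdeal (Δ.rows n) := le_rfl
    nth_rw 1 [hΔI] at h
    simp only [sup_le_iff, Ideal.span_singleton_le_iff_mem, bot_le, and_true] at h
    exact h
  have hK₁ : x₁ + x₂ + x₃ - (x₄ + x₅ + x₆) ∈ K := by
    convert add_mem hK.1 hK.2.2 using 1
    ring
  have hK₂ : x₁ * x₂ + x₁ * x₃ + x₂ * x₃ - (x₄ * x₅ + x₄ * x₆ + x₅ * x₆) ∈ K := by
    convert add_mem (add_mem hK.2.1 (K.mul_mem_left x₃ hK.1))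
      (K.mul_mem_left (x₄ + x₅) hK.2.2) using 1
    ring
  refine (Γ.represents_factorization n hΓ).homotopyEquivalent
    ((represents_upsilon n).directSum (Δ.represents_factorization n hΔ)) ψ ?_ ?_ ?_
  · rintro j y ⟨hy, hy'⟩
    refine koszulIncl_mem _ (IsHomog.add ?_ ?_)
    · rw [hΓ₃]
      exact (isHomog_koszulProj hy).rename _
    · convert hc.mul ((isHomog_koszulProj hy').rename (Sum.map Empty.elim id)) using 1
      rw [hΓ₃, hΔ₁]
      push_cast
      ring
  · intro y
    change koszulProj (Γ.rows n) (koszulIncl (Γ.rows n) _) ∈ rowIdeal (Γ.rows n) ↔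
      koszulProj (upsilonRows n) y.1 ∈ rowIdeal (upsilonRows n) ∧
        koszulProj (Δ.rows n) y.2 ∈ rowIdeal (Δ.rows n)
    rw [koszulProj_koszulIncl]
    constructor
    · obtain ⟨q, hq⟩ := hE (koszulProj (Δ.rows n) y.2)
      rw [← hq, hκ]
      intro h
      rw [hΓI] at h
      refine mem_of_mem_tripleIdeal hi h₇₈ h₇₉ h₈₉ hx h ?_ ?_ ?_ hK₁ hK₂ hK.2.2
      · rw [hα₁, hU]
        exact Ideal.mem_sup_left (Ideal.mem_span_singleton_self _)
      · rw [hα₂, hU]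
        exact Ideal.mem_sup_right (Ideal.mem_sup_left (Ideal.mem_span_singleton_self _))
      · rw [hα₃, hU]
        exact Ideal.mem_sup_right (Ideal.mem_sup_right
          (Ideal.mem_sup_left (Ideal.mem_span_singleton_self _)))
    · rintro ⟨h, h'⟩
      exact add_mem (hfst _ h) (hsnd _ h')
  · intro j x hxj
    obtain ⟨g₁, g₂, g₅⟩ : boundaryIncl (Fin 3) x₁ + boundaryIncl (Fin 3) x₂ -
          (X (im i₇) + X (im i₈)) ∈ rowIdeal (Γ.rows n) ∧
        boundaryIncl (Fin 3) x₁ * boundaryIncl (Fin 3) x₂ - X (im i₇) * X (im i₈) ∈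
          rowIdeal (Γ.rows n) ∧
        X (im i₇) + X (im i₉) - (boundaryIncl (Fin 3) x₄ + boundaryIncl (Fin 3) x₅) ∈
          rowIdeal (Γ.rows n) := by
      rw [hΓI]
      exact ⟨mem_tripleIdeal.2 ⟨1, 0, 0, 0, 0, 0, by ring⟩,
        mem_tripleIdeal.2 ⟨0, 1, 0, 0, 0, 0, by ring⟩,
        mem_tripleIdeal.2 ⟨0, 0, 0, 0, 1, 0, by ring⟩⟩
    have hg : IsHomog (koszulProj (Γ.rows n) x) (j - -3) := by
      have hg : IsHomog (koszulProj (Γ.rows n) x) (j - -(Γ.wide.length : ℤ)) :=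
        isHomog_koszulProj hxj
      rw [hΓ₃] at hg
      exact hg
    obtain ⟨a, b, hab⟩ := exists_normalForm (x₆ := x₆) hi g₁ g₂ g₅ (koszulProj (Γ.rows n) x)
    -- The coefficients of the normal form need not be homogeneous; passing to the component of the
    -- degree of `x` makes them so.
    have hab' := homogComponent_mem_rowIdeal hab (j - -3)
    rw [map_sub, map_add, hg.homogComponent_eq, hc.homogComponent_mul, homogComponent_rename,
      homogComponent_rename] at hab'
    refine ⟨(koszulIncl (upsilonRows n) (homogComponent (j - -3) a),
      koszulIncl (Δ.rows n) (boundaryIncl Empty (homogComponent (j - -3 - 2) b))),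
      ⟨koszulIncl_mem (upsilonRows n) (isHomog_homogComponent (j - -3) a), ?_⟩, ?_⟩
    · refine koszulIncl_mem _ ?_
      convert (isHomog_homogComponent _ _).rename _ using 1
      rw [hΔ₁]
      push_cast
      ring
    · have key : ∀ x' : (koszul (Γ.rows n)).M0, koszulProj (Γ.rows n) x' -
          (boundaryIncl (Fin 3) (homogComponent (j - -3) a) +
            c * boundaryIncl (Fin 3) (homogComponent (j - -3 - 2) b)) ∈ rowIdeal (Γ.rows n) →
          x' - koszulIncl (Γ.rows n) (boundaryIncl (Fin 3) (koszulProj (upsilonRows n)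
            (koszulIncl (upsilonRows n) (homogComponent (j - -3) a))) +
            c * κ (koszulProj (Δ.rows n) (koszulIncl (Δ.rows n)
              (boundaryIncl Empty (homogComponent (j - -3 - 2) b))))) ∈ koszulKer (Γ.rows n) := by
        intro x' h
        rwa [koszulKer, Submodule.mem_comap, map_sub, koszulProj_koszulIncl,
          koszulProj_koszulIncl, koszulProj_koszulIncl, hκ]
      exact key x hab'

theorem homotopyEquivalent_graph₁ (n : ℕ) : HomotopyEquivalent (graph₁.factorization n)
    ((upsilon n).directSum (graph₄.factorization n)) := by
  refine homotopyEquivalent_upsilon_directSum n (x₁ := X 0) (x₂ := X 1) (x₃ := X 2) (x₄ := X 3)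
    (x₅ := X 4) (x₆ := X 5) (i₇ := 0) (i₈ := 1) (i₉ := 2) (by decide) (by decide) (by decide)
    (by decide) (X_injective.ne (by decide)) (isHomog_X _) rfl rfl rfl graph₁
    (isRegularRows_graph₁ n) rfl ?_ graph₄ (isRegularRows_graph₄ n) rfl ?_
  · simp only [tripleIdeal, boundaryIncl, rename_X]
    rfl
  · simp only [boundaryIncl, map_add, map_sub, map_mul, rename_X]
    rfl

/-- `Γ₃` is the reflection of `Γ₁`: exchange `x₁` with `x₃`, `x₄` with `x₆` and `x₇` with `x₈`. The
symmetric functions defining `Υ` are invariant, while `Γ₄` turns into `Γ₂`. -/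
theorem homotopyEquivalent_graph₃ (n : ℕ) : HomotopyEquivalent (graph₃.factorization n)
    ((upsilon n).directSum (graph₂.factorization n)) := by
  refine homotopyEquivalent_upsilon_directSum n (x₁ := X 2) (x₂ := X 1) (x₃ := X 0) (x₄ := X 5)
    (x₅ := X 4) (x₆ := X 3) (i₇ := 1) (i₈ := 0) (i₉ := 2) (by decide) (by decide) (by decide)
    (by decide) (X_injective.ne (by decide)) (isHomog_X _) ?_ ?_ ?_ graph₃
    (isRegularRows_graph₃ n) rfl ?_ graph₂ (isRegularRows_graph₂ n) rfl ?_
  · rw [s₁, s₄]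
    ring
  · rw [s₂, s₅]
    ring
  · rw [s₃, s₆]
    ring
  · simp only [tripleIdeal, boundaryIncl, rename_X]
    rw [add_comm (X (bd 2)), mul_comm (X (bd 2)), add_comm (X (im 1)) (X (im 0)),
      mul_comm (X (im 1)) (X (im 0)), add_comm (X (im 0)) (X (bd 0)),
      mul_comm (X (im 0)) (X (bd 0)), add_comm (X (im 2)) (X (bd 3)),
      mul_comm (X (im 2)) (X (bd 3)), add_comm (X (im 1)) (X (im 2)),
      mul_comm (X (im 1)) (X (im 2)), add_comm (X (bd 5)), mul_comm (X (bd 5))]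
    rfl
  · simp only [boundaryIncl, map_add, map_sub, map_mul, rename_X]
    rw [add_comm (X (bd 2)), mul_comm (X (bd 2)), add_comm (X (bd 5)), mul_comm (X (bd 5))]
    rfl

end KhovanovRozansky

end

/-! ### The isomorphisms in `hmf_w` -/

theorem mainTheorem5 (n : ℕ) (hn : 1 ≤ n) :
    IsomorphicInHmf (graph₁.factorization n) ((upsilon n).directSum (graph₄.factorization n)) ∧
      IsomorphicInHmf ((graph₁.factorization n).directSum (graph₂.factorization n))
        ((graph₃.factorization n).directSum (graph₄.factorization n)) := by
  have h₁ := homotopyEquivalent_graph₁ n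
  have h₃ := homotopyEquivalent_graph₃ n
  -- Both sides of the second isomorphism are compared with `(Υ ⊕ C(Γ₄)) ⊕ C(Γ₂)`. It has finite
  -- rank, so finite-dimensionality of the cohomology also passes to the sums containing `C(Γ₁)` and
  -- `C(Γ₃)`, which have infinite rank over `R'`.
  have h₁₂ := h₁.directSum (.refl (graph₂.factorization n))
  have h₃₄ := (h₃.directSum (.refl (graph₄.factorization n))).trans
    (GradedFactorization.homotopyEquivalent_directSum_right_comm _ _ _)
  obtain ⟨_, _⟩ := finite_upsilon n
  obtain ⟨_, _⟩ := finite_factorization graph₂ n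
  obtain ⟨_, _⟩ := finite_factorization graph₄ n
  have f₀ : Module.Finite (MvPolynomial (Fin 6) ℚ)
      ((upsilon n).directSum (graph₄.factorization n)).M0 :=
    inferInstanceAs (Module.Finite _ ((upsilon n).M0 × (graph₄.factorization n).M0))
  have f₁ : Module.Finite (MvPolynomial (Fin 6) ℚ)
      ((upsilon n).directSum (graph₄.factorization n)).M1 :=
    inferInstanceAs (Module.Finite _ ((upsilon n).M1 × (graph₄.factorization n).M1))
  have f₂ : Module.Finite (MvPolynomial (Fin 6) ℚ) (((upsilon n).directSum
      (graph₄.factorization n)).directSum (graph₂.factorization n)).M0 :=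
    inferInstanceAs (Module.Finite _ (((upsilon n).directSum (graph₄.factorization n)).M0 ×
      (graph₂.factorization n).M0))
  have f₃ : Module.Finite (MvPolynomial (Fin 6) ℚ) (((upsilon n).directSum
      (graph₄.factorization n)).directSum (graph₂.factorization n)).M1 :=
    inferInstanceAs (Module.Finite _ (((upsilon n).directSum (graph₄.factorization n)).M1 ×
      (graph₂.factorization n).M1))
  exact ⟨h₁.isomorphicInHmf (h₁.hasFiniteDimensionalCohomology f₀ f₁)
      ((GradedFactorization.HomotopyEquivalent.refl _).hasFiniteDimensionalCohomology f₀ f₁),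
    (h₁₂.trans h₃₄.symm).isomorphicInHmf (h₁₂.hasFiniteDimensionalCohomology f₂ f₃)
      (h₃₄.hasFiniteDimensionalCohomology f₂ f₃)⟩
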